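/- For $n\in\mathbb N=\{1,2,3,\dots\}$ let $C_n\subseteq\mathbb R^2$ be the circle of radius $\frac1n$ centered at $(\frac1n,0)$, let $\ell_n:[0,1]\to C_n$, $\ell_n(t)=\frac1n(1-\cos 2\pi t,\ \sin 2\pi t)$, and let $\mathbb H=\bigcup_{n\ge 1}C_n\subseteq\mathbb R^2$ be the Hawaiian Earring. For each $n\in\mathbb N$ let $P_n=D_n\setminus(D_{n,1}^\circ\cup D_{n,2}^\circ)$ be a pair of pants, where $D_n\subseteq\mathbb R^2$ is a closed disk and $D_{n,1},D_{n,2}$ are disjoint closed disks in the interior of $D_n$, and let $\alpha_n,\beta_n,\gamma_n$ be clockwise parametrizations on $[0,1]$ of $\partial D_n,\partial D_{n,1},\partial D_{n,2}$. (Concretely, take every $D_n$ to be the unit disk, and $D_{n,1}$, $D_{n,2}$ to be the disks of radius $\frac14$ centered at $(-\frac12,0)$ and $(\frac12,0)$, with each parametrization of constant speed and starting at the lowest point of its circle.) The Hawaiian Pants $\mathbb P$ is the adjunction space obtained from $\mathbb H$ by attaching all $P_n$ along their boundaries via $\alpha_n(t)\mapsto\ell_n(t)$, $\beta_n(t)\mapsto\ell_{2n}(t)$,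 $\gamma_n(t)\mapsto\ell_{2n+1}(t)$; that is, the corresponding quotient of the topological disjoint union of $\mathbb H$ and all the $P_n$, with the quotient topology. For a path-connected space $X$ with base point $x_0$ and a subgroup $H\le\pi_1(X,x_0)$, let $\widetilde X_H$ be the set of equivalence classes $\langle\alpha\rangle$ of paths $\alpha:[0,1]\to X$ with $\alpha(0)=x_0$, where $\alpha\sim\alpha'$ if and only if $\alpha(1)=\alpha'(1)$ and the class of the loop $\alpha\cdot\alpha'^{-}$ (the path $\alpha$ followed by the reverse of $\alpha'$) lies in $H$. Give $\widetilde X_H$ the topology generated by the sets $\langle\alpha,U\rangle=\{\langle\alpha\cdot\gamma\rangle\mid\gamma\text{ a path in }U\text{ with }\gamma(0)=\alpha(1)\}$, where $U\subseteq X$ is open and $\alpha(1)\in U$, and let $p_H:\widetilde X_H\to X$, $p_H(\langle\alpha\rangle)=\alpha(1)$. For a path $\beta$ in $X$ from $x$ to $y$, the standard monodromy $\Phi_\beta:p_H^{-1}(x)\to p_H^{-1}(y)$ is given by $\Phi_\beta(\langle\alpha\rangle)=\langle\alpha\cdot\beta\rangle$. The space $X$ has the discrete monodromy property relative to $H$ if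 for all $x,y\in X$ and every path $\beta$ in $X$ from $x$ to $y$, either $\Phi_\beta$ is the identity function, or its graph is a discrete subset of $p_H^{-1}(x)\times p_H^{-1}(y)\subseteq\widetilde X_H\times\widetilde X_H$ (that is, the graph is discrete in the subspace topology). The space $X$ has the discrete monodromy property if it has it relative to the trivial subgroup $H=\{1\}$ (for any choice of the base point $x_0$). Theorem. The Hawaiian Pants $\mathbb P$ has the discrete monodromy property. -/

import Mathlib

open scoped unitInterval

noncomputable section

/-! ### The path-class space of a based space relative to a subgroup of the fundamental group -/

namespace PathClass

universe u

variable {X : Type u} [TopologicalSpace X] {x₀ : X}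

/-- Two paths `α`, `β` starting at `x₀` are equivalent relative to `H` if `α(1) = β(1)` and
`[α · β⁻] ∈ H`. (Mathlib multiplies in the fundamental group in the order opposite to concatenation;
membership of a single class in a subgroup is not affected by this.) -/
def Rel (H : Subgroup (FundamentalGroup X x₀)) (a b : Σ y : X, Path x₀ y) : Prop :=
  ∃ h : a.1 = b.1,
    FundamentalGroup.fromPath (Path.Homotopic.Quotient.mk (a.2.trans (b.2.cast rfl h).symm)) ∈ H

theorem rel_mk {H : Subgroup (FundamentalGroup X x₀)} {y : X} (α β : Path x₀ y) :
    Rel H ⟨y, α⟩ ⟨y, β⟩ ↔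
      FundamentalGroup.fromPath (Path.Homotopic.Quotient.mk (α.trans β.symm)) ∈ H :=
  ⟨fun ⟨_, h⟩ => h, fun h => ⟨rfl, h⟩⟩

theorem rel_equivalence (H : Subgroup (FundamentalGroup X x₀)) : Equivalence (Rel H) where
  refl := by
    rintro ⟨y, α⟩
    rw [rel_mk, Path.Homotopic.Quotient.mk_trans, Path.Homotopic.Quotient.mk_symm,
      Path.Homotopic.Quotient.trans_symm]
    exact H.one_mem
  symm := by
    rintro ⟨y, α⟩ ⟨z, β⟩ ⟨h, hH⟩
    obtain rfl : y = z := h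
    rw [rel_mk]
    have := H.inv_mem hH
    rw [FundamentalGroup.inv_def] at this
    have e : Path.Homotopic.Quotient.mk (β.trans α.symm) =
        (Path.Homotopic.Quotient.mk (α.trans β.symm)).symm := by
      rw [← Path.Homotopic.Quotient.mk_symm, Path.trans_symm, Path.symm_symm]
    rw [e]
    exact this
  trans := by
    rintro ⟨y, α⟩ ⟨z, β⟩ ⟨w, γ⟩ ⟨h, hH⟩ ⟨k, kH⟩
    obtain rfl : y = z := h
    obtain rfl : y = w := k
    rw [rel_mk]
    have := H.mul_mem kH hH
    rw [FundamentalGroup.mul_def] at this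
    have e : Path.Homotopic.Quotient.mk (α.trans γ.symm) =
        (Path.Homotopic.Quotient.mk (α.trans β.symm)).trans
          (Path.Homotopic.Quotient.mk (β.trans γ.symm)) := by
      simp only [Path.Homotopic.Quotient.mk_trans, Path.Homotopic.Quotient.mk_symm]
      rw [Path.Homotopic.Quotient.trans_assoc,
        ← Path.Homotopic.Quotient.trans_assoc (Path.Homotopic.Quotient.mk β).symm,
        Path.Homotopic.Quotient.symm_trans, Path.Homotopic.Quotient.refl_trans]
    rw [e]
    exact this

/-- Equivalence of paths relative to `H`, as a setoid. -/
def setoid (H : Subgroup (FundamentalGroup X x₀)) : Setoid (Σ y : X, Path x₀ y) :=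
  ⟨Rel H, rel_equivalence H⟩

/-- The set `X̃_H` of equivalence classes `⟨α⟩` of paths `α` in `X` starting at `x₀`. -/
def Space (H : Subgroup (FundamentalGroup X x₀)) : Type u :=
  Quotient (setoid H)

/-- The class `⟨α⟩` of a path `α` starting at `x₀`. -/
def mk (H : Subgroup (FundamentalGroup X x₀)) {y : X} (α : Path x₀ y) : Space H :=
  Quotient.mk (setoid H) ⟨y, α⟩

/-- The set `⟨α, U⟩ = {⟨α · γ⟩ | γ a path in U starting at α(1)}`. -/
def basicOpen (H : Subgroup (FundamentalGroup X x₀)) {y : X} (α : Path x₀ y) (U : Set X) :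
    Set (Space H) :=
  {e | ∃ (z : X) (γ : Path y z), Set.range γ ⊆ U ∧ e = mk H (α.trans γ)}

/-- The topology on `X̃_H` generated by the sets `⟨α, U⟩` with `U` open and `α(1) ∈ U`. -/
instance (H : Subgroup (FundamentalGroup X x₀)) : TopologicalSpace (Space H) :=
  TopologicalSpace.generateFrom
    {S | ∃ (y : X) (α : Path x₀ y) (U : Set X), IsOpen U ∧ y ∈ U ∧ S = basicOpen H α U}

/-- The endpoint projection `p_H : X̃_H → X`, `p_H ⟨α⟩ = α(1)`. -/
def proj (H : Subgroup (FundamentalGroup X x₀)) : Space H → X :=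
  Quotient.lift (fun a => a.1) (fun _ _ h => h.1)

/-- The fiber `p_H⁻¹(x)`; it carries the subspace topology of `X̃_H`. -/
abbrev Fiber (H : Subgroup (FundamentalGroup X x₀)) (x : X) : Type u :=
  {e : Space H // proj H e = x}

theorem mk_trans_eq {H : Subgroup (FundamentalGroup X x₀)} {x y : X} {α α' : Path x₀ x}
    (h : Rel H ⟨x, α⟩ ⟨x, α'⟩) (β : Path x y) : mk H (α.trans β) = mk H (α'.trans β) := by
  refine Quotient.sound (s := setoid H) ((rel_mk _ _).2 ?_)
  have e : Path.Homotopic.Quotient.mk ((α.trans β).trans (α'.trans β).symm) =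
      Path.Homotopic.Quotient.mk (α.trans α'.symm) := by
    rw [Path.trans_symm]
    simp only [Path.Homotopic.Quotient.mk_trans, Path.Homotopic.Quotient.mk_symm]
    rw [Path.Homotopic.Quotient.trans_assoc,
      ← Path.Homotopic.Quotient.trans_assoc (Path.Homotopic.Quotient.mk β),
      Path.Homotopic.Quotient.trans_symm, Path.Homotopic.Quotient.refl_trans]
  rw [e]
  exact (rel_mk _ _).1 h

/-- The standard monodromy `Φ_β : p_H⁻¹(x) → p_H⁻¹(y)`, `Φ_β ⟨α⟩ = ⟨α · β⟩`, of a path `β` from `x`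
to `y`. -/
def monodromy (H : Subgroup (FundamentalGroup X x₀)) {x y : X} (β : Path x y) (e : Fiber H x) :
    Fiber H y :=
  Quotient.hrecOn (motive := fun q : Space H => proj H q = x → Fiber H y) e.1
    (fun a h => ⟨mk H ((a.2.cast rfl (Eq.symm h)).trans β), rfl⟩)
    (by
      rintro ⟨z, α⟩ ⟨z', α'⟩ ⟨h, hH⟩
      obtain rfl : z = z' := h
      refine heq_of_eq (funext fun hz => ?_)
      obtain rfl : z = x := hz
      exact Subtype.ext (mk_trans_eq ((rel_mk _ _).2 hH) β))
    e.2

theorem monodromy_mk (H : Subgroup (FundamentalGroup X x₀)) {x y : X} (α : Path x₀ x)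
    (β : Path x y) : monodromy H β ⟨mk H α, rfl⟩ = ⟨mk H (α.trans β), rfl⟩ :=
  rfl

/-- `X` has the discrete monodromy property relative to `H ≤ π₁(X, x₀)`: every standard monodromy
`Φ_β : p_H⁻¹(x) → p_H⁻¹(y)` is the identity function, or its graph is a discrete subset of
`p_H⁻¹(x) × p_H⁻¹(y)`. -/
def DiscreteMonodromyRel (H : Subgroup (FundamentalGroup X x₀)) : Prop :=
  ∀ (x y : X) (β : Path x y),
    (∀ e : Fiber H x, (monodromy H β e : Space H) = (e : Space H)) ∨
      IsDiscrete {q : Fiber H x × Fiber H y | monodromy H β q.1 = q.2}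

end PathClass

/-- The discrete monodromy property of a space: the discrete monodromy property relative to the
trivial subgroup of the fundamental group, at every base point. -/
def DiscreteMonodromyProperty (X : Type*) [TopologicalSpace X] : Prop :=
  ∀ x₀ : X, PathClass.DiscreteMonodromyRel (⊥ : Subgroup (FundamentalGroup X x₀))

/-! ### The Hawaiian Pants

The plane `ℝ²` is identified with `ℂ`. -/

namespace HawaiianPants

/-- The circle `C_n` of radius `1/n` centered at `(1/n, 0)`, for `n = 1, 2, 3, …`. -/
def circle (n : ℕ+) : Set ℂ :=
  Metric.sphere ((1 / (n : ℝ) : ℝ) : ℂ) (1 / (n : ℝ))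

/-- The Hawaiian Earring `⋃ₙ C_n`. -/
def earring : Set ℂ := ⋃ n : ℕ+, circle n

theorem ell_mem (n : ℕ+) (t : ℝ) :
    (⟨1 / (n : ℝ) * (1 - Real.cos (2 * Real.pi * t)), 1 / (n : ℝ) * Real.sin (2 * Real.pi * t)⟩ : ℂ)
      ∈ circle n := by
  rw [circle, mem_sphere_iff_norm, Complex.norm_def, Complex.normSq_apply]
  have hn : (0 : ℝ) ≤ 1 / (n : ℝ) := by positivity
  have h := Real.sin_sq_add_cos_sq (2 * Real.pi * t)
  rw [Real.sqrt_eq_iff_mul_self_eq (add_nonneg (mul_self_nonneg _) (mul_self_nonneg _)) hn]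
  simp only [Complex.sub_re, Complex.sub_im, Complex.ofReal_re, Complex.ofReal_im]
  linear_combination ((1 / (n : ℝ)) ^ 2) * h

/-- The loop `ℓ_n(t) = (1/n) (1 - cos 2πt, sin 2πt)` running once around `C_n`. -/
def ell (n : ℕ+) (t : I) : earring :=
  ⟨_, Set.mem_iUnion.2 ⟨n, ell_mem n t⟩⟩

/-- The pair of pants: a closed disk with two disjoint open disks in its interior removed. -/
def pants : Set ℂ :=
  Metric.closedBall 0 1 \ (Metric.ball (-1 / 2) (1 / 4) ∪ Metric.ball (1 / 2) (1 / 4))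

/-- The clockwise parametrization, starting at the lowest point, of the circle with center `c` and
radius `r`. -/
def clockwise (c : ℂ) (r : ℝ) (t : ℝ) : ℂ :=
  c - r * Complex.I * Complex.exp ((-(2 * Real.pi * t) : ℝ) * Complex.I)

theorem norm_clockwise_sub (c : ℂ) {r : ℝ} (hr : 0 ≤ r) (t : ℝ) : ‖clockwise c r t - c‖ = r := by
  rw [clockwise, sub_sub_cancel_left, norm_neg, norm_mul, norm_mul, Complex.norm_exp_ofReal_mul_I,
    Complex.norm_I, Complex.norm_real, Real.norm_of_nonneg hr, mul_one, mul_one]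

theorem outer_mem (t : ℝ) : clockwise 0 1 t ∈ pants := by
  have h := norm_clockwise_sub 0 zero_le_one t
  rw [sub_zero] at h
  have h1 := norm_sub_norm_le (clockwise 0 1 t) (-1 / 2)
  have h2 := norm_sub_norm_le (clockwise 0 1 t) (1 / 2)
  norm_num [h] at h1 h2
  simp only [pants, Set.mem_sdiff, Set.mem_union, mem_closedBall_iff_norm, mem_ball_iff_norm,
    sub_zero, h, not_or, not_lt]
  refine ⟨le_rfl, ?_, ?_⟩ <;> norm_num <;> linarith

theorem left_mem (t : ℝ) : clockwise (-1 / 2) (1 / 4) t ∈ pants := by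
  have h := norm_clockwise_sub (-1 / 2) (by norm_num : (0 : ℝ) ≤ 1 / 4) t
  have h1 := norm_add_le (clockwise (-1 / 2) (1 / 4) t - (-1 / 2)) (-1 / 2)
  have h2 := norm_sub_le (clockwise (-1 / 2) (1 / 4) t - (-1 / 2))
    (clockwise (-1 / 2) (1 / 4) t - 1 / 2)
  rw [sub_add_cancel, h] at h1
  rw [sub_sub_sub_cancel_left, h] at h2
  norm_num at h1 h2
  simp only [pants, Set.mem_sdiff, Set.mem_union, mem_closedBall_iff_norm, mem_ball_iff_norm,
    sub_zero, h, not_or, not_lt]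
  norm_num
  constructor <;> linarith

theorem right_mem (t : ℝ) : clockwise (1 / 2) (1 / 4) t ∈ pants := by
  have h := norm_clockwise_sub (1 / 2) (by norm_num : (0 : ℝ) ≤ 1 / 4) t
  have h1 := norm_add_le (clockwise (1 / 2) (1 / 4) t - 1 / 2) (1 / 2)
  have h2 := norm_sub_le (clockwise (1 / 2) (1 / 4) t - (-1 / 2))
    (clockwise (1 / 2) (1 / 4) t - 1 / 2)
  rw [sub_add_cancel, h] at h1
  rw [sub_sub_sub_cancel_left, h] at h2
  norm_num at h1 h2
  simp only [pants, Set.mem_sdiff, Set.mem_union, mem_closedBall_iff_norm, mem_ball_iff_norm,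
    sub_zero, h, not_or, not_lt]
  norm_num
  constructor <;> linarith

/-- The clockwise parametrization of the outer boundary circle of the pair of pants. -/
def outer (t : I) : pants := ⟨clockwise 0 1 t, outer_mem t⟩

/-- The clockwise parametrization of the boundary circle of the first removed disk. -/
def left (t : I) : pants := ⟨clockwise (-1 / 2) (1 / 4) t, left_mem t⟩

/-- The clockwise parametrization of the boundary circle of the second removed disk. -/
def right (t : I) : pants := ⟨clockwise (1 / 2) (1 / 4) t, right_mem t⟩

/-- The gluing of the boundaries of the pairs of pants `P_n`, `n = 1, 2, 3, …`, to the Hawaiian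
Earring: the outer boundary circle of `P_n` is attached along `ℓ_n`, the two inner boundary circles
along `ℓ_{2n}` and `ℓ_{2n+1}`. -/
inductive Glue : earring ⊕ (Σ _ : ℕ+, pants) → earring ⊕ (Σ _ : ℕ+, pants) → Prop
  | outer (n : ℕ+) (t : I) : Glue (Sum.inr ⟨n, outer t⟩) (Sum.inl (ell n t))
  | left (n : ℕ+) (t : I) : Glue (Sum.inr ⟨n, left t⟩) (Sum.inl (ell (2 * n) t))
  | right (n : ℕ+) (t : I) : Glue (Sum.inr ⟨n, right t⟩) (Sum.inl (ell (2 * n + 1) t))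

end HawaiianPants

/-- The Hawaiian Pants: the adjunction space obtained from the Hawaiian Earring by attaching the
pairs of pants `P_n`, with the quotient topology of the topological disjoint union. -/
def HawaiianPants : Type := Quot HawaiianPants.Glue

instance : TopologicalSpace HawaiianPants :=
  inferInstanceAs (TopologicalSpace (Quot HawaiianPants.Glue))

end

/-! Near a point (⟨α⟩, ⟨α·β⟩), the graph of Φ_β consists of pairs (⟨α·δ⟩, ⟨α·β·ε⟩) with δ, ε small
loops at the ends of β and δ·β ≃ β·ε. It is therefore enough that such a δ is always null-homotopic
(`discreteMonodromyProperty_of`). Away from the base point of the earring small loops are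
null-homotopic (`exists_nhds_of_ne`), which leaves the loops β at the base point. A trivial β has
identity monodromy; otherwise β represents some g ≠ 1. Small loops at the base point represent
elements of the subgroups `tail N`, which come from the circles and the seams of pants beyond N
(`exists_nhds_base`). The tails intersect trivially, so g lies outside one of them
(`eq_one_of_forall_mem_tail`), and each tail is malnormal, so that a g = g a' with a, a' in it
forces a = 1 (`eq_one_of_mul_eq_mul`).

Both facts are algebra in a `PantsGroup`. The group Γ is generated by the image of the earring group
B and two seam classes X_n, Y_n for every pair of pants, with only the relations L_n = Y_n⁻¹
L_{2n+1} Y_n · X_n⁻¹ L_{2n} X_n. As 2n and 2n + 1 exceed n, the first N circles can be eliminated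
from N downwards, so Γ behaves like the free product of `tail N` and a free group on the first N
pairs of seams (`exists_lift`, `eq_top_of_tail_le`). Malnormality is read off from an action of Γ on
itself in which the tail is made to fix its own points. For the intersection, killing the first K
seams fixes an element of all tails but moves it, for large K, into the part of B beyond K. Since B
embeds in Γ, one element of B survives every collapse, and such an element is null-homotopic by an
infinite concatenation of shrinking homotopies (`eq_one_of_collapseHom`). That B embeds follows from
a permutation representation of B in which all circles act as translations: these are conjugate to
one another, and a translation is a product of two of its conjugates (`exists_conj`).

The presentation comes from a form of van Kampen's theorem. A homomorphism is a function on all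
paths that respects constant paths and squares (`IsHomOn`); such functions glue over any open cover
on whose overlaps they agree (`exists_isHomOn_univ`), with no condition of connectedness. Hence all
pairs of pants are attached at once. -/

noncomputable section

open Set Topology

/-! ### Homomorphisms from paths to a group -/

namespace PathHom

variable {X Y Z Q : Type*} [TopologicalSpace X] [TopologicalSpace Y] [TopologicalSpace Z] [Group Q]

/-- The bottom edge of a square. -/
def bot (F : C(I × I, X)) : C(I, X) := ⟨fun s => F (s, 0), by fun_prop⟩

/-- The top edge of a square. -/
def top (F : C(I × I, X)) : C(I, X) := ⟨fun s => F (s, 1), by fun_prop⟩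

/-- The left edge of a square. -/
def lft (F : C(I × I, X)) : C(I, X) := ⟨fun t => F (0, t), by fun_prop⟩

/-- The right edge of a square. -/
def rgt (F : C(I × I, X)) : C(I, X) := ⟨fun t => F (1, t), by fun_prop⟩

/-- The restriction of a path to the interval from `a` to `b`, reparametrized. -/
def sub (γ : C(I, X)) (a b : I) : C(I, X) :=
  γ.comp ⟨fun t => Icc.convexComb a b t, by fun_prop⟩

theorem sub_apply (γ : C(I, X)) (a b t : I) : sub γ a b t = γ (Icc.convexComb a b t) := rfl

@[simp] theorem sub_zero_one (γ : C(I, X)) : sub γ 0 1 = γ := by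
  ext t; simp [sub_apply]

@[simp] theorem sub_self (γ : C(I, X)) (a : I) : sub γ a a = ContinuousMap.const I (γ a) := by
  ext t; simp [sub_apply]

theorem convexComb_mono {a b s t : I} (hab : a ≤ b) (hst : s ≤ t) :
    Icc.convexComb a b s ≤ Icc.convexComb a b t := by
  rw [← Subtype.coe_le_coe] at *
  simp only [Icc.coe_convexComb]
  nlinarith

theorem convexComb_mem {a b c d t : I} (ha : a ∈ Icc c d) (hb : b ∈ Icc c d) :
    Icc.convexComb a b t ∈ Icc c d := by
  have h0 := t.2.1
  have h1 := t.2.2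
  obtain ⟨a1, a2⟩ := ha
  obtain ⟨b1, b2⟩ := hb
  rw [← Subtype.coe_le_coe] at *
  constructor <;> rw [← Subtype.coe_le_coe] <;> simp only [Icc.coe_convexComb] <;> nlinarith

theorem sub_sub (γ : C(I, X)) (a b s t : I) :
    sub (sub γ a b) s t = sub γ (Icc.convexComb a b s) (Icc.convexComb a b t) := by
  ext u
  simp only [sub_apply]
  congr 1
  ext
  simp only [Icc.coe_convexComb]
  ring

/-- `φ` is a homomorphism from the paths in `U` to a group: constant paths have value `1`, and the
two ways around a square in `U` have the same value. -/
structure IsHomOn (U : Set X) (φ : C(I, X) → Q) : Prop where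
  const : ∀ x ∈ U, φ (ContinuousMap.const I x) = 1
  square : ∀ F : C(I × I, X), (∀ z, F z ∈ U) → φ (bot F) * φ (rgt F) = φ (lft F) * φ (top F)

theorem IsHomOn.mono {U V : Set X} {φ : C(I, X) → Q} (h : IsHomOn V φ) (hUV : U ⊆ V) :
    IsHomOn U φ :=
  ⟨fun x hx => h.const x (hUV hx), fun F hF => h.square F fun z => hUV (hF z)⟩

/-- Multiplicativity is the square condition for a degenerate square inside the path: its left edge
is constant, and the other three edges are the two pieces and the whole. -/
theorem IsHomOn.sub_mul_sub {U : Set X} {φ : C(I, X) → Q} (h : IsHomOn U φ) (γ : C(I, X))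
    {a b c : I} (hab : a ≤ b) (hbc : b ≤ c) (hU : ∀ t ∈ Icc a c, γ t ∈ U) :
    φ (sub γ a b) * φ (sub γ b c) = φ (sub γ a c) := by
  have hac := hab.trans hbc
  let F : C(I × I, X) := γ.comp
    ⟨fun z => Icc.convexComb a (Icc.convexComb b c z.2) z.1, by
      have h1 : Continuous fun z : I × I => Icc.convexComb b c z.2 := by fun_prop
      exact Icc.continuous_convexComb_prod.comp
        (continuous_const.prodMk (h1.prodMk continuous_fst))⟩
  have hF : ∀ z, F z ∈ U := fun z => hU _ <|
    convexComb_mem (left_mem_Icc.2 hac) (convexComb_mem ⟨hab, hbc⟩ (right_mem_Icc.2 hac))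
  have e1 : bot F = sub γ a b := by ext t; simp [F, bot, sub_apply]
  have e2 : rgt F = sub γ b c := by ext t; simp [F, rgt, sub_apply]
  have e3 : lft F = ContinuousMap.const I (γ a) := by ext t; simp [F, lft]
  have e4 : top F = sub γ a c := by ext t; simp [F, top, sub_apply]
  have := h.square F hF
  rwa [e1, e2, e3, e4, h.const _ (hU a (left_mem_Icc.2 hac)), one_mul] at this

/-- The property of a path in a space covered by sets with a homomorphism on each: a function on the
interval whose local increments are given by the homomorphisms. -/
def IsLift {ι : Type*} (U : ι → Set X) (φ : ι → C(I, X) → Q) (γ : C(I, X)) (g : I → Q) : Prop :=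
  ∀ i a b, a ≤ b → (∀ t ∈ Icc a b, γ t ∈ U i) → g a * φ i (sub γ a b) = g b

theorem exists_partition {ι : Type*} {U : ι → Set X} (hU : ∀ i, IsOpen (U i))
    (hc : ∀ x, ∃ i, x ∈ U i) (γ : C(I, X)) :
    ∃ t : ℕ → I, t 0 = 0 ∧ Monotone t ∧ (∃ n, t n = 1) ∧
      ∀ n, ∃ i, ∀ s ∈ Icc (t n) (t (n + 1)), γ s ∈ U i := by
  obtain ⟨t, h0, hm, ⟨n, hn⟩, h⟩ := exists_monotone_Icc_subset_open_cover_unitInterval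
    (c := fun i => γ ⁻¹' U i) (fun i => (hU i).preimage γ.continuous)
    (fun s _ => by obtain ⟨i, hi⟩ := hc (γ s); exact mem_iUnion.2 ⟨i, hi⟩)
  exact ⟨t, h0, hm, ⟨n, hn n le_rfl⟩, h⟩

/-! ### Gluing homomorphisms over an open cover -/

section VanKampen

variable {ι : Type*} {U : ι → Set X} {φ : ι → C(I, X) → Q}

theorem IsLift.unique (hU : ∀ i, IsOpen (U i)) (hc : ∀ x, ∃ i, x ∈ U i) {γ : C(I, X)}
    {g g' : I → Q} (h : IsLift U φ γ g) (h' : IsLift U φ γ g') (h0 : g 0 = g' 0) : g = g' := by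
  obtain ⟨t, ht0, hm, ⟨n, hn⟩, ht⟩ := exists_partition hU hc γ
  have key : ∀ k, ∀ s ≤ t k, g s = g' s := by
    intro k
    induction k with
    | zero =>
      intro s hs
      obtain rfl : s = 0 := le_antisymm (ht0 ▸ hs) bot_le
      exact h0
    | succ k ih =>
      intro s hs
      rcases le_total s (t k) with hsk | hsk
      · exact ih s hsk
      · obtain ⟨i, hi⟩ := ht k
        have hi' : ∀ u ∈ Icc (t k) s, γ u ∈ U i := fun u hu => hi u ⟨hu.1, hu.2.trans hs⟩
        rw [← h i _ _ hsk hi', ← h' i _ _ hsk hi', ih _ le_rfl]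
  funext s
  exact key n s (hn ▸ le_top)

/-- The lift grows along a partition whose intervals each go into one member of the cover. Agreement
on overlaps makes the member chosen on an interval immaterial. -/
theorem exists_isLift (hU : ∀ i, IsOpen (U i)) (hc : ∀ x, ∃ i, x ∈ U i)
    (hφ : ∀ i, IsHomOn (U i) (φ i))
    (hφφ : ∀ i j γ, (∀ t, γ t ∈ U i) → (∀ t, γ t ∈ U j) → φ i γ = φ j γ) (γ : C(I, X)) :
    ∃ g : I → Q, g 0 = 1 ∧ IsLift U φ γ g := by
  obtain ⟨t, ht0, hm, ⟨n, hn⟩, ht⟩ := exists_partition hU hc γ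
  have key : ∀ k, ∃ g : I → Q, g 0 = 1 ∧ ∀ i a b, a ≤ b → b ≤ t k → (∀ s ∈ Icc a b, γ s ∈ U i) →
      g a * φ i (sub γ a b) = g b := by
    intro k
    induction k with
    | zero =>
      refine ⟨fun _ => 1, rfl, fun i a b hab hb hi => ?_⟩
      obtain rfl : b = 0 := le_antisymm (ht0 ▸ hb) bot_le
      obtain rfl : a = 0 := le_antisymm hab bot_le
      rw [sub_self, (hφ i).const _ (hi 0 (by simp)), one_mul]
    | succ k ih =>
      obtain ⟨g, hg0, hg⟩ := ih
      obtain ⟨j, hj⟩ := ht k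
      have conv : ∀ a b c, a ≤ b → (∀ s ∈ Icc a b, γ s ∈ U c) → ∀ u, sub γ a b u ∈ U c :=
        fun a b c hab h u => h _ (convexComb_mem (left_mem_Icc.2 hab) (right_mem_Icc.2 hab))
      refine ⟨fun s => if s ≤ t k then g s else g (t k) * φ j (sub γ (t k) s), ?_, ?_⟩
      · simp [hg0]
      · intro i a b hab hb hi
        by_cases hbk : b ≤ t k
        · simp only [hab.trans hbk, hbk, if_true]
          exact hg i a b hab hbk hi
        · have hkb := (not_le.1 hbk).le
          have hj' : ∀ s ∈ Icc (t k) b, γ s ∈ U j := fun s hs => hj s ⟨hs.1, hs.2.trans hb⟩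
          simp only [hbk, if_false]
          by_cases hak : a ≤ t k
          · have hi1 : ∀ s ∈ Icc a (t k), γ s ∈ U i := fun s hs => hi s ⟨hs.1, hs.2.trans hkb⟩
            have hi2 : ∀ s ∈ Icc (t k) b, γ s ∈ U i := fun s hs => hi s ⟨hak.trans hs.1, hs.2⟩
            simp only [hak, if_true]
            rw [← (hφ i).sub_mul_sub γ hak hkb hi, ← mul_assoc, hg i a _ hak le_rfl hi1,
              hφφ i j _ (conv _ _ _ hkb hi2) (conv _ _ _ hkb hj')]
          · have hka := (not_le.1 hak).le
            simp only [hak, if_false]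
            rw [hφφ i j _ (conv _ _ _ hab hi)
              (conv _ _ _ hab fun s hs => hj' s ⟨hka.trans hs.1, hs.2⟩), mul_assoc,
              (hφ j).sub_mul_sub γ hka hab hj']
  obtain ⟨g, hg0, hg⟩ := key n
  exact ⟨g, hg0, fun i a b hab hi => hg i a b hab (hn ▸ le_top) hi⟩

/-- Combined with uniqueness, this expresses the end value of the lift of a subpath through the lift
of the whole path. -/
theorem IsLift.sub {γ : C(I, X)} {g : I → Q} (h : IsLift U φ γ g) {a b : I} (hab : a ≤ b) :
    IsLift U φ (sub γ a b) fun t => (g a)⁻¹ * g (Icc.convexComb a b t) := by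
  intro i s t hst hi
  dsimp only
  rw [mul_assoc, sub_sub, h i _ _ (convexComb_mono hab hst)]
  intro u hu
  obtain ⟨r, rfl⟩ : ∃ r : I, u = Icc.convexComb (Icc.convexComb a b s) (Icc.convexComb a b t) r :=
    ⟨_, Icc.eq_convexComb hu.1 hu.2⟩
  have := hi (Icc.convexComb s t r) (convexComb_mem (left_mem_Icc.2 hst) (right_mem_Icc.2 hst))
  rw [sub_apply] at this
  convert this using 2
  ext
  simp only [Icc.coe_convexComb]
  ring

/-- Homomorphisms on the members of an open cover which agree on the overlaps have a common
extension. -/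
theorem exists_isHomOn_univ (hU : ∀ i, IsOpen (U i)) (hc : ∀ x, ∃ i, x ∈ U i)
    (hφ : ∀ i, IsHomOn (U i) (φ i))
    (hφφ : ∀ i j γ, (∀ t, γ t ∈ U i) → (∀ t, γ t ∈ U j) → φ i γ = φ j γ) :
    ∃ Φ : C(I, X) → Q, IsHomOn univ Φ ∧ ∀ i γ, (∀ t, γ t ∈ U i) → Φ γ = φ i γ := by
  -- The glued homomorphism takes a path to the end value of its lift starting at 1.
  choose g hg0 hg using exists_isLift hU hc hφ hφφ
  have hsub : ∀ γ {a b : I}, a ≤ b → g (PathHom.sub γ a b) 1 = (g γ a)⁻¹ * g γ b := by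
    intro γ a b hab
    have := congrFun (IsLift.unique hU hc (hg (PathHom.sub γ a b)) ((hg γ).sub hab)
      (by simp [hg0])) 1
    simpa using this
  have hloc : ∀ i γ, (∀ t, γ t ∈ U i) → g γ 1 = φ i γ := by
    intro i γ h
    have := hg γ i 0 1 zero_le_one fun t _ => h t
    rwa [hg0, one_mul, sub_zero_one, eq_comm] at this
  refine ⟨fun γ => g γ 1, ⟨fun x _ => ?_, fun F _ => ?_⟩, hloc⟩
  · obtain ⟨i, hi⟩ := hc x
    rw [hloc i _ fun _ => hi, (hφ i).const x hi]
  · obtain ⟨t, ht0, hm, ⟨n, hn⟩, ht⟩ := exists_monotone_Icc_subset_open_cover_unitInterval_prod_self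
      (c := fun i => F ⁻¹' U i) (fun i => (hU i).preimage F.continuous)
      (fun s _ => by obtain ⟨i, hi⟩ := hc (F s); exact mem_iUnion.2 ⟨i, hi⟩)
    have hn := hn n le_rfl
    let H (b : I) : C(I, X) := ⟨fun s => F (s, b), by fun_prop⟩
    let W (a : I) : C(I, X) := ⟨fun s => F (a, s), by fun_prop⟩
    -- The square is subdivided so that each cell lies in one member of the cover, where the square
    -- condition is known. The cells then telescope along rows, and the rows are stacked.
    have cell : ∀ k l, (g (H (t l)) (t k))⁻¹ * g (H (t l)) (t (k + 1)) *
        ((g (W (t (k + 1))) (t l))⁻¹ * g (W (t (k + 1))) (t (l + 1))) =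
        (g (W (t k)) (t l))⁻¹ * g (W (t k)) (t (l + 1)) *
        ((g (H (t (l + 1))) (t k))⁻¹ * g (H (t (l + 1))) (t (k + 1))) := by
      intro k l
      have hk := hm (Nat.le_succ k)
      have hl := hm (Nat.le_succ l)
      obtain ⟨i, hi⟩ := ht k l
      rw [← hsub _ hk, ← hsub _ hl, ← hsub _ hl, ← hsub _ hk]
      let G : C(I × I, X) := F.comp ⟨fun z =>
        (Icc.convexComb (t k) (t (k + 1)) z.1, Icc.convexComb (t l) (t (l + 1)) z.2), by fun_prop⟩
      have hG : ∀ z, G z ∈ U i := fun z => hi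
        ⟨convexComb_mem (left_mem_Icc.2 hk) (right_mem_Icc.2 hk),
          convexComb_mem (left_mem_Icc.2 hl) (right_mem_Icc.2 hl)⟩
      have e1 : bot G = PathHom.sub (H (t l)) (t k) (t (k + 1)) := by
        ext s; simp [G, bot, sub_apply, H]
      have e2 : rgt G = PathHom.sub (W (t (k + 1))) (t l) (t (l + 1)) := by
        ext s; simp [G, rgt, sub_apply, W]
      have e3 : lft G = PathHom.sub (W (t k)) (t l) (t (l + 1)) := by
        ext s; simp [G, lft, sub_apply, W]
      have e4 : top G = PathHom.sub (H (t (l + 1))) (t k) (t (k + 1)) := by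
        ext s; simp [G, top, sub_apply, H]
      rw [← e1, ← e2, ← e3, ← e4, hloc i _ fun _ => hG _, hloc i _ fun _ => hG _,
        hloc i _ fun _ => hG _, hloc i _ fun _ => hG _]
      exact (hφ i).square G hG
    have row : ∀ l k, g (H (t l)) (t k) * ((g (W (t k)) (t l))⁻¹ * g (W (t k)) (t (l + 1))) =
        (g (W 0) (t l))⁻¹ * g (W 0) (t (l + 1)) * g (H (t (l + 1))) (t k) := by
      intro l k
      induction k with
      | zero => simp [ht0, hg0]
      | succ k ih =>
        have h1 := cell k l
        calc _ = g (H (t l)) (t k) * ((g (H (t l)) (t k))⁻¹ * g (H (t l)) (t (k + 1)) *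
              ((g (W (t (k + 1))) (t l))⁻¹ * g (W (t (k + 1))) (t (l + 1)))) := by group
          _ = (g (H (t l)) (t k) * ((g (W (t k)) (t l))⁻¹ * g (W (t k)) (t (l + 1)))) *
              ((g (H (t (l + 1))) (t k))⁻¹ * g (H (t (l + 1))) (t (k + 1))) := by
            rw [h1]; group
          _ = _ := by rw [ih]; group
    have col : ∀ l, g (H 0) 1 * g (W 1) (t l) = g (W 0) (t l) * g (H (t l)) 1 := by
      intro l
      induction l with
      | zero => simp [ht0, hg0]
      | succ l ih =>
        have h1 := row l n
        rw [hn] at h1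
        calc _ = (g (H 0) 1 * g (W 1) (t l)) * ((g (W 1) (t l))⁻¹ * g (W 1) (t (l + 1))) := by
              group
          _ = g (W 0) (t l) * (g (H (t l)) 1 * ((g (W 1) (t l))⁻¹ * g (W 1) (t (l + 1)))) := by
            rw [ih]; group
          _ = _ := by rw [h1]; group
    have := col n
    rwa [hn] at this

end VanKampen

/-- If the increments of a homomorphism along paths in the members of an open cover lie in a subgroup
(relative to some choice of frames), then so do all of them. -/
theorem IsHomOn.mem_of_cover {ι : Type*} {U : ι → Set X} (hU : ∀ i, IsOpen (U i))
    (hc : ∀ x, ∃ i, x ∈ U i) {κ : C(I, X) → Q} (hκ : IsHomOn univ κ) (N : Subgroup Q) (α : X → Q)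
    (h : ∀ i γ, (∀ t, γ t ∈ U i) → α (γ 0) * κ γ * (α (γ 1))⁻¹ ∈ N) (γ : C(I, X)) :
    α (γ 0) * κ γ * (α (γ 1))⁻¹ ∈ N := by
  obtain ⟨t, ht0, hm, ⟨n, hn⟩, ht⟩ := exists_partition hU hc γ
  have key : ∀ k, α (γ 0) * κ (sub γ 0 (t k)) * (α (γ (t k)))⁻¹ ∈ N := by
    intro k
    induction k with
    | zero => simp [ht0, hκ.const]
    | succ k ih =>
      obtain ⟨i, hi⟩ := ht k
      have hk := hm (Nat.le_succ k)
      have h1 := h i (sub γ (t k) (t (k + 1))) fun s =>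
        hi _ (convexComb_mem (left_mem_Icc.2 hk) (right_mem_Icc.2 hk))
      rw [sub_apply, sub_apply, Icc.convexComb_zero, Icc.convexComb_one] at h1
      have h2 := N.mul_mem ih h1
      rw [← hκ.sub_mul_sub γ (a := 0) (b := t k) bot_le hk fun _ _ => mem_univ _]
      convert h2 using 1
      group
  have := key n
  rwa [hn, sub_zero_one] at this

end PathHom

/-! ### The group of homotopy classes of loops -/

/-- The group of homotopy classes of loops at `p`, multiplied in the order of concatenation. -/
def LoopGroup (X : Type*) [TopologicalSpace X] (p : X) : Type _ := Path.Homotopic.Quotient p p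

namespace LoopGroup

variable {X Y Q : Type*} [TopologicalSpace X] [TopologicalSpace Y] [Group Q] {p : X} {q : Y}

instance : Mul (LoopGroup X p) := ⟨fun a b => Path.Homotopic.Quotient.trans a b⟩

instance : Inv (LoopGroup X p) := ⟨fun a => Path.Homotopic.Quotient.symm a⟩

instance : One (LoopGroup X p) := ⟨Path.Homotopic.Quotient.refl p⟩

instance : Group (LoopGroup X p) :=
  Group.ofLeftAxioms
    (fun a b c => Path.Homotopic.Quotient.trans_assoc a b c)
    (fun a => Path.Homotopic.Quotient.refl_trans a)
    (fun a => Path.Homotopic.Quotient.symm_trans a)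

/-- The class of a loop. -/
def mk (γ : Path p p) : LoopGroup X p := Path.Homotopic.Quotient.mk γ

theorem mk_surjective : Function.Surjective (mk : Path p p → LoopGroup X p) :=
  Path.Homotopic.Quotient.mk_surjective

theorem mk_trans (γ δ : Path p p) : mk (γ.trans δ) = mk γ * mk δ := rfl

theorem mk_symm (γ : Path p p) : mk γ.symm = (mk γ)⁻¹ := rfl

theorem mk_refl : mk (Path.refl p) = 1 := rfl

theorem mk_eq {γ δ : Path p p} : mk γ = mk δ ↔ γ.Homotopic δ := Path.Homotopic.Quotient.eq

/-- The homomorphism induced by a continuous map. -/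
def map (f : C(X, Y)) (h : f p = q) : LoopGroup X p →* LoopGroup Y q where
  toFun := Quotient.lift (fun γ : Path p p => mk ((γ.map f.continuous).cast h.symm h.symm))
    (fun _ _ ⟨F⟩ => mk_eq.2 ⟨(F.map f).pathCast h.symm h.symm⟩)
  map_one' := by
    subst h
    rfl
  map_mul' := by
    subst h
    intro a b
    obtain ⟨a, rfl⟩ := mk_surjective a
    obtain ⟨b, rfl⟩ := mk_surjective b
    exact congrArg mk (Path.map_trans a b f.continuous)

theorem map_mk (f : C(X, Y)) (h : f p = q) (γ : Path p p) :
    map f h (mk γ) = mk ((γ.map f.continuous).cast h.symm h.symm) := rfl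

end LoopGroup

/-! ### Homotopy invariance, pull-backs and framed classes -/

namespace PathHom

variable {X Y Q R : Type*} [TopologicalSpace X] [TopologicalSpace Y] [Group Q] [Group R] {U : Set X}
  {φ : C(I, X) → Q}

theorem IsHomOn.eq_of_square (h : IsHomOn U φ) (F : C(I × I, X)) (hF : ∀ z, F z ∈ U)
    (hl : ∀ t, F (0, t) = F (0, 0)) (hr : ∀ t, F (1, t) = F (1, 0)) : φ (bot F) = φ (top F) := by
  have := h.square F hF
  have e1 : lft F = ContinuousMap.const I (F (0, 0)) := by ext t; exact hl t
  have e2 : rgt F = ContinuousMap.const I (F (1, 0)) := by ext t; exact hr t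
  rwa [e1, e2, h.const _ (hF _), h.const _ (hF _), mul_one, one_mul] at this

theorem IsHomOn.homotopic (h : IsHomOn univ φ) {x y : X} {γ δ : Path x y} (hγ : γ.Homotopic δ) :
    φ γ.toContinuousMap = φ δ.toContinuousMap := by
  obtain ⟨F⟩ := hγ
  -- A homotopy has its deformation parameter first, a square here has it second.
  let G : C(I × I, X) := ⟨fun z => F (z.2, z.1), by fun_prop⟩
  have := h.eq_of_square G (fun _ => mem_univ _) (fun t => by simp [G]) (fun t => by simp [G])
  convert this using 2
  · ext t; simp [G, bot]
  · ext t; simp [G, top]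

theorem IsHomOn.map_trans (h : IsHomOn univ φ) {x y z : X} (γ : Path x y) (δ : Path y z) :
    φ (γ.trans δ).toContinuousMap = φ γ.toContinuousMap * φ δ.toContinuousMap := by
  have := h.sub_mul_sub (γ.trans δ).toContinuousMap (a := 0) (b := ⟨1 / 2, by norm_num, by norm_num⟩)
    (c := 1) bot_le le_top fun _ _ => mem_univ _
  rw [sub_zero_one] at this
  rw [← this]
  congr 2
  · ext t
    change (γ.trans δ) _ = γ t
    rw [Path.trans_apply, dif_pos (by simp [Icc.coe_convexComb]; linarith [t.2.2])]
    congr 1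
    ext
    simp [Icc.coe_convexComb]
    ring
  · ext t
    change (γ.trans δ) _ = δ t
    rcases eq_or_lt_of_le t.2.1 with h0 | h0
    · obtain rfl : t = 0 := Subtype.ext h0.symm
      refine (congrArg (γ.trans δ) (Icc.convexComb_zero _ _)).trans ?_
      rw [Path.trans_apply, dif_pos (by norm_num)]
      simp
    · rw [Path.trans_apply, dif_neg (by simp [Icc.coe_convexComb]; linarith)]
      congr 1
      ext
      simp [Icc.coe_convexComb]
      ring

theorem IsHomOn.map_refl (h : IsHomOn univ φ) (x : X) : φ (Path.refl x).toContinuousMap = 1 :=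
  h.const x (mem_univ x)

theorem IsHomOn.map_symm (h : IsHomOn univ φ) {x y : X} (γ : Path x y) :
    φ γ.symm.toContinuousMap = (φ γ.toContinuousMap)⁻¹ := by
  rw [eq_inv_iff_mul_eq_one, ← h.map_trans, h.homotopic ⟨(Path.Homotopy.reflSymmTrans γ).symm⟩]
  exact h.map_refl _

theorem IsHomOn.comp (h : IsHomOn U φ) (ψ : Q →* R) : IsHomOn U fun γ => ψ (φ γ) :=
  ⟨fun x hx => by rw [h.const x hx, _root_.map_one], fun F hF => by
    rw [← map_mul, h.square F hF, map_mul]⟩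

/-- Change of frames. -/
theorem IsHomOn.conj (h : IsHomOn U φ) (s : X → Q) :
    IsHomOn U fun γ => (s (γ 0))⁻¹ * φ γ * s (γ 1) where
  const x hx := by simp [h.const x hx]
  square F hF := by
    have := h.square F hF
    have e1 : bot F 1 = rgt F 0 := rfl
    have e2 : bot F 0 = lft F 0 := rfl
    have e3 : rgt F 1 = top F 1 := rfl
    have e4 : top F 0 = lft F 1 := rfl
    rw [e1, e2, e3, e4]
    calc _ = (s (lft F 0))⁻¹ * (φ (bot F) * φ (rgt F)) * s (top F 1) := by group
      _ = _ := by rw [this]; group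

theorem isHomOn_one (U : Set X) : IsHomOn U fun _ => (1 : Q) :=
  ⟨fun _ _ => rfl, fun _ _ => rfl⟩

theorem isHomOn_potential (U : Set X) (s : X → Q) : IsHomOn U fun γ => (s (γ 0))⁻¹ * s (γ 1) := by
  simpa using (isHomOn_one U).conj s

/-- A path in a set composed with a map that is continuous on this set. -/
def mapOn {f : X → Y} (hf : ContinuousOn f U) (γ : C(I, X)) (h : ∀ t, γ t ∈ U) : C(I, Y) :=
  ⟨fun t => f (γ t), hf.comp_continuous γ.continuous h⟩

open Classical in
/-- The pull-back of a function on paths by a map that is continuous on `U`. -/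
def pullback {f : X → Y} (hf : ContinuousOn f U) (φ : C(I, Y) → Q) (γ : C(I, X)) : Q :=
  -- The default value is harmless, because `IsHomOn U` only tests paths in `U`.
  if h : ∀ t, γ t ∈ U then φ (mapOn hf γ h) else 1

theorem pullback_eq {f : X → Y} (hf : ContinuousOn f U) (φ : C(I, Y) → Q) (γ : C(I, X))
    (h : ∀ t, γ t ∈ U) : pullback hf φ γ = φ (mapOn hf γ h) := dif_pos h

theorem IsHomOn.pullback {f : X → Y} (hf : ContinuousOn f U) {φ : C(I, Y) → Q}
    (h : IsHomOn univ φ) : IsHomOn U (pullback hf φ) where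
  const x hx := by
    rw [pullback_eq hf φ _ fun _ => hx]
    exact h.const (f x) (mem_univ _)
  square F hF := by
    rw [pullback_eq hf φ _ fun _ => hF _, pullback_eq hf φ _ fun _ => hF _,
      pullback_eq hf φ _ fun _ => hF _, pullback_eq hf φ _ fun _ => hF _]
    exact h.square ⟨fun z => f (F z), hf.comp_continuous F.continuous hF⟩ fun _ => mem_univ _

/-- A homomorphism on paths induces a homomorphism of the group of loop classes. -/
def IsHomOn.toHom (h : IsHomOn univ φ) (p : X) : LoopGroup X p →* Q where
  toFun := Quotient.lift (fun γ : Path p p => φ γ.toContinuousMap) fun _ _ hF => h.homotopic hF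
  map_one' := h.map_refl p
  map_mul' := by
    intro a b
    obtain ⟨a, rfl⟩ := LoopGroup.mk_surjective a
    obtain ⟨b, rfl⟩ := LoopGroup.mk_surjective b
    exact h.map_trans a b

theorem IsHomOn.toHom_mk (h : IsHomOn univ φ) {p : X} (γ : Path p p) :
    h.toHom p (LoopGroup.mk γ) = φ γ.toContinuousMap := rfl

/-- A continuous map of the interval as a path between its end points. -/
def toPath (γ : C(I, X)) : Path (γ 0) (γ 1) := ⟨γ, rfl, rfl⟩

/-- The two routes around the boundary are already homotopic in the contractible square itself. -/
theorem homotopic_square (F : C(I × I, X)) :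
    ((toPath (bot F)).trans (toPath (rgt F))).Homotopic ((toPath (lft F)).trans (toPath (top F))) := by
  let a : Path ((0, 0) : I × I) (1, 0) := ⟨⟨fun s => (s, 0), by fun_prop⟩, rfl, rfl⟩
  let b : Path ((1, 0) : I × I) (1, 1) := ⟨⟨fun s => (1, s), by fun_prop⟩, rfl, rfl⟩
  let c : Path ((0, 0) : I × I) (0, 1) := ⟨⟨fun s => (0, s), by fun_prop⟩, rfl, rfl⟩
  let d : Path ((0, 1) : I × I) (1, 1) := ⟨⟨fun s => (s, 1), by fun_prop⟩, rfl, rfl⟩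
  have : ContractibleSpace I := (convex_Icc (0 : ℝ) 1).contractibleSpace ⟨0, by simp⟩
  have h := (SimplyConnectedSpace.paths_homotopic (a.trans b) (c.trans d)).map F
  rw [Path.map_trans, Path.map_trans] at h
  exact h

variable {p : X}

/-- The class of a path closed up by a choice of paths from the base point. -/
def frameClass (c : ∀ x, Path p x) (γ : C(I, X)) : LoopGroup X p :=
  LoopGroup.mk (((c (γ 0)).trans (toPath γ)).trans (c (γ 1)).symm)

theorem frameClass_path (c : ∀ x, Path p x) {x y : X} (γ : Path x y) :
    frameClass c γ.toContinuousMap = LoopGroup.mk (((c x).trans γ).trans (c y).symm) := by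
  have : ∀ (γ : C(I, X)) (x y : X) (hx : γ 0 = x) (hy : γ 1 = y),
      frameClass c γ = LoopGroup.mk (((c x).trans ⟨γ, hx, hy⟩).trans (c y).symm) := by
    rintro γ x y rfl rfl
    rfl
  exact this γ.toContinuousMap x y γ.source γ.target

/-- The frame at an intermediate corner is traversed back and forth and cancels. This is the
tautological path homomorphism, the one through which classes of loops are computed. -/
theorem isHomOn_frameClass (c : ∀ x, Path p x) : IsHomOn univ (frameClass c) where
  const x _ := by
    have := frameClass_path c (Path.refl x)
    refine this.trans ?_
    change Path.Homotopic.Quotient.mk _ = Path.Homotopic.Quotient.refl p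
    simp
  square F _ := by
    have h := homotopic_square F
    have key : ∀ {x y z : X} (a : Path p x) (b : Path x y) (c : Path p y) (d : Path y z)
        (e : Path p z), LoopGroup.mk ((a.trans b).trans c.symm) * LoopGroup.mk ((c.trans d).trans e.symm)
          = LoopGroup.mk ((a.trans (b.trans d)).trans e.symm) := by
      intro x y z a b c d e
      rw [← LoopGroup.mk_trans]
      change Path.Homotopic.Quotient.mk _ = Path.Homotopic.Quotient.mk _
      simp only [Path.Homotopic.Quotient.mk_trans, Path.Homotopic.Quotient.mk_symm,
        Path.Homotopic.Quotient.trans_assoc]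
      rw [← Path.Homotopic.Quotient.trans_assoc (Path.Homotopic.Quotient.mk c).symm,
        Path.Homotopic.Quotient.symm_trans, Path.Homotopic.Quotient.refl_trans]
    have k1 := key (c (F (0, 0))) (toPath (bot F)) (c (F (1, 0))) (toPath (rgt F)) (c (F (1, 1)))
    have k2 := key (c (F (0, 0))) (toPath (lft F)) (c (F (0, 1))) (toPath (top F)) (c (F (1, 1)))
    refine k1.trans (Eq.trans ?_ k2.symm)
    exact LoopGroup.mk_eq.2 (Path.Homotopic.hcomp (Path.Homotopic.hcomp (.refl _) h) (.refl _))

theorem frameClass_loop (c : ∀ x, Path p x) (hc : c p = Path.refl p) (γ : Path p p) :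
    frameClass c γ.toContinuousMap = LoopGroup.mk γ := by
  rw [frameClass_path, hc, LoopGroup.mk_trans, LoopGroup.mk_trans, LoopGroup.mk_symm,
    LoopGroup.mk_refl]
  simp

theorem frameClass_frame (c : ∀ x, Path p x) (hc : c p = Path.refl p) (x : X) :
    frameClass c (c x).toContinuousMap = 1 := by
  rw [frameClass_path, hc]
  change Path.Homotopic.Quotient.mk _ = Path.Homotopic.Quotient.refl p
  simp

end PathHom

/-! ### Permutations without finite cycles -/

namespace ShiftPerm

/-- The unit translation of the first coordinate. -/
def shift (K : Type) : Equiv.Perm (ℤ × ℤ × K) :=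
  (Equiv.addRight (1 : ℤ)).prodCongr (Equiv.refl _)

/-- The exchange of the two integer coordinates. -/
def swap (K : Type) : Equiv.Perm (ℤ × ℤ × K) where
  toFun z := (z.2.1, z.1, z.2.2)
  invFun z := (z.2.1, z.1, z.2.2)
  left_inv _ := rfl
  right_inv _ := rfl

/-- A shear of the two integer coordinates. -/
def shear (K : Type) : Equiv.Perm (ℤ × ℤ × K) where
  toFun z := (z.1, z.2.1 - z.1, z.2.2)
  invFun z := (z.1, z.2.1 + z.1, z.2.2)
  left_inv z := by simp
  right_inv z := by simp

/-- The sheared conjugate moves (k, l) to (k + 1, l - 1) and the swapped one moves it to (k, l + 1),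
so a translation is a product of two of its conjugates. -/
theorem shift_eq (K : Type) :
    shift K = shear K * shift K * (shear K)⁻¹ * (swap K * shift K * (swap K)⁻¹) := by
  ext ⟨k, l, b⟩ : 1
  simp only [Equiv.Perm.coe_mul, Function.comp_apply]
  change (k + 1, l, b) = (k + 1, (l + 1) + k - (k + 1), b)
  congr 2
  ring

/-- Right multiplication by the inverse, on the first factor of a product. -/
def regular (B K : Type) [Group B] : B →* Equiv.Perm (B × K) where
  toFun b := (Equiv.mulRight b⁻¹).prodCongr (Equiv.refl _)
  map_one' := by ext ⟨w, k⟩ <;> simp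
  map_mul' a b := by ext ⟨w, k⟩ <;> simp [mul_assoc]

theorem regular_apply (B K : Type) [Group B] (b : B) (z : B × K) :
    regular B K b z = (z.1 * b⁻¹, z.2) := rfl

/-- An element of infinite order acts freely, so its action is a disjoint union of translations of
ℤ, determined up to conjugacy by the number of orbits. The additional factor ℤ × B makes that number
independent of the element. -/
theorem exists_equiv {B : Type} [Group B] (b : B) (hb : ∀ k : ℤ, b ^ k = 1 → k = 0) :
    ∃ E : ℤ × ℤ × B ≃ B × (ℤ × B), regular B (ℤ × B) b = E.permCongr (shift B) := by
  let C := Subgroup.zpowers b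
  have hinf : Infinite B := by
    refine Infinite.of_injective (fun k : ℤ => b ^ k) fun k l h => ?_
    have : b ^ (k - l) = 1 := by rw [zpow_sub]; exact mul_inv_eq_one.2 h
    exact sub_eq_zero.1 (hb _ this)
  -- Each left coset of the cyclic group is a copy of ℤ. The negative exponent turns right
  -- multiplication by b⁻¹ into adding 1.
  have hf : Function.Bijective (fun z : ℤ × (B ⧸ C) => z.2.out * b ^ (-z.1)) := by
    constructor
    · rintro ⟨k, q⟩ ⟨l, q'⟩ h
      dsimp only at h
      have hq : q = q' := by
        rw [← Quotient.out_eq' q, ← Quotient.out_eq' q']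
        refine QuotientGroup.eq.2 ⟨-k + l, ?_⟩
        dsimp only
        rw [zpow_add, eq_inv_mul_iff_mul_eq, ← mul_assoc]
        rw [show q.out * b ^ (-k) = q'.out * b ^ (-l) from h, mul_assoc, ← zpow_add]
        simp
      subst hq
      have := mul_left_cancel h
      have h2 : b ^ (-k + l) = 1 := by rw [zpow_add, this, ← zpow_add]; simp
      have := hb _ h2
      simp
      omega
    · intro g
      have : (QuotientGroup.mk g : B ⧸ C).out⁻¹ * g ∈ C := by
        refine QuotientGroup.eq.1 ?_
        exact Quotient.out_eq' _
      obtain ⟨k, hk⟩ := this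
      refine ⟨(-k, QuotientGroup.mk g), ?_⟩
      dsimp only at hk ⊢
      rw [neg_neg, hk]
      group
  let f := Equiv.ofBijective _ hf
  -- The number of cosets is absorbed by the infinite cardinal of ℤ × B.
  have hK : Nonempty ((B ⧸ C) × (ℤ × B) ≃ ℤ × B) := by
    rw [← Cardinal.eq, Cardinal.mk_prod, Cardinal.lift_id, Cardinal.lift_id]
    refine Cardinal.mul_eq_right (Cardinal.aleph0_le_mk _) ?_ (Cardinal.mk_ne_zero _)
    rw [Cardinal.mk_prod, Cardinal.lift_id, Cardinal.lift_id]
    refine (Cardinal.mk_le_of_surjective QuotientGroup.mk_surjective).trans ?_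
    exact Cardinal.le_mul_left (Cardinal.mk_ne_zero _)
  obtain ⟨e⟩ := hK
  let E : ℤ × ℤ × B ≃ B × (ℤ × B) :=
    ((Equiv.refl ℤ).prodCongr e.symm).trans
      ((Equiv.prodAssoc _ _ _).symm.trans (f.prodCongr (Equiv.refl _)))
  refine ⟨E, ?_⟩
  have key : ∀ z, regular B (ℤ × B) b (E z) = E (shift B z) := by
    rintro ⟨k, z⟩
    rw [regular_apply]
    refine Prod.ext ?_ rfl
    change (e.symm z).1.out * b ^ (-k) * b⁻¹ = (e.symm z).1.out * b ^ (-(k + 1))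
    rw [neg_add, zpow_add, mul_assoc]
    simp
  ext z : 1
  rw [Equiv.permCongr_apply, ← key, Equiv.apply_symm_apply]

/-- In the permutations of a suitable set, the images of finitely or infinitely many elements of
infinite order are conjugate to one another, and products of two conjugates of one another. -/
theorem exists_conj {B : Type} [Group B] {a b c : B} (ha : ∀ k : ℤ, a ^ k = 1 → k = 0)
    (hb : ∀ k : ℤ, b ^ k = 1 → k = 0) (hc : ∀ k : ℤ, c ^ k = 1 → k = 0) :
    ∃ x y : Equiv.Perm (B × (ℤ × B)), regular B (ℤ × B) a =
      y⁻¹ * regular B (ℤ × B) c * y * (x⁻¹ * regular B (ℤ × B) b * x) := by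
  obtain ⟨E, hE⟩ := exists_equiv a ha
  obtain ⟨F, hF⟩ := exists_equiv b hb
  obtain ⟨G, hG⟩ := exists_equiv c hc
  refine ⟨(E.symm.trans ((swap B)⁻¹.trans F)), (E.symm.trans ((shear B)⁻¹.trans G)), ?_⟩
  rw [hE, hF, hG]
  conv_lhs => rw [shift_eq]
  ext z : 1
  simp [Equiv.Perm.inv_def]

end ShiftPerm

/-! ### The algebra of the fundamental group of the Hawaiian Pants -/

/-- The algebraic properties of the fundamental groups `B` of the Hawaiian Earring and `Γ` of the
Hawaiian Pants, with the classes `L n` of the circles, the classes `X n`, `Y n` of the seams of the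
pairs of pants, and the retractions `r N` that collapse the first `N` circles. -/
structure PantsGroup (B Γ : Type) [Group B] [Group Γ] where
  ι : B →* Γ
  X : ℕ+ → Γ
  Y : ℕ+ → Γ
  L : ℕ+ → B
  r : ℕ → B →* B
  rel : ∀ n, ι (L n) = (Y n)⁻¹ * ι (L (2 * n + 1)) * Y n * ((X n)⁻¹ * ι (L (2 * n)) * X n)
  gen : Subgroup.closure (range ι ∪ range X ∪ range Y) = ⊤
  lift : ∀ (Q : Type) [Group Q] (ψ : B →* Q) (x y : ℕ+ → Q),
    (∀ n, ψ (L n) = (y n)⁻¹ * ψ (L (2 * n + 1)) * y n * ((x n)⁻¹ * ψ (L (2 * n)) * x n)) →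
    ∃ Φ : Γ →* Q, (∀ b, Φ (ι b) = ψ b) ∧ (∀ n, Φ (X n) = x n) ∧ ∀ n, Φ (Y n) = y n
  liftB : ∀ (N : ℕ) (Q : Type) [Group Q] (ψ : B →* Q) (c : ℕ+ → Q),
    ∃ ψ' : B →* Q, (∀ b, ψ' (r N b) = ψ (r N b)) ∧ ∀ n : ℕ+, (n : ℕ) ≤ N → ψ' (L n) = c n
  genB : ∀ N : ℕ, Subgroup.closure (range (r N) ∪ L '' {n | (n : ℕ) ≤ N}) = ⊤
  r_L : ∀ (N : ℕ) (n : ℕ+), N < n → r N (L n) = L n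
  r_r : ∀ (K M : ℕ), K ≤ M → ∀ b, r K (r M b) = r M b
  eq_one : ∀ b, (∀ N, r N b = b) → b = 1

/-! ### Embedding of the earring group, malnormality and intersection of the tails -/

namespace PantsGroup

variable {B Γ : Type} [Group B] [Group Γ] (S : PantsGroup B Γ)

/-- The first n circles may be sent anywhere, in particular to a generator of ℤ. -/
theorem zpow_L (n : ℕ+) (k : ℤ) (h : S.L n ^ k = 1) : k = 0 := by
  obtain ⟨ψ, -, h2⟩ := S.liftB n (Multiplicative ℤ) 1 fun _ => Multiplicative.ofAdd 1
  have := congrArg ψ h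
  rw [map_zpow, h2 n le_rfl, map_one ψ, ← ofAdd_zsmul] at this
  simpa using this

/-- A faithful permutation representation of B extends to Γ: since all circles have infinite order,
permutations for the seams can be chosen so that every relation holds. -/
theorem ι_injective : Function.Injective S.ι := by
  choose x y hxy using fun n => ShiftPerm.exists_conj (S.zpow_L n) (S.zpow_L (2 * n))
    (S.zpow_L (2 * n + 1))
  obtain ⟨Φ, hΦ, -, -⟩ := S.lift _ (ShiftPerm.regular B (ℤ × B)) x y hxy
  refine (injective_iff_map_eq_one _).2 fun b hb => ?_
  have := hΦ b
  rw [hb, map_one] at this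
  have := congrArg Prod.fst (Equiv.congr_fun this (1, (0, 1)))
  rw [ShiftPerm.regular_apply] at this
  simpa [eq_comm] using this

/-- The recursion along the attached pairs of pants can be solved downwards. -/
theorem exists_solution {Q : Type} [Group Q] (N : ℕ) (a x y : ℕ+ → Q) :
    ∃ c : ℕ+ → Q, (∀ n : ℕ+, N < n → c n = a n) ∧ ∀ n : ℕ+, (n : ℕ) ≤ N →
      c n = (y n)⁻¹ * c (2 * n + 1) * y n * ((x n)⁻¹ * c (2 * n) * x n) := by
  -- The equation at n involves besides c n only the larger indices 2n and 2n + 1, so the values at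
  -- N, N - 1, …, 1 can be defined in this order without disturbing earlier equations.
  have key : ∀ k ≤ N, ∃ c : ℕ+ → Q, (∀ n : ℕ+, N < n → c n = a n) ∧ ∀ n : ℕ+, k < n → (n : ℕ) ≤ N →
      c n = (y n)⁻¹ * c (2 * n + 1) * y n * ((x n)⁻¹ * c (2 * n) * x n) := by
    intro k hk
    induction hk using Nat.decreasingInduction with
    | self => exact ⟨a, fun _ _ => rfl, fun n h1 h2 => absurd h1 (not_lt.2 h2)⟩
    | of_succ k hk ih =>
      obtain ⟨c, h1, h2⟩ := ih
      let m : ℕ+ := ⟨k + 1, k.succ_pos⟩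
      refine ⟨Function.update c m ((y m)⁻¹ * c (2 * m + 1) * y m * ((x m)⁻¹ * c (2 * m) * x m)),
        fun n hn => ?_, fun n hn hN => ?_⟩
      · rw [Function.update_of_ne, h1 n hn]
        rintro rfl
        simp [m] at hn
        omega
      · have e1 : ∀ j : ℕ+, k + 1 < j → j ≠ m := by
          rintro j hj rfl
          simp [m] at hj
        have hn' : k + 1 ≤ (n : ℕ) := hn
        rw [Function.update_of_ne (e1 (2 * n + 1) (by push_cast; omega)),
          Function.update_of_ne (e1 (2 * n) (by push_cast; omega))]
        by_cases hnm : n = m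
        · subst hnm
          rw [Function.update_self]
        · rw [Function.update_of_ne hnm]
          refine h2 n ?_ hN
          refine lt_of_le_of_ne hn' fun h => hnm (PNat.eq h.symm)
  obtain ⟨c, h1, h2⟩ := key 0 N.zero_le
  exact ⟨c, h1, fun n hn => h2 n n.pos hn⟩

/-- A homomorphism of `Γ` is determined arbitrarily by its restriction to the part beyond `N` and by
the images of the first `N` seams. -/
theorem exists_lift (N : ℕ) {Q : Type} [Group Q] (ψ : B →* Q) (x y : ℕ+ → Q)
    (h : ∀ n : ℕ+, N < n →
      ψ (S.L n) = (y n)⁻¹ * ψ (S.L (2 * n + 1)) * y n * ((x n)⁻¹ * ψ (S.L (2 * n)) * x n)) :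
    ∃ Φ : Γ →* Q, (∀ b, Φ (S.ι (S.r N b)) = ψ (S.r N b)) ∧ (∀ n, Φ (S.X n) = x n) ∧
      ∀ n, Φ (S.Y n) = y n := by
  -- The values of ψ on the first N circles are discarded and replaced by those that the relations
  -- force.
  obtain ⟨c, hc1, hc2⟩ := exists_solution N (fun n => ψ (S.L n)) x y
  obtain ⟨ψ', h1, h2⟩ := S.liftB N Q ψ c
  have hc : ∀ n, ψ' (S.L n) = c n := by
    intro n
    rcases le_or_gt (n : ℕ) N with hn | hn
    · exact h2 n hn
    · rw [hc1 n hn, ← S.r_L N n hn, h1]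
  obtain ⟨Φ, hΦ1, hΦ2, hΦ3⟩ := S.lift Q ψ' x y fun n => by
    rw [hc, hc, hc]
    rcases le_or_gt (n : ℕ) N with hn | hn
    · exact hc2 n hn
    · rw [hc1 n hn, hc1, hc1, h n hn]
      all_goals push_cast; omega
  exact ⟨Φ, fun b => by rw [hΦ1, h1], hΦ2, hΦ3⟩

/-- The subgroup of the part of the Hawaiian Pants beyond `N`. -/
def tail (N : ℕ) : Subgroup Γ :=
  Subgroup.closure (range (fun b => S.ι (S.r N b)) ∪ S.X '' {n | N < n} ∪ S.Y '' {n | N < n})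

theorem ι_r_mem_tail (N : ℕ) (b : B) : S.ι (S.r N b) ∈ S.tail N :=
  Subgroup.subset_closure (.inl (.inl ⟨b, rfl⟩))

theorem ι_L_mem_tail {N : ℕ} {n : ℕ+} (h : N < n) : S.ι (S.L n) ∈ S.tail N := by
  rw [← S.r_L N n h]
  exact S.ι_r_mem_tail N _

theorem X_mem_tail {N : ℕ} {n : ℕ+} (h : N < n) : S.X n ∈ S.tail N :=
  Subgroup.subset_closure (.inl (.inr ⟨n, h, rfl⟩))

theorem Y_mem_tail {N : ℕ} {n : ℕ+} (h : N < n) : S.Y n ∈ S.tail N :=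
  Subgroup.subset_closure (.inr ⟨n, h, rfl⟩)

/-- A subgroup that contains the part beyond `N` and the first `N` seams is everything. -/
theorem eq_top_of_tail_le (N : ℕ) (T : Subgroup Γ) (h : S.tail N ≤ T)
    (hX : ∀ n : ℕ+, (n : ℕ) ≤ N → S.X n ∈ T) (hY : ∀ n : ℕ+, (n : ℕ) ≤ N → S.Y n ∈ T) : T = ⊤ := by
  have hX' : ∀ n, S.X n ∈ T := fun n =>
    (le_or_gt (n : ℕ) N).elim (hX n) fun hn => h (S.X_mem_tail hn)
  have hY' : ∀ n, S.Y n ∈ T := fun n =>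
    (le_or_gt (n : ℕ) N).elim (hY n) fun hn => h (S.Y_mem_tail hn)
  -- The relation expresses a circle through two circles of larger number, so k bounds how often it
  -- must be applied to get beyond N.
  have hL : ∀ k : ℕ, ∀ n : ℕ+, N < n + k → S.ι (S.L n) ∈ T := by
    intro k
    induction k with
    | zero => exact fun n hn => h (S.ι_L_mem_tail hn)
    | succ k ih =>
      intro n hn
      have hpos := n.pos
      rw [S.rel]
      have h1 := ih (2 * n + 1) (by push_cast; omega)
      have h2 := ih (2 * n) (by push_cast; omega)
      exact T.mul_mem (T.mul_mem (T.mul_mem (T.inv_mem (hY' n)) h1) (hY' n))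
        (T.mul_mem (T.mul_mem (T.inv_mem (hX' n)) h2) (hX' n))
  have hB : T.comap S.ι = ⊤ := by
    rw [eq_top_iff, ← S.genB N, Subgroup.closure_le]
    rintro _ (⟨b, rfl⟩ | ⟨n, -, rfl⟩)
    · exact h (S.ι_r_mem_tail N b)
    · exact hL (N + 1) n (by omega)
  rw [eq_top_iff, ← S.gen, Subgroup.closure_le]
  rintro _ ((⟨b, rfl⟩ | ⟨n, rfl⟩) | ⟨n, rfl⟩)
  · exact (hB ▸ Subgroup.mem_top b : b ∈ T.comap S.ι)
  · exact hX' n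
  · exact hY' n

open Classical in
/-- The action of a subgroup on the group by left multiplication away from the subgroup. -/
def twist (A : Subgroup Γ) : A →* Equiv.Perm Γ :=
  MonoidHom.toHomPerm
    { toFun := fun a g => if g ∈ A then g else a * g
      map_one' := by
        funext g
        change _ = g
        simp
      map_mul' := fun a b => by
        funext g
        change _ = if (if g ∈ A then g else (b : Γ) * g) ∈ A then (if g ∈ A then g else (b : Γ) * g)
          else (a : Γ) * (if g ∈ A then g else (b : Γ) * g)
        by_cases hg : g ∈ A
        · simp [hg]
        · have : (b : Γ) * g ∉ A := fun h => hg ((A.mul_mem_cancel_left b.2).1 h)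
          simp [hg, this, mul_assoc] }

theorem twist_of_mem {A : Subgroup Γ} (a : A) {g : Γ} (hg : g ∈ A) : twist A a g = g := if_pos hg

theorem twist_of_notMem {A : Subgroup Γ} (a : A) {g : Γ} (hg : g ∉ A) : twist A a g = a * g :=
  if_neg hg

open Classical in
/-- The part beyond `N` is a malnormal subgroup. -/
theorem eq_one_of_mul_eq_mul {N : ℕ} {a a' g : Γ} (ha : a ∈ S.tail N) (ha' : a' ∈ S.tail N)
    (hg : g ∉ S.tail N) (h : a * g = g * a') : a = 1 := by
  set A := S.tail N with hA
  let j : B →* A := (S.ι.comp (S.r N)).codRestrict A fun b => S.ι_r_mem_tail N b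
  -- Seams beyond N act through the twisted action of the tail, which fixes the tail pointwise, and
  -- the first N seams act by left multiplication. Freedom of the first N seams makes this an action
  -- of all of Γ.
  let x (n : ℕ+) : Equiv.Perm Γ :=
    if hn : N < n then twist A ⟨S.X n, S.X_mem_tail hn⟩ else Equiv.mulLeft (S.X n)
  let y (n : ℕ+) : Equiv.Perm Γ :=
    if hn : N < n then twist A ⟨S.Y n, S.Y_mem_tail hn⟩ else Equiv.mulLeft (S.Y n)
  obtain ⟨Φ, h1, h2, h3⟩ := S.exists_lift N ((twist A).comp j) x y fun n hn => by
    simp only [x, y, dif_pos hn, MonoidHom.comp_apply]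
    simp only [← map_mul, ← map_inv]
    congr 1
    refine Subtype.ext ?_
    change S.ι (S.r N _) = (S.Y n)⁻¹ * S.ι (S.r N _) * S.Y n * ((S.X n)⁻¹ * S.ι (S.r N _) * S.X n)
    rw [S.r_L N n hn, S.r_L, S.r_L]
    · exact S.rel n
    all_goals push_cast; omega
  have hΦ : ∀ b : A, Φ b = twist A b := by
    rintro ⟨b, hb⟩
    have hb' := hb
    rw [hA, tail] at hb'
    induction hb' using Subgroup.closure_induction with
    | mem z hz =>
      rcases hz with (⟨b, rfl⟩ | ⟨n, hn, rfl⟩) | ⟨n, hn, rfl⟩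
      · refine (h1 b).trans ?_
        change twist A (j (S.r N b)) = _
        congr 1
        refine Subtype.ext ?_
        change S.ι (S.r N (S.r N b)) = _
        rw [S.r_r N N le_rfl]
      · refine (h2 n).trans ?_
        simp only [x]
        rw [dif_pos (show N < (n : ℕ) from hn)]
      · refine (h3 n).trans ?_
        simp only [y]
        rw [dif_pos (show N < (n : ℕ) from hn)]
    | one => exact (map_one Φ).trans (map_one (twist A)).symm
    | mul u v hu hv iu iv =>
      exact (map_mul Φ u v).trans ((congrArg₂ _ (iu hu) (iv hv)).trans
        (map_mul (twist A) ⟨u, hu⟩ ⟨v, hv⟩).symm)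
    | inv u hu iu =>
      exact (map_inv Φ u).trans ((congrArg _ (iu hu)).trans (map_inv (twist A) ⟨u, hu⟩).symm)
  -- The twisted action agrees with left multiplication up to right cosets by the tail: u sends k
  -- into u k A. This holds on generators and passes to products and inverses.
  let T : Subgroup Γ :=
    { carrier := {u | ∀ k, (u * k)⁻¹ * Φ u k ∈ A}
      one_mem' := fun k => by simp
      mul_mem' := fun {u v} hu hv k => by
        have e := A.mul_mem (hv k) (hu (Φ v k))
        rw [map_mul]
        convert e using 1
        simp only [Equiv.Perm.coe_mul, Function.comp_apply]
        group
      inv_mem' := fun {u} hu k => by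
        have e := A.inv_mem (hu (Φ u⁻¹ k))
        have e2 : Φ u (Φ u⁻¹ k) = k := by
          rw [← Equiv.Perm.mul_apply, ← map_mul]; simp
        rw [e2] at e
        convert e using 1
        group }
  have hT : T = ⊤ := by
    refine S.eq_top_of_tail_le N T (fun b hb k => ?_) (fun n hn k => ?_) fun n hn k => ?_
    · rw [hΦ ⟨b, hb⟩]
      by_cases hk : k ∈ A
      · rw [twist_of_mem _ hk]
        exact A.mul_mem (A.inv_mem (A.mul_mem hb hk)) hk
      · rw [twist_of_notMem _ hk]
        simp
    · rw [h2]; simp [x, hn.not_gt]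
    · rw [h3]; simp [y, hn.not_gt]
  have hgT : g ∈ T := hT ▸ Subgroup.mem_top g
  have hc := hgT 1
  rw [mul_one] at hc
  -- As g moves 1 into g A, it moves it out of A, where a acts by honest left multiplication; but a'
  -- fixes 1. Applying both sides of a g = g a' to 1 shows that left multiplication by a fixes a
  -- point.
  have hnot : Φ g 1 ∉ A := fun hm => hg (by
    have := A.mul_mem hm (A.inv_mem hc)
    simpa [mul_assoc] using this)
  have e1 : Φ (a * g) 1 = a * Φ g 1 := by
    rw [map_mul, Equiv.Perm.mul_apply, hΦ ⟨a, ha⟩, twist_of_notMem _ hnot]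
  have e2 : Φ (g * a') 1 = Φ g 1 := by
    rw [map_mul, Equiv.Perm.mul_apply, hΦ ⟨a', ha'⟩, twist_of_mem _ A.one_mem]
  rw [h, e2] at e1
  exact (mul_eq_right.1 e1.symm)

open Classical in
/-- The tails intersect trivially. -/
theorem eq_one_of_forall_mem_tail {g : Γ} (hg : ∀ N, g ∈ S.tail N) : g = 1 := by
  -- A given element involves only finitely many seams besides B, hence lies in some `D M`.
  let D (M : ℕ) : Subgroup Γ := Subgroup.closure
    (range S.ι ∪ S.X '' {n | (n : ℕ) ≤ M} ∪ S.Y '' {n | (n : ℕ) ≤ M})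
  have hD : Monotone D := fun M M' h => Subgroup.closure_mono (by
    refine union_subset_union (union_subset_union_right _ ?_) ?_ <;>
    · exact image_mono fun n (hn : (n : ℕ) ≤ M) => hn.trans h)
  obtain ⟨M, hM⟩ : ∃ M, g ∈ D M := by
    have : (⨆ M, D M) = ⊤ := by
      rw [eq_top_iff, ← S.gen, Subgroup.closure_le]
      rintro _ ((⟨b, rfl⟩ | ⟨n, rfl⟩) | ⟨n, rfl⟩)
      · exact (le_iSup D 0) (Subgroup.subset_closure (.inl (.inl ⟨b, rfl⟩)))
      · exact (le_iSup D n) (Subgroup.subset_closure (.inl (.inr ⟨n, le_refl (n : ℕ), rfl⟩)))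
      · exact (le_iSup D n) (Subgroup.subset_closure (.inr ⟨n, le_refl (n : ℕ), rfl⟩))
    have hmem : g ∈ ⨆ M, D M := this ▸ Subgroup.mem_top g
    exact (Subgroup.mem_iSup_of_directed hD.directed_le).1 hmem
  -- The endomorphism ρ that kills the first K seams and is the identity on the tail fixes g. It
  -- also sends `D M` into the part of B beyond K, because without seams the relations write the
  -- first K circles as products of later circles.
  have key : ∀ K, M ≤ K → ∃ b, g = S.ι (S.r K b) := by
    intro K hK
    let x (n : ℕ+) : Γ := if K < n then S.X n else 1
    let y (n : ℕ+) : Γ := if K < n then S.Y n else 1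
    obtain ⟨ρ, h1, h2, h3⟩ := S.exists_lift K S.ι x y fun n hn => by
      simp only [x, y, if_pos hn]
      exact S.rel n
    have hρ : ∀ u ∈ S.tail K, ρ u = u := by
      intro u hu
      rw [tail] at hu
      induction hu using Subgroup.closure_induction with
      | mem z hz =>
        rcases hz with (⟨b, rfl⟩ | ⟨n, hn, rfl⟩) | ⟨n, hn, rfl⟩
        · exact h1 b
        · exact (h2 n).trans (if_pos hn)
        · exact (h3 n).trans (if_pos hn)
      | one => exact map_one ρ
      | mul u v _ _ iu iv => rw [map_mul, iu, iv]
      | inv u _ iu => rw [map_inv, iu]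
    let R : Subgroup Γ := (S.ι.comp (S.r K)).range
    have hL : ∀ k : ℕ, ∀ n : ℕ+, K < n + k → ρ (S.ι (S.L n)) ∈ R := by
      intro k
      induction k with
      | zero =>
        intro n hn
        rw [← S.r_L K n hn, h1]
        exact ⟨S.L n, rfl⟩
      | succ k ih =>
        intro n hn
        have hpos := n.pos
        rcases lt_or_ge K n with hn' | hn'
        · rw [← S.r_L K n hn', h1]
          exact ⟨S.L n, rfl⟩
        rw [S.rel]
        simp only [map_mul, map_inv, h2, h3, x, y, if_neg hn'.not_gt]
        simp only [inv_one, one_mul, mul_one]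
        exact R.mul_mem (ih (2 * n + 1) (by push_cast; omega)) (ih (2 * n) (by push_cast; omega))
    have hB : R.comap (ρ.comp S.ι) = ⊤ := by
      rw [eq_top_iff, ← S.genB K, Subgroup.closure_le]
      rintro _ (⟨b, rfl⟩ | ⟨n, -, rfl⟩)
      · exact ⟨b, (h1 b).symm⟩
      · exact hL (K + 1) n (by omega)
    have : D M ≤ R.comap ρ := by
      refine (Subgroup.closure_le _).2 ?_
      rintro _ ((⟨b, rfl⟩ | ⟨n, hn, rfl⟩) | ⟨n, hn, rfl⟩)
      · exact (hB ▸ Subgroup.mem_top b : b ∈ R.comap (ρ.comp S.ι))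
      · change ρ (S.X n) ∈ R
        rw [h2]
        simp only [x, if_neg ((show (n : ℕ) ≤ M from hn).trans hK).not_gt]
        exact R.one_mem
      · change ρ (S.Y n) ∈ R
        rw [h3]
        simp only [y, if_neg ((show (n : ℕ) ≤ M from hn).trans hK).not_gt]
        exact R.one_mem
    obtain ⟨b, hb⟩ := this hM
    exact ⟨b, ((hρ g (hg K)).symm.trans hb.symm)⟩
  obtain ⟨b, hb⟩ := key M le_rfl
  -- The elements of B obtained for different K have the same image g, and coincide since B embeds.
  have hfix : ∀ K, S.r K (S.r M b) = S.r M b := by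
    intro K
    rcases le_total K M with h | h
    · exact S.r_r K M h b
    · obtain ⟨b', hb'⟩ := key K h
      have : S.r M b = S.r K b' := S.ι_injective (hb.symm.trans hb')
      rw [this, S.r_r K K le_rfl]
  rw [hb, S.eq_one _ hfix, map_one]

end PantsGroup

end

noncomputable section

open Set Topology PathHom

/-! ### The Hawaiian Earring -/

namespace HawaiianPants

theorem mem_circle_iff {m : ℕ+} {w : ℂ} : w ∈ circle m ↔ (m : ℝ) * Complex.normSq w = 2 * w.re := by
  have hm : (0 : ℝ) < m := by exact_mod_cast m.pos
  rw [circle, mem_sphere_iff_norm, Complex.norm_def,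
    Real.sqrt_eq_iff_mul_self_eq (Complex.normSq_nonneg _) (by positivity)]
  simp only [Complex.normSq_apply, Complex.sub_re, Complex.sub_im, Complex.ofReal_re,
    Complex.ofReal_im]
  constructor
  · intro h
    field_simp at h
    nlinarith
  · intro h
    field_simp
    nlinarith

theorem zero_mem_circle (m : ℕ+) : (0 : ℂ) ∈ circle m := by
  rw [mem_circle_iff]; simp

theorem norm_le_of_mem_circle {m : ℕ+} {w : ℂ} (h : w ∈ circle m) : ‖w‖ ≤ 2 / m := by
  have hm : (0 : ℝ) < m := by exact_mod_cast m.pos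
  rw [mem_circle_iff, Complex.normSq_eq_norm_sq] at h
  have h1 := Complex.re_le_norm w
  rw [le_div_iff₀ hm]
  rcases (norm_nonneg w).eq_or_lt with h0 | h0
  · rw [← h0]; simp
  · have : ‖w‖ * (m * ‖w‖) ≤ ‖w‖ * 2 := by nlinarith
    nlinarith [le_of_mul_le_mul_left this h0]

/-- Inversion straightens the circles into the parallel lines Re = m / 2, with the base point at
infinity. The real part then tells the circles apart and the imaginary part is a coordinate on each.
-/
theorem inv_re_of_mem_circle {m : ℕ+} {w : ℂ} (h : w ∈ circle m) (h0 : w ≠ 0) :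
    (w⁻¹).re = m / 2 := by
  rw [mem_circle_iff] at h
  have : Complex.normSq w ≠ 0 := by simpa using h0
  rw [Complex.inv_re]
  field_simp
  linarith

/-- These are homogeneous coordinates: the line coordinate is q / s, and s = 0 gives the base point.
The degenerate pair s = q = 0 also gives 0, by division by zero. -/
theorem div_mem_circle (m : ℕ+) (s q : ℝ) :
    (s : ℂ) / ((s * (m / 2) : ℝ) + (q : ℝ) * Complex.I) ∈ circle m := by
  rw [mem_circle_iff]
  by_cases h : Complex.normSq ((s * (m / 2) : ℝ) + (q : ℝ) * Complex.I) = 0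
  · rw [Complex.normSq_eq_zero.1 h]; simp
  · rw [Complex.normSq_div, Complex.normSq_ofReal, Complex.div_re]
    simp only [Complex.ofReal_re, Complex.ofReal_im, Complex.add_re, Complex.mul_re,
      Complex.I_re, Complex.I_im]
    field_simp
    ring

/-- The base point of the Hawaiian Earring. -/
def base : earring := ⟨0, mem_iUnion.2 ⟨1, zero_mem_circle 1⟩⟩

/-- The point of the circle `C_m` with inverse `m / 2 + (q / s) i`, or the base point if `s = 0`. -/
def pt (m : ℕ+) (s q : ℝ) : earring :=
  ⟨_, mem_iUnion.2 ⟨m, div_mem_circle m s q⟩⟩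

theorem pt_mem (m : ℕ+) (s q : ℝ) : (pt m s q : ℂ) ∈ circle m := div_mem_circle m s q

theorem pt_val (m : ℕ+) (s q : ℝ) :
    (pt m s q : ℂ) = (s : ℂ) / ((s * (m / 2) : ℝ) + (q : ℝ) * Complex.I) := rfl

theorem den_ne_zero {m : ℕ+} {s q : ℝ} (h : s ≠ 0 ∨ q ≠ 0) :
    ((s * (m / 2) : ℝ) : ℂ) + (q : ℝ) * Complex.I ≠ 0 := by
  intro h0
  have h1 := congrArg Complex.re h0
  have h2 := congrArg Complex.im h0
  simp only [Complex.add_re, Complex.add_im, Complex.mul_re, Complex.mul_im, Complex.ofReal_re,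
    Complex.ofReal_im, Complex.I_re, Complex.I_im, Complex.zero_re, Complex.zero_im] at h1 h2
  have hm : (m : ℝ) ≠ 0 := by exact_mod_cast m.ne_zero
  rcases h with h | h
  · apply h
    have : s * (m / 2) = 0 := by linarith
    rcases mul_eq_zero.1 this with h | h
    · exact h
    · exact absurd h (by positivity)
  · apply h; linarith

@[simp] theorem pt_zero (m : ℕ+) (q : ℝ) : pt m 0 q = base := by
  refine Subtype.ext ?_
  rw [pt_val]; simp [base]

theorem pt_ne_base {m : ℕ+} {s q : ℝ} (hs : s ≠ 0) : pt m s q ≠ base := by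
  intro h
  have h := congrArg Subtype.val h
  rw [pt_val] at h
  exact div_ne_zero (by exact_mod_cast hs) (den_ne_zero (.inl hs)) h

theorem continuousAt_pt {Z : Type*} [TopologicalSpace Z] {m : ℕ+} {S R : Z → ℝ} {z : Z}
    (hS : ContinuousAt S z) (hR : ContinuousAt R z) (h : S z ≠ 0 ∨ R z ≠ 0) :
    ContinuousAt (fun z => pt m (S z) (R z)) z := by
  refine IsInducing.subtypeVal.continuousAt_iff.2 ?_
  exact ContinuousAt.div (by fun_prop) (by fun_prop) (den_ne_zero h)

theorem continuous_pt {Z : Type*} [TopologicalSpace Z] {m : ℕ+} {S R : Z → ℝ}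
    (hS : Continuous S) (hR : Continuous R) (h : ∀ z, S z ≠ 0 ∨ R z ≠ 0) :
    Continuous (fun z => pt m (S z) (R z)) :=
  continuous_iff_continuousAt.2 fun z => continuousAt_pt hS.continuousAt hR.continuousAt (h z)

theorem coe_eq_zero {w : earring} : (w : ℂ) = 0 ↔ w = base :=
  ⟨fun h => Subtype.ext h, fun h => h ▸ rfl⟩

open Classical in
/-- The number of the circle on which a point lies. -/
def idx (w : earring) : ℕ+ := (mem_iUnion.1 w.2).choose

theorem mem_circle_idx (w : earring) : (w : ℂ) ∈ circle (idx w) := (mem_iUnion.1 w.2).choose_spec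

theorem inv_re (w : earring) (h : w ≠ base) : ((w : ℂ)⁻¹).re = idx w / 2 :=
  inv_re_of_mem_circle (mem_circle_idx w) fun h0 => h (coe_eq_zero.1 h0)

theorem idx_eq {w : earring} (h : w ≠ base) {m : ℕ+} (hm : (w : ℂ) ∈ circle m) : idx w = m := by
  have h1 := inv_re w h
  rw [inv_re_of_mem_circle hm fun h0 => h (coe_eq_zero.1 h0)] at h1
  have : (m : ℝ) = idx w := by linarith
  exact PNat.eq (by exact_mod_cast this.symm)

theorem idx_pt (m : ℕ+) {s q : ℝ} (hs : s ≠ 0) : idx (pt m s q) = m :=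
  idx_eq (pt_ne_base hs) (pt_mem m s q)

/-- The coordinate on the circles without the base point. -/
def coord (w : earring) : ℝ := ((w : ℂ)⁻¹).im

theorem pt_idx_coord {w : earring} (h : w ≠ base) : pt (idx w) 1 (coord w) = w := by
  refine Subtype.ext ?_
  rw [pt_val, one_mul, ← inv_re w h, coord, Complex.re_add_im]
  simp

theorem coord_pt (m : ℕ+) (q : ℝ) : coord (pt m 1 q) = q := by
  rw [coord, pt_val]
  simp

theorem continuousAt_coord {w : earring} (h : w ≠ base) : ContinuousAt coord w := by
  have : ContinuousAt (fun w : earring => ((w : ℂ)⁻¹)) w :=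
    continuousAt_subtype_val.inv₀ fun h0 => h (coe_eq_zero.1 h0)
  exact Complex.continuous_im.continuousAt.comp this

theorem isOpen_ne_base : IsOpen {w : earring | w ≠ base} := isOpen_ne

/-- The lines Re = m / 2 are 1 / 2 apart, so a continuous real part cannot jump between them. -/
theorem eventually_idx_eq {w : earring} (h : w ≠ base) : ∀ᶠ v in 𝓝 w, idx v = idx w := by
  have h1 : ContinuousAt (fun w : earring => ((w : ℂ)⁻¹)) w :=
    continuousAt_subtype_val.inv₀ fun h0 => h (coe_eq_zero.1 h0)
  have h2 : ContinuousAt (fun w : earring => ((w : ℂ)⁻¹).re) w :=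
    Complex.continuous_re.continuousAt.comp h1
  filter_upwards [isOpen_ne_base.mem_nhds h, Metric.continuousAt_iff'.1 h2 (1 / 2) (by norm_num)]
    with v hv hd
  rw [inv_re v hv, inv_re w h, Real.dist_eq, abs_lt] at hd
  have h3 : ((idx v : ℕ) : ℝ) < idx w + 1 := by linarith [hd.2]
  have h4 : ((idx w : ℕ) : ℝ) < idx v + 1 := by linarith [hd.1]
  refine PNat.eq ?_
  have h3 : (idx v : ℕ) < idx w + 1 := by exact_mod_cast h3
  have h4 : (idx w : ℕ) < idx v + 1 := by exact_mod_cast h4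
  omega

theorem idx_path {γ : C(I, earring)} (h : ∀ t, γ t ≠ base) (t : I) : idx (γ t) = idx (γ 0) := by
  have : IsLocallyConstant fun t => idx (γ t) := by
    rw [IsLocallyConstant.iff_eventually_eq]
    intro t
    exact γ.continuous.continuousAt.eventually (eventually_idx_eq (h t))
  exact this.apply_eq_of_preconnectedSpace t 0

/-- The path on the circle `C_m` from the base point to the point with coordinate `q`, leaving the
base point on the side given by the sign of `ε`. -/
def ray (m : ℕ+) (ε : ℝˣ) (q : ℝ) : C(I, earring) :=
  -- The line coordinate q - ε (1 - s) / s comes in from -∞ if ε > 0 and from +∞ if ε < 0. Inversion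
  -- reverses the sign of the imaginary part, so ε = 1 leaves into the upper half plane, as `ell`
  -- does.
  ⟨fun s => pt m s (s * q - ε * (1 - s)), continuous_pt (by fun_prop) (by fun_prop) fun s => by
    by_cases h : (s : ℝ) = 0
    · right; rw [h]; simp
    · exact .inl h⟩

/-- The path on the circle `C_m` away from the base point between points of given coordinates. -/
def seg (m : ℕ+) (q q' : ℝ) : C(I, earring) :=
  ⟨fun s => pt m 1 ((1 - s) * q + s * q'), continuous_pt (by fun_prop) (by fun_prop) fun s => by simp⟩

theorem seg_ne_base (m : ℕ+) (q q' : ℝ) (t : I) : seg m q q' t ≠ base := pt_ne_base one_ne_zero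

@[simp] theorem ray_zero (m : ℕ+) (ε : ℝˣ) (q : ℝ) : ray m ε q 0 = base := by simp [ray]

@[simp] theorem ray_one (m : ℕ+) (ε : ℝˣ) (q : ℝ) : ray m ε q 1 = pt m 1 q := by simp [ray]

variable {Q : Type*} [Group Q] {Φ : C(I, earring) → Q}

/-- The rays to the points of γ sweep out a square with constant left edge and right edge γ. -/
theorem map_ray_mul (hΦ : IsHomOn univ Φ) (ε : ℝˣ) {γ : C(I, earring)} (h : ∀ t, γ t ≠ base) :
    Φ (ray (idx (γ 0)) ε (coord (γ 0))) * Φ γ = Φ (ray (idx (γ 0)) ε (coord (γ 1))) := by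
  have hc : Continuous fun t : I => coord (γ t) := continuous_iff_continuousAt.2 fun t =>
    (continuousAt_coord (h t)).comp γ.continuous.continuousAt
  let F : C(I × I, earring) :=
    ⟨fun z => pt (idx (γ 0)) z.1 (z.1 * coord (γ z.2) - ε * (1 - z.1)),
      continuous_pt (by fun_prop) (by have := hc.comp (continuous_snd (X := I)); fun_prop) fun s => by
        by_cases h : (s.1 : ℝ) = 0
        · right; rw [h]; simp
        · exact .inl h⟩
  have := hΦ.square F fun _ => mem_univ _
  have e1 : rgt F = γ := by
    ext1 t
    have : rgt F t = pt (idx (γ 0)) 1 (coord (γ t)) := by simp [rgt, F]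
    rw [this, ← idx_path h t, pt_idx_coord (h t)]
  have e2 : lft F = ContinuousMap.const I base := by ext1 t; simp [lft, F]
  have e3 : bot F = ray (idx (γ 0)) ε (coord (γ 0)) := by ext1 t; simp [bot, F, ray]
  have e4 : top F = ray (idx (γ 0)) ε (coord (γ 1)) := by ext1 t; simp [top, F, ray]
  rwa [e1, e2, e3, e4, hΦ.const _ (mem_univ _), one_mul] at this

/-- Paths from the base point to each point, running on one circle and leaving on a fixed side. -/
def frame (w : earring) : Path base w :=
  open Classical in
  if h : w = base then (Path.refl base).cast rfl h else
    ⟨ray (idx w) 1 (coord w), ray_zero _ _ _, (ray_one _ _ _).trans (pt_idx_coord h)⟩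

theorem frame_base : frame base = Path.refl base := by
  rw [frame, dif_pos rfl]; rfl

theorem frame_of_ne {w : earring} (h : w ≠ base) :
    (frame w).toContinuousMap = ray (idx w) 1 (coord w) := by
  rw [frame, dif_neg h]

/-- The fundamental group of the Hawaiian Earring. -/
abbrev EarringGroup : Type := LoopGroup earring base

/-- The class of a path closed up by the standard paths from the base point. -/
def kappa (γ : C(I, earring)) : EarringGroup := frameClass frame γ

theorem isHomOn_kappa : IsHomOn univ kappa := isHomOn_frameClass frame

theorem kappa_loop (γ : Path base base) : kappa γ.toContinuousMap = LoopGroup.mk γ :=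
  frameClass_loop frame frame_base γ

theorem kappa_frame (w : earring) : kappa (frame w).toContinuousMap = 1 :=
  frameClass_frame frame frame_base w

theorem kappa_ray_one (m : ℕ+) (q : ℝ) : kappa (ray m 1 q) = 1 := by
  have := kappa_frame (pt m 1 q)
  rwa [frame_of_ne (pt_ne_base one_ne_zero), idx_pt m one_ne_zero, coord_pt] at this

/-- All frames leave on the same side, so they move continuously along a path that avoids the base
point. -/
theorem kappa_of_ne_base {γ : C(I, earring)} (h : ∀ t, γ t ≠ base) : kappa γ = 1 := by
  simpa [kappa_ray_one] using map_ray_mul isHomOn_kappa 1 h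

theorem map_ray_mul_seg (hΦ : IsHomOn univ Φ) (m : ℕ+) (ε : ℝˣ) (q q' : ℝ) :
    Φ (ray m ε q) * Φ (seg m q q') = Φ (ray m ε q') := by
  have := map_ray_mul hΦ ε (seg_ne_base m q q')
  have e0 : seg m q q' 0 = pt m 1 q := by simp [seg]
  have e1 : seg m q q' 1 = pt m 1 q' := by simp [seg]
  rwa [e0, e1, idx_pt m one_ne_zero, coord_pt, coord_pt] at this

/-- The class of the circle `C_m`. -/
def loopL (m : ℕ+) : EarringGroup := (kappa (ray m (-1) 1))⁻¹

theorem kappa_ray_neg_one (m : ℕ+) (q : ℝ) : kappa (ray m (-1) q) = (loopL m)⁻¹ := by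
  rw [loopL, inv_inv, ← map_ray_mul_seg isHomOn_kappa m (-1) 1 q,
    kappa_of_ne_base (seg_ne_base m 1 q), mul_one]

/-- The value on a radial path at constant coordinate. -/
def track (m : ℕ+) {q : ℝ} (hq : q ≠ 0) : C(I, earring) :=
  ⟨fun s => pt m s q, continuous_pt (by fun_prop) (by fun_prop) fun _ => .inr hq⟩

/-- The second homogeneous coordinates are interpolated linearly. At s = 0 they are q and -ε, which
have the same sign, so the forbidden pair (0, 0) does not occur. -/
theorem map_track (hΦ : IsHomOn univ Φ) (m : ℕ+) {q : ℝ} (hq : q ≠ 0) (ε : ℝˣ) (h : ε * q < 0) :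
    Φ (track m hq) = Φ (ray m ε q) := by
  let F : C(I × I, earring) :=
    ⟨fun z => pt m z.1 ((1 - z.2) * q + z.2 * (z.1 * q - ε * (1 - z.1))),
      continuous_pt (by fun_prop) (by fun_prop) fun z => by
        by_cases h0 : (z.1 : ℝ) = 0
        · right
          rw [h0]
          intro h1
          have h2 : (1 - (z.2 : ℝ)) * (q * q) = z.2 * (ε * q) := by linear_combination q * h1
          have h3 := z.2.2.1
          have h4 := z.2.2.2
          have h5 := mul_self_pos.2 hq
          rcases h3.eq_or_lt with h6 | h6
          · rw [← h6] at h2; linarith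
          · nlinarith [mul_nonneg (sub_nonneg.2 h4) h5.le, mul_neg_of_pos_of_neg h6 h]
        · exact .inl h0⟩
  have := hΦ.eq_of_square F (fun _ => mem_univ _) (fun t => by simp [F])
    (fun t => by simp [F, ← add_mul])
  convert this using 2
  · ext1 s; simp [F, bot, track]
  · ext1 s; simp [F, top, ray]

end HawaiianPants

/-! ### Collapsing the first circles of the earring -/

namespace HawaiianPants

variable {Q : Type*} [Group Q] {Φ : C(I, earring) → Q}

theorem tendsto_base {Z : Type*} {l : Filter Z} {f : Z → earring} {b : Z → ℝ}
    (h : ∀ᶠ z in l, ‖(f z : ℂ)‖ ≤ b z) (hb : Filter.Tendsto b l (𝓝 0)) :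
    Filter.Tendsto f l (𝓝 base) := by
  rw [IsInducing.subtypeVal.tendsto_nhds_iff]
  exact squeeze_zero_norm' h hb

open Classical in
/-- The retraction of the Hawaiian Earring that collapses the first `N` circles. -/
def collapseFun (N : ℕ) (w : earring) : earring := if N < (idx w : ℕ) then w else base

theorem collapseFun_base (N : ℕ) : collapseFun N base = base := by
  simp [collapseFun]

theorem norm_collapseFun_le (N : ℕ) (w : earring) : ‖(collapseFun N w : ℂ)‖ ≤ ‖(w : ℂ)‖ := by
  rw [collapseFun]
  split_ifs
  · rfl
  · simp [base]

/-- The retraction of the Hawaiian Earring that collapses the first `N` circles. -/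
def collapse (N : ℕ) : C(earring, earring) where
  toFun := collapseFun N
  continuous_toFun := by
    rw [continuous_iff_continuousAt]
    intro w
    by_cases hw : w = base
    · subst hw
      rw [ContinuousAt, collapseFun_base]
      refine tendsto_base (.of_forall (norm_collapseFun_le N)) ?_
      have : Continuous fun w : earring => ‖(w : ℂ)‖ := by fun_prop
      simpa [base] using this.tendsto base
    · by_cases h : N < (idx w : ℕ)
      · refine continuousAt_id.congr ?_
        filter_upwards [eventually_idx_eq hw] with v hv
        simp [collapseFun, hv, h]
      · refine (continuousAt_const (y := base)).congr ?_
        filter_upwards [eventually_idx_eq hw] with v hv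
        simp [collapseFun, hv, h]

theorem collapse_of_lt {N : ℕ} {w : earring} (h : N < (idx w : ℕ)) : collapse N w = w := if_pos h

theorem collapse_of_le {N : ℕ} {w : earring} (h : (idx w : ℕ) ≤ N) : collapse N w = base :=
  if_neg h.not_gt

@[simp] theorem collapse_base (N : ℕ) : collapse N base = base := collapseFun_base N

theorem collapse_collapse {K M : ℕ} (h : K ≤ M) (w : earring) :
    collapse K (collapse M w) = collapse M w := by
  rcases lt_or_ge M (idx w : ℕ) with hw | hw
  · rw [collapse_of_lt hw, collapse_of_lt (h.trans_lt hw)]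
  · rw [collapse_of_le hw, collapse_base]

theorem norm_collapse_le (N : ℕ) (w : earring) : ‖(collapse N w : ℂ)‖ ≤ 2 / (N + 1) := by
  rcases lt_or_ge N (idx w : ℕ) with hw | hw
  · rw [collapse_of_lt hw]
    refine (norm_le_of_mem_circle (mem_circle_idx w)).trans ?_
    have : ((N : ℝ) + 1) ≤ idx w := by exact_mod_cast hw
    gcongr
  · rw [collapse_of_le hw]
    simp only [base, norm_zero]
    positivity

/-- The endomorphism of the fundamental group induced by collapsing the first `N` circles. -/
def collapseHom (N : ℕ) : EarringGroup →* EarringGroup := LoopGroup.map (collapse N) (collapse_base N)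

theorem collapseHom_mk (N : ℕ) (γ : Path base base) :
    collapseHom N (LoopGroup.mk γ) =
      kappa ((collapse N).comp γ.toContinuousMap) := by
  rw [collapseHom, LoopGroup.map_mk, ← kappa_loop]
  rfl

/-- A frame stays on one circle, so the collapse leaves it unchanged or makes it constant. -/
theorem kappa_collapse_frame (N : ℕ) (w : earring) :
    kappa ((collapse N).comp (frame w).toContinuousMap) = 1 := by
  rcases lt_or_ge N (idx w : ℕ) with hw | hw
  · have : (collapse N).comp (frame w).toContinuousMap = (frame w).toContinuousMap := by
      ext1 t
      change collapse N (frame w t) = frame w t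
      by_cases hb : frame w t = base
      · rw [hb, collapse_base]
      · by_cases h0 : w = base
        · subst h0; rw [frame_base]; simp
        · have h1 : frame w t = ray (idx w) 1 (coord w) t := by
            rw [← frame_of_ne h0]; rfl
          refine collapse_of_lt ?_
          rwa [idx_eq hb (m := idx w) (by rw [h1]; exact pt_mem _ _ _)]
    rw [this, kappa_frame]
  · have : (collapse N).comp (frame w).toContinuousMap = ContinuousMap.const I base := by
      ext1 t
      change collapse N (frame w t) = base
      by_cases hb : frame w t = base
      · rw [hb, collapse_base]
      · by_cases h0 : w = base
        · subst h0; rw [frame_base]; simp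
        · have h1 : frame w t = ray (idx w) 1 (coord w) t := by
            rw [← frame_of_ne h0]; rfl
          refine collapse_of_le ?_
          rwa [idx_eq hb (m := idx w) (by rw [h1]; exact pt_mem _ _ _)]
    rw [this, isHomOn_kappa.const _ (mem_univ _)]

theorem isHomOn_collapse (N : ℕ) (hΦ : IsHomOn univ Φ) :
    IsHomOn univ fun γ => Φ ((collapse N).comp γ) where
  const x _ := hΦ.const (collapse N x) (mem_univ _)
  square F _ := hΦ.square ((collapse N).comp F) fun _ => mem_univ _

theorem toHom_kappa (hΦ : IsHomOn univ Φ) (γ : C(I, earring)) :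
    hΦ.toHom base (kappa γ) =
      Φ (frame (γ 0)).toContinuousMap * Φ γ * (Φ (frame (γ 1)).toContinuousMap)⁻¹ := by
  rw [kappa, frameClass, hΦ.toHom_mk, hΦ.map_trans, hΦ.map_trans, hΦ.map_symm]
  rfl

/-- No correction terms appear because the collapse takes frames to paths of trivial class. -/
theorem collapseHom_kappa (N : ℕ) (γ : C(I, earring)) :
    collapseHom N (kappa γ) = kappa ((collapse N).comp γ) := by
  have h := toHom_kappa (isHomOn_collapse N isHomOn_kappa) γ
  rw [kappa_collapse_frame, kappa_collapse_frame, one_mul, inv_one, mul_one] at h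
  rw [← h]
  obtain ⟨δ, hδ⟩ := LoopGroup.mk_surjective (kappa γ)
  rw [← hδ, collapseHom_mk]
  rfl

theorem collapseHom_collapseHom {K M : ℕ} (h : K ≤ M) (b : EarringGroup) :
    collapseHom K (collapseHom M b) = collapseHom M b := by
  obtain ⟨δ, rfl⟩ := LoopGroup.mk_surjective b
  rw [collapseHom_mk, collapseHom_kappa]
  congr 1
  ext1 t
  exact collapse_collapse h _

theorem collapseHom_loopL_of_lt {N : ℕ} {m : ℕ+} (h : N < m) :
    collapseHom N (loopL m) = loopL m := by
  rw [loopL, map_inv, collapseHom_kappa]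
  congr 2
  ext1 t
  change collapse N (ray m (-1) 1 t) = _
  by_cases hb : ray m (-1) 1 t = base
  · rw [hb, collapse_base]
  · rw [collapse_of_lt]
    rwa [idx_eq hb (m := m) (pt_mem _ _ _)]

theorem collapseHom_loopL_of_le {N : ℕ} {m : ℕ+} (h : (m : ℕ) ≤ N) :
    collapseHom N (loopL m) = 1 := by
  rw [loopL, map_inv, collapseHom_kappa, inv_eq_one]
  refine Eq.trans ?_ (isHomOn_kappa.const base (mem_univ _))
  congr 1
  ext1 t
  change collapse N (ray m (-1) 1 t) = base
  by_cases hb : ray m (-1) 1 t = base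
  · rw [hb, collapse_base]
  · rw [collapse_of_le]
    rwa [idx_eq hb (m := m) (pt_mem _ _ _)]

/-! ### Splitting the first circles off the earring group -/

/-- The Hawaiian Earring without the points opposite to the base point on the first `N` circles. -/
def untop (N : ℕ) : Set earring := {w | (w : ℂ).im ≠ 0 ∨ N * (w : ℂ).re < 2}

theorem isOpen_untop (N : ℕ) : IsOpen (untop N) := by
  have h1 : IsOpen {w : earring | (w : ℂ).im ≠ 0} := isOpen_ne_fun (by fun_prop) (by fun_prop)
  have h2 : IsOpen {w : earring | N * (w : ℂ).re < 2} := isOpen_lt (by fun_prop) (by fun_prop)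
  exact h1.union h2

theorem base_mem_untop (N : ℕ) : base ∈ untop N := by
  right; simp [base]

theorem coord_eq_zero {w : earring} : coord w = 0 ↔ (w : ℂ).im = 0 := by
  rw [coord, Complex.inv_im, div_eq_zero_iff, neg_eq_zero, Complex.normSq_eq_zero]
  constructor
  · rintro (h | h)
    · exact h
    · rw [h]; rfl
  · exact .inl

/-- Coordinate 0 on the circle C_m belongs to the point 2 / m, which is removed when m ≤ N. -/
theorem coord_ne_zero {N : ℕ} {w : earring} (hw : w ∈ untop N) (h0 : w ≠ base)
    (h : (idx w : ℕ) ≤ N) : coord w ≠ 0 := by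
  rw [Ne, coord_eq_zero]
  rcases hw with hw | hw
  · exact hw
  · intro him
    have h1 := mem_circle_iff.1 (mem_circle_idx w)
    rw [Complex.normSq_apply, him] at h1
    have h2 : (w : ℂ).re ≠ 0 := fun hre => h0 (coe_eq_zero.1 (Complex.ext hre him))
    have h3 : (idx w : ℝ) * (w : ℂ).re = 2 := by
      refine mul_right_cancel₀ h2 ?_
      linarith
    have h4 : ((idx w : ℕ) : ℝ) ≤ N := by exact_mod_cast h
    have h5 : (0 : ℝ) < idx w := by exact_mod_cast (idx w).pos
    have h6 : 0 < (w : ℂ).re := by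
      by_contra hn
      nlinarith
    nlinarith

theorem collapse_mem_untop (N : ℕ) (w : earring) : collapse N w ∈ untop N := by
  rcases lt_or_ge N (idx w : ℕ) with h | h
  · rw [collapse_of_lt h]
    right
    have h1 := (Complex.re_le_norm _).trans (norm_le_of_mem_circle (mem_circle_idx w))
    have h4 : (N : ℝ) < (idx w : ℕ) := by exact_mod_cast h
    have h5 : (0 : ℝ) < idx w := by exact_mod_cast (idx w).pos
    rw [le_div_iff₀ h5] at h1
    rcases le_or_gt (w : ℂ).re 0 with h6 | h6
    · nlinarith [Nat.cast_nonneg (α := ℝ) N]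
    · nlinarith
  · rw [collapse_of_le h]
    exact base_mem_untop N

open Classical in
/-- The deformation of `untop N` that contracts the remaining arcs of the first `N` circles. -/
def deform (N : ℕ) (w : earring) (s : ℝ) : earring :=
  -- The line coordinate q becomes q / s and escapes to infinity as s tends to 0, which is
  -- continuous because q ≠ 0 after the removal.
  if N < (idx w : ℕ) ∨ w = base then w else pt (idx w) s (coord w)

theorem deform_base (N : ℕ) (s : ℝ) : deform N base s = base := if_pos (.inr rfl)

theorem deform_one (N : ℕ) (w : earring) : deform N w 1 = w := by
  rw [deform]
  split_ifs with h
  · rfl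
  · exact pt_idx_coord (not_or.1 h).2

theorem deform_zero (N : ℕ) (w : earring) : deform N w 0 = collapse N w := by
  rw [deform]
  rcases lt_or_ge N (idx w : ℕ) with h | h
  · rw [if_pos (.inl h), collapse_of_lt h]
  · rw [collapse_of_le h, pt_zero]
    split_ifs with h1
    · exact h1.resolve_left h.not_gt
    · rfl

/-- At the base point, where the circles accumulate, continuity of the deformation rests on this
bound, uniform in the circle and in s. -/
theorem norm_deform_le (N : ℕ) (w : earring) {s : ℝ} (hs : s ∈ I) :
    ‖(deform N w s : ℂ)‖ ≤ ‖(w : ℂ)‖ := by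
  rw [deform]
  split_ifs with h
  · rfl
  · conv_rhs => rw [← pt_idx_coord (not_or.1 h).2]
    rw [Complex.norm_def, Complex.norm_def]
    refine Real.sqrt_le_sqrt ?_
    rcases hs.1.eq_or_lt with h0 | h0
    · rw [← h0, pt_zero]
      simp only [base, map_zero]
      exact Complex.normSq_nonneg _
    · rw [pt_val, pt_val, Complex.normSq_div, Complex.normSq_div, Complex.normSq_add_mul_I,
        Complex.normSq_add_mul_I, Complex.normSq_ofReal, Complex.normSq_ofReal]
      have h5 : (0 : ℝ) < idx w := by exact_mod_cast (idx w).pos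
      rw [div_le_div_iff₀ (by positivity) (by positivity)]
      have h6 := hs.2
      have h7 : s * s ≤ 1 := by nlinarith
      nlinarith [mul_nonneg (sub_nonneg.2 h7) (sq_nonneg (coord w))]

theorem continuousAt_deform {N : ℕ} {w : earring} (hw : w ∈ untop N) (s : I) :
    ContinuousAt (fun z : earring × I => deform N z.1 z.2) (w, s) := by
  by_cases h0 : w = base
  · subst h0
    rw [ContinuousAt, deform_base]
    refine tendsto_base (.of_forall fun z => norm_deform_le N z.1 z.2.2) ?_
    have : Continuous fun z : earring × I => ‖(z.1 : ℂ)‖ := by fun_prop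
    simpa [base] using this.tendsto (base, s)
  · have hev : ∀ᶠ z : earring × I in 𝓝 (w, s), idx z.1 = idx w ∧ z.1 ≠ base :=
      (continuousAt_fst (p := ((w, s) : earring × I))).eventually
        ((eventually_idx_eq h0).and (isOpen_ne_base.mem_nhds h0))
    by_cases h : N < (idx w : ℕ)
    · refine continuousAt_fst.congr ?_
      filter_upwards [hev] with z hz
      rw [deform, if_pos (.inl (by rwa [hz.1]))]
    · have : ContinuousAt (fun z : earring × I => pt (idx w) z.2 (coord z.1)) (w, s) :=
        continuousAt_pt (by fun_prop)
          ((continuousAt_coord h0).fst' (y := s))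
          (.inr (coord_ne_zero hw h0 (not_lt.1 h)))
      refine this.congr ?_
      filter_upwards [hev] with z hz
      rw [deform, if_neg (by rw [hz.1]; exact not_or.2 ⟨h, hz.2⟩), hz.1]

/-- The path traced by a point under the deformation. -/
def deformTrack {N : ℕ} {w : earring} (hw : w ∈ untop N) : C(I, earring) :=
  ⟨fun s => deform N w s, continuous_iff_continuousAt.2 fun s =>
    (continuousAt_deform hw s).comp (f := fun s : I => (w, s)) (by fun_prop)⟩

theorem map_deform (hΦ : IsHomOn univ Φ) {N : ℕ} {γ : C(I, earring)} (h : ∀ t, γ t ∈ untop N) :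
    Φ (deformTrack (h 0)) * Φ γ = Φ ((collapse N).comp γ) * Φ (deformTrack (h 1)) := by
  let F : C(I × I, earring) := ⟨fun z => deform N (γ z.2) z.1,
    continuous_iff_continuousAt.2 fun z =>
      (continuousAt_deform (h z.2) z.1).comp (f := fun z : I × I => (γ z.2, z.1)) (by fun_prop)⟩
  have := hΦ.square F fun _ => mem_univ _
  have e1 : bot F = deformTrack (h 0) := rfl
  have e2 : rgt F = γ := by ext1 t; exact deform_one N _
  have e3 : lft F = (collapse N).comp γ := by ext1 t; exact deform_zero N _
  have e4 : top F = deformTrack (h 1) := rfl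
  rwa [e1, e2, e3, e4] at this

open Classical in
-- A collapsed arc shrinks to the base point on the side given by the sign of its coordinate. Only
-- on the positive side does this differ from the frame, by one turn around the circle.
theorem map_deformTrack (hΦ : IsHomOn univ Φ) {N : ℕ} {w : earring} (hw : w ∈ untop N) :
    Φ (deformTrack hw) = if N < (idx w : ℕ) ∨ w = base then 1 else
      if 0 < coord w then Φ (ray (idx w) (-1) (coord w)) else Φ (ray (idx w) 1 (coord w)) := by
  split_ifs with h h1
  · refine Eq.trans ?_ (hΦ.const w (mem_univ _))
    congr 1
    ext1 t
    exact if_pos h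
  · rw [← map_track hΦ _ h1.ne' (-1) (by simpa using h1)]
    congr 1
    ext1 t
    exact if_neg h
  · have h2 := coord_ne_zero hw (not_or.1 h).2 (not_lt.1 (not_or.1 h).1)
    rw [← map_track hΦ _ h2 1 (by simpa using lt_of_le_of_ne (not_lt.1 h1) h2)]
    congr 1
    ext1 t
    exact if_neg h

open Classical in
/-- The potential of the classes of paths in `untop N`, with prescribed values for the circles. -/
def side {Q : Type*} [Group Q] (N : ℕ) (c : ℕ+ → Q) (w : earring) : Q :=
  if (idx w : ℕ) ≤ N ∧ w ≠ base ∧ 0 < coord w then (c (idx w))⁻¹ else 1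

theorem kappa_deformTrack {N : ℕ} {w : earring} (hw : w ∈ untop N) :
    kappa (deformTrack hw) = side N loopL w := by
  classical
  rw [map_deformTrack isHomOn_kappa, side, kappa_ray_neg_one, kappa_ray_one]
  by_cases h1 : N < (idx w : ℕ) <;> by_cases h2 : w = base <;> by_cases h3 : 0 < coord w <;>
    simp [h1, h2, h3, not_le.2, not_lt.1]

/-- The classes of paths in `untop N`. -/
theorem kappa_untop {N : ℕ} {γ : C(I, earring)} (h : ∀ t, γ t ∈ untop N) :
    kappa γ = (side N loopL (γ 0))⁻¹ * collapseHom N (kappa γ) * side N loopL (γ 1) := by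
  rw [← kappa_deformTrack (h 0), ← kappa_deformTrack (h 1), collapseHom_kappa, mul_assoc,
    ← map_deform isHomOn_kappa h, inv_mul_cancel_left]

/-- The cover of the Hawaiian Earring by `untop N` and the complement of the base point. -/
def earringCover (N : ℕ) (b : Bool) : Set earring := bif b then untop N else {w | w ≠ base}

theorem isOpen_earringCover (N : ℕ) (b : Bool) : IsOpen (earringCover N b) := by
  cases b
  · exact isOpen_ne_base
  · exact isOpen_untop N

theorem exists_mem_earringCover (N : ℕ) (w : earring) : ∃ b, w ∈ earringCover N b := by
  by_cases h : w = base
  · exact ⟨true, h ▸ base_mem_untop N⟩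
  · exact ⟨false, h⟩

/-- Paths in `untop N` contribute collapsed classes and values of `side`, paths off the base point
contribute nothing, and every loop is cut into such paths. -/
theorem closure_collapse_loopL (N : ℕ) :
    Subgroup.closure (range (collapseHom N) ∪ loopL '' {n | (n : ℕ) ≤ N}) = ⊤ := by
  rw [eq_top_iff]
  set T := Subgroup.closure (range (collapseHom N) ∪ loopL '' {n | (n : ℕ) ≤ N})
  rintro b -
  obtain ⟨γ, rfl⟩ := LoopGroup.mk_surjective b
  have hside : ∀ w, side N loopL w ∈ T := by
    intro w
    rw [side]
    split_ifs with h
    · exact T.inv_mem (Subgroup.subset_closure (.inr ⟨_, h.1, rfl⟩))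
    · exact T.one_mem
  have := IsHomOn.mem_of_cover (isOpen_earringCover N) (exists_mem_earringCover N) isHomOn_kappa T
    (fun _ => 1) (fun b γ hγ => by
      simp only [one_mul, inv_one, mul_one]
      cases b
      · rw [kappa_of_ne_base hγ]
        exact T.one_mem
      · rw [kappa_untop hγ]
        exact T.mul_mem (T.mul_mem (T.inv_mem (hside _)) (Subgroup.subset_closure (.inl ⟨_, rfl⟩)))
          (hside _)) γ.toContinuousMap
  simpa [kappa_loop] using this

/-- On the first N circles the sign of the coordinate could change only through the removed point or
the base point. -/
theorem side_eq_of_ne_base {N : ℕ} (c : ℕ+ → Q) {γ : C(I, earring)} (h : ∀ t, γ t ∈ untop N)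
    (h0 : ∀ t, γ t ≠ base) : side N c (γ 0) = side N c (γ 1) := by
  rw [side, side, idx_path h0 1]
  by_cases hN : (idx (γ 0) : ℕ) ≤ N
  · have hne : ∀ t, coord (γ t) ≠ 0 := fun t =>
      coord_ne_zero (h t) (h0 t) (by rwa [idx_path h0 t])
    have hc : Continuous fun t : I => coord (γ t) := continuous_iff_continuousAt.2 fun t =>
      (continuousAt_coord (h0 t)).comp γ.continuous.continuousAt
    have : 0 < coord (γ 0) ↔ 0 < coord (γ 1) := by
      constructor
      · intro hp
        by_contra hn
        obtain ⟨t, ht⟩ := mem_range_of_exists_le_of_exists_ge hc ⟨1, not_lt.1 hn⟩ ⟨0, hp.le⟩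
        exact hne t ht
      · intro hp
        by_contra hn
        obtain ⟨t, ht⟩ := mem_range_of_exists_le_of_exists_ge hc ⟨0, not_lt.1 hn⟩ ⟨1, hp.le⟩
        exact hne t ht
    simp [h0, this]
  · simp [hN]

/-- Homomorphisms of the fundamental group of the Hawaiian Earring can be prescribed on the
finitely many first circles and on the rest. -/
theorem exists_lift_earring (N : ℕ) (Q : Type) [Group Q] (ψ : EarringGroup →* Q) (c : ℕ+ → Q) :
    ∃ ψ' : EarringGroup →* Q, (∀ b, ψ' (collapseHom N b) = ψ (collapseHom N b)) ∧
      ∀ n : ℕ+, (n : ℕ) ≤ N → ψ' (loopL n) = c n := by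
  -- This is the formula of `kappa_untop` with the classes of the first N circles replaced by the
  -- prescribed values c.
  let φ : Bool → C(I, earring) → Q := fun b γ => bif b then
    (side N c (γ 0))⁻¹ * ψ (collapseHom N (kappa γ)) * side N c (γ 1) else 1
  have hφ : ∀ b, IsHomOn (earringCover N b) (φ b) := by
    rintro (_ | _)
    · exact isHomOn_one _
    · exact (((isHomOn_kappa.comp (ψ.comp (collapseHom N))).conj (side N c)).mono (subset_univ _))
  have hag : ∀ γ, (∀ t, γ t ∈ untop N) → (∀ t, γ t ≠ base) → φ true γ = 1 := by
    intro γ h h0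
    simp only [φ, cond_true]
    rw [kappa_of_ne_base h0, side_eq_of_ne_base c h h0]
    simp
  obtain ⟨Φ, hΦ, hΦφ⟩ := exists_isHomOn_univ (isOpen_earringCover N) (exists_mem_earringCover N) hφ (by
    rintro (_ | _) (_ | _) γ h1 h2
    · rfl
    · exact (hag γ h2 h1).symm
    · exact hag γ h1 h2
    · rfl)
  refine ⟨hΦ.toHom base, fun b => ?_, fun n hn => ?_⟩
  · obtain ⟨γ, rfl⟩ := LoopGroup.mk_surjective b
    rw [collapseHom, LoopGroup.map_mk, hΦ.toHom_mk, hΦφ true _ fun t => ?_]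
    · simp only [φ, cond_true]
      rw [kappa_loop, ← LoopGroup.map_mk (collapse N) (collapse_base N), ← collapseHom,
        collapseHom_collapseHom le_rfl]
      have : side N c base = 1 := by simp [side]
      rw [Path.coe_toContinuousMap, Path.source, Path.target, this]
      simp
    · exact collapse_mem_untop N _
  · have huntop : ∀ (q : ℝ) (hq : q ≠ 0) (t : I), track n hq t ∈ untop N := by
      intro q hq t
      change pt n t q ∈ untop N
      by_cases ht : (t : ℝ) = 0
      · rw [ht, pt_zero]; exact base_mem_untop N
      · left
        rw [pt_val, Complex.div_im]
        simp only [Complex.ofReal_re, Complex.ofReal_im, Complex.add_re, Complex.mul_re,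
          Complex.I_re, Complex.I_im, Complex.add_im, Complex.mul_im]
        have := Complex.normSq_pos.2 (den_ne_zero (m := n) (s := t) (q := q) (.inl ht))
        simp
        exact ⟨⟨fun h => ht (by rw [h]; rfl), hq⟩, by simpa using this.ne'⟩
    have hval : ∀ (q : ℝ) (hq : q ≠ 0), Φ (track n hq) =
        ψ (collapseHom N (kappa (track n hq))) * side N c (pt n 1 q) := by
      intro q hq
      rw [hΦφ true _ (huntop q hq)]
      simp only [φ, cond_true]
      have h0 : track n hq 0 = base := by simp [track]
      have h1 : track n hq 1 = pt n 1 q := by simp [track]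
      have : side N c base = 1 := by simp [side]
      rw [h0, h1, this]
      simp
    -- This ray passes the removed point, so it is replaced by a ray to coordinate -1, inside `untop
    -- N`, and a segment away from the base point. The ray from the other side is a track and needs
    -- no cut.
    have hneg : Φ (ray n 1 1) = 1 := by
      rw [← map_ray_mul_seg hΦ n 1 (-1) 1, hΦφ false _ (seg_ne_base n _ _),
        ← map_track hΦ n (by norm_num) 1 (by norm_num), hval,
        map_track isHomOn_kappa n (by norm_num) 1 (by norm_num), kappa_ray_one]
      simp [φ, side, coord_pt]
    have hpos : Φ (ray n (-1) 1) = (c n)⁻¹ := by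
      rw [← map_track hΦ n one_ne_zero (-1) (by norm_num), hval,
        map_track isHomOn_kappa n (by norm_num) (-1) (by norm_num), kappa_ray_neg_one, map_inv,
        collapseHom_loopL_of_le hn]
      have : side N c (pt n 1 1) = (c n)⁻¹ := by
        rw [side, idx_pt n one_ne_zero, coord_pt, if_pos ⟨hn, pt_ne_base one_ne_zero, one_pos⟩]
      rw [this]
      simp
    rw [loopL, map_inv, toHom_kappa hΦ, ray_zero, ray_one, frame_base, frame_of_ne
      (pt_ne_base one_ne_zero), idx_pt n one_ne_zero, coord_pt, hneg, hpos, hΦ.map_refl]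
    simp

end HawaiianPants

/-! ### Infinite concatenation of homotopies -/

namespace HawaiianPants

/-- The concatenation of the homotopies `K n`, the `n`-th one on the interval from `n` to `n + 1`. -/
def concat {Z : Type*} [TopologicalSpace Z] (K : ℕ → C(I × I, Z)) (z : ℝ × I) : Z :=
  K ⌊z.1⌋₊ (projIcc 0 1 zero_le_one (z.1 - ⌊z.1⌋₊), z.2)

/-- Only the joints at integers matter, where the matching condition applies. Starting at 1 keeps a
previous homotopy available on the left of each joint. -/
theorem continuousAt_concat {Z : Type*} [TopologicalSpace Z] {K : ℕ → C(I × I, Z)}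
    (hK : ∀ n t, K n (1, t) = K (n + 1) (0, t)) {z : ℝ × I} (hz : 1 ≤ z.1) :
    ContinuousAt (concat K) z := by
  obtain ⟨n, hn⟩ : ∃ n, ⌊z.1⌋₊ = n + 1 :=
    Nat.exists_eq_add_one.2 (Nat.floor_pos.2 hz)
  have h1 : ((n + 1 : ℕ) : ℝ) ≤ z.1 := hn ▸ Nat.floor_le (by linarith)
  have h2 : z.1 < ((n + 1 : ℕ) : ℝ) + 1 := hn ▸ Nat.lt_floor_add_one z.1
  push_cast at h1 h2
  have hc : Continuous fun y : ℝ × I => if y.1 ≤ n + 1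
      then K n (projIcc 0 1 zero_le_one (y.1 - n), y.2)
      else K (n + 1) (projIcc 0 1 zero_le_one (y.1 - (n + 1 : ℕ)), y.2) := by
    refine Continuous.if_le (by fun_prop) (by fun_prop) continuous_fst continuous_const ?_
    intro y hy
    rw [hy, show ((n : ℝ) + 1 - n) = 1 by ring, show ((n : ℝ) + 1 - (n + 1 : ℕ)) = 0 by push_cast; ring,
      projIcc_right, projIcc_left]
    exact hK n y.2
  refine hc.continuousAt.congr ?_
  have hev : ∀ᶠ y : ℝ × I in 𝓝 z, y.1 ∈ Ioo (n : ℝ) (n + 1 + 1) :=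
    (continuousAt_fst (p := z)).eventually (Ioo_mem_nhds (by linarith) h2)
  filter_upwards [hev] with y hy
  obtain ⟨hy1, hy2⟩ := hy
  have hy0 : (0 : ℝ) ≤ y.1 := (Nat.cast_nonneg n).trans hy1.le
  split_ifs with h
  · rcases h.eq_or_lt with h | h
    · have hf : ⌊y.1⌋₊ = n + 1 := by
        rw [h]; exact_mod_cast Nat.floor_natCast (R := ℝ) (n + 1)
      rw [concat, hf, h, show ((n : ℝ) + 1 - n) = 1 by ring,
        show ((n : ℝ) + 1 - (n + 1 : ℕ)) = 0 by push_cast; ring, projIcc_right, projIcc_left]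
      exact hK n y.2
    · have hf : ⌊y.1⌋₊ = n := (Nat.floor_eq_iff hy0).2 ⟨hy1.le, h⟩
      rw [concat, hf]
  · have hf : ⌊y.1⌋₊ = n + 1 :=
      (Nat.floor_eq_iff hy0).2 ⟨by push_cast; linarith, by push_cast; linarith⟩
    rw [concat, hf]

theorem collapse_zero (w : earring) : collapse 0 w = w := collapse_of_lt (idx w).pos

/-- A class that is fixed when any number of circles is collapsed is trivial. -/
theorem eq_one_of_collapseHom {b : EarringGroup} (hb : ∀ N, collapseHom N b = b) : b = 1 := by
  obtain ⟨β, rfl⟩ := LoopGroup.mk_surjective b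
  let r (N : ℕ) : Path base base :=
    (β.map (collapse N).continuous).cast (collapse_base N).symm (collapse_base N).symm
  have hr : ∀ N, (r N).Homotopic (r (N + 1)) := fun N =>
    LoopGroup.mk_eq.1 ((hb N).trans (hb (N + 1)).symm)
  let H (N : ℕ) : (r N).Homotopy (r (N + 1)) := (hr N).some
  -- Collapsing the N-th homotopy, stored at index N + 1, once more pushes it into the circles
  -- beyond N without changing its ends, so the homotopies shrink. Index 0 is a stationary filler.
  let K (n : ℕ) : C(I × I, earring) := (collapse (n - 1)).comp
    (n.casesOn ⟨fun z => β z.2, by fun_prop⟩ fun N => (H N).toContinuousMap)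
  have hK0 : ∀ N t, K (N + 1) (0, t) = collapse N (β t) := by
    intro N t
    change collapse N (H N (0, t)) = _
    rw [(H N).apply_zero]
    exact collapse_collapse le_rfl _
  have hK1 : ∀ N t, K (N + 1) (1, t) = collapse (N + 1) (β t) := by
    intro N t
    change collapse N (H N (1, t)) = _
    rw [(H N).apply_one]
    exact collapse_collapse (Nat.le_succ N) _
  have hK : ∀ n t, K n (1, t) = K (n + 1) (0, t) := by
    rintro (_ | n) t
    · rw [hK0]; rfl
    · rw [hK0, hK1]
  have hKe : ∀ N s t, β t = base → (t = 0 ∨ t = 1) → K (N + 1) (s, t) = base := by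
    intro N s t h ht
    have : H N (s, t) = r N t := (H N).eq_fst s (by simpa using ht)
    change collapse N (H N (s, t)) = base
    rw [this]
    change collapse N (collapse N (β t)) = base
    rw [h, collapse_base, collapse_base]
  -- The parameter 1 / (1 - s) carries [0, 1) onto [1, ∞), leaving s = 1 for the limit.
  let f (z : I × I) : earring := if (z.1 : ℝ) < 1 then concat K (1 / (1 - z.1), z.2) else base
  have hu : ∀ s : I, (s : ℝ) < 1 → 1 ≤ 1 / (1 - (s : ℝ)) := fun s hs => by
    rw [le_div_iff₀ (by linarith)]; linarith [s.2.1]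
  -- Stage n + 1 has size at most 2 / (n + 1), and there u = 1 / (1 - s) is below n + 2 ≤ 2 (n + 1).
  -- This gives continuity at s = 1.
  have hf : ∀ z, ‖(f z : ℂ)‖ ≤ 4 * (1 - (z.1 : ℝ)) := by
    intro z
    simp only [f]
    split_ifs with hz
    · have h1 := hu _ hz
      set u := 1 / (1 - (z.1 : ℝ)) with hu'
      obtain ⟨n, hn⟩ : ∃ n, ⌊u⌋₊ = n + 1 := Nat.exists_eq_add_one.2 (Nat.floor_pos.2 h1)
      have h2 : u < ((n + 1 : ℕ) : ℝ) + 1 := hn ▸ Nat.lt_floor_add_one u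
      push_cast at h2
      rw [concat]
      dsimp only
      rw [hn]
      refine (norm_collapse_le n _).trans ?_
      rw [div_le_iff₀ (by positivity)]
      have h3 : 0 < 1 - (z.1 : ℝ) := by linarith
      have h4 : u * (1 - z.1) = 1 := by rw [hu']; field_simp
      have h5 : 1 ≤ 2 * (1 - (z.1 : ℝ)) * (n + 1) := by
        have : u ≤ 2 * (n + 1) := by linarith [(Nat.cast_nonneg n : (0 : ℝ) ≤ n)]
        nlinarith
      linarith
    · have : (z.1 : ℝ) = 1 := le_antisymm z.1.2.2 (not_lt.1 hz)
      simp [this, base]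
  have hfc : Continuous f := by
    rw [continuous_iff_continuousAt]
    intro z
    by_cases hz : (z.1 : ℝ) < 1
    · have h1 : ContinuousAt (fun y : I × I => ((1 / (1 - (y.1 : ℝ)), y.2) : ℝ × I)) z :=
        (continuousAt_const.div (by fun_prop) (by linarith)).prodMk (by fun_prop)
      have h2 := ContinuousAt.comp (f := fun y : I × I => ((1 / (1 - (y.1 : ℝ)), y.2) : ℝ × I))
        (continuousAt_concat hK (hu _ hz)) h1
      refine h2.congr ?_
      have : IsOpen {y : I × I | (y.1 : ℝ) < 1} := isOpen_lt (by fun_prop) (by fun_prop)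
      filter_upwards [this.mem_nhds hz] with y hy
      exact (if_pos hy).symm
    · rw [ContinuousAt, show f z = base from if_neg hz]
      refine tendsto_base (.of_forall hf) ?_
      have : Continuous fun y : I × I => 4 * (1 - (y.1 : ℝ)) := by fun_prop
      have hz1 : (z.1 : ℝ) = 1 := le_antisymm z.1.2.2 (not_lt.1 hz)
      simpa [hz1] using this.tendsto z
  have hfe : ∀ s t, β t = base → (t = 0 ∨ t = 1) → f (s, t) = base := by
    intro s t h ht
    simp only [f]
    split_ifs with hs
    · obtain ⟨n, hn⟩ : ∃ n, ⌊1 / (1 - (s : ℝ))⌋₊ = n + 1 :=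
        Nat.exists_eq_add_one.2 (Nat.floor_pos.2 (hu _ hs))
      rw [concat]
      dsimp only
      rw [hn]
      exact hKe _ _ _ h ht
    · rfl
  have h := isHomOn_kappa.square ⟨f, hfc⟩ fun _ => mem_univ _
  have e1 : bot ⟨f, hfc⟩ = ContinuousMap.const I base := by
    ext1 s; exact hfe s 0 β.source (.inl rfl)
  have e2 : top ⟨f, hfc⟩ = ContinuousMap.const I base := by
    ext1 s; exact hfe s 1 β.target (.inr rfl)
  have e3 : rgt ⟨f, hfc⟩ = ContinuousMap.const I base := by
    ext1 t; exact if_neg (by simp)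
  have e4 : lft ⟨f, hfc⟩ = β.toContinuousMap := by
    ext1 t
    refine (if_pos (by simp)).trans ?_
    simp only [Icc.coe_zero, _root_.sub_zero, div_one, concat, Nat.floor_one, Nat.cast_one,
      _root_.sub_self, projIcc_left]
    rw [show (1 : ℕ) = 0 + 1 from rfl]
    exact (hK0 0 t).trans (collapse_zero _)
  rw [e1, e2, e3, e4, isHomOn_kappa.const _ (mem_univ _), kappa_loop, mul_one, mul_one] at h
  exact h.symm

end HawaiianPants

/-! ### Plane geometry of the pair of pants -/

namespace HawaiianPants

/-- The interior of the pair of pants. -/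
def inner : Set ℂ := {z | z.re ^ 2 + z.im ^ 2 < 1 ∧ 1 / 16 < (z.re + 1 / 2) ^ 2 + z.im ^ 2 ∧
  1 / 16 < (z.re - 1 / 2) ^ 2 + z.im ^ 2}

theorem isOpen_inner : IsOpen inner := by
  have h1 : IsOpen {z : ℂ | z.re ^ 2 + z.im ^ 2 < 1} := isOpen_lt (by fun_prop) (by fun_prop)
  have h2 : IsOpen {z : ℂ | 1 / 16 < (z.re + 1 / 2) ^ 2 + z.im ^ 2} :=
    isOpen_lt (by fun_prop) (by fun_prop)
  have h3 : IsOpen {z : ℂ | 1 / 16 < (z.re - 1 / 2) ^ 2 + z.im ^ 2} :=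
    isOpen_lt (by fun_prop) (by fun_prop)
  exact h1.inter (h2.inter h3)

/-- The coordinates of the points of the upper half of the pair of pants. -/
def Upper (u v : ℝ) : Prop := (u ^ 2 + v ^ 2 < 1 ∧ 1 / 16 < (u + 1 / 2) ^ 2 + v ^ 2 ∧
  -- The half reaches below the axis only through the three gaps of the real axis: two between a
  -- hole and the outer circle, one between the holes.
  1 / 16 < (u - 1 / 2) ^ 2 + v ^ 2) ∧ (0 < v ∨ 3 / 4 < |u| ∧ -(1 / 3) < v ∨ |u| < 1 / 4 ∧ -(1 / 2) < v)

/-- The upper and, for `e = -1`, lower halves of the pair of pants, slightly enlarged. -/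
def half (e : ℝ) : Set ℂ := {z | Upper z.re (e * z.im)}

theorem isOpen_half (e : ℝ) : IsOpen (half e) := by
  have h1 : IsOpen {z : ℂ | z.re ^ 2 + (e * z.im) ^ 2 < 1} := isOpen_lt (by fun_prop) (by fun_prop)
  have h2 : IsOpen {z : ℂ | 1 / 16 < (z.re + 1 / 2) ^ 2 + (e * z.im) ^ 2} :=
    isOpen_lt (by fun_prop) (by fun_prop)
  have h3 : IsOpen {z : ℂ | 1 / 16 < (z.re - 1 / 2) ^ 2 + (e * z.im) ^ 2} :=
    isOpen_lt (by fun_prop) (by fun_prop)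
  have h4 : IsOpen {z : ℂ | 0 < e * z.im} := isOpen_lt (by fun_prop) (by fun_prop)
  have h5 : IsOpen {z : ℂ | 3 / 4 < |z.re|} := isOpen_lt (by fun_prop) (by fun_prop)
  have h6 : IsOpen {z : ℂ | -(1 / 3) < e * z.im} := isOpen_lt (by fun_prop) (by fun_prop)
  have h7 : IsOpen {z : ℂ | |z.re| < 1 / 4} := isOpen_lt (by fun_prop) (by fun_prop)
  have h8 : IsOpen {z : ℂ | -(1 / 2) < e * z.im} := isOpen_lt (by fun_prop) (by fun_prop)
  exact (h1.inter (h2.inter h3)).inter (h4.union ((h5.inter h6).union (h7.inter h8)))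

theorem half_subset_inner {e : ℝ} (he : e ^ 2 = 1) : half e ⊆ inner := by
  rintro z ⟨h, -⟩
  simp only [mul_pow, he, one_mul] at h
  exact h

theorem inner_subset {z : ℂ} (hz : z ∈ inner) : z ∈ half 1 ∨ z ∈ half (-1) := by
  have hi : ∀ e : ℝ, e ^ 2 = 1 → z.re ^ 2 + (e * z.im) ^ 2 < 1 ∧
      1 / 16 < (z.re + 1 / 2) ^ 2 + (e * z.im) ^ 2 ∧
      1 / 16 < (z.re - 1 / 2) ^ 2 + (e * z.im) ^ 2 := fun e he => by
    simp only [mul_pow, he, one_mul]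
    exact hz
  obtain ⟨h1, h2, h3⟩ := hz
  rcases lt_trichotomy z.im 0 with h | h | h
  · right
    exact ⟨hi _ (by norm_num), .inl (by linarith)⟩
  · left
    refine ⟨hi _ (by norm_num), .inr ?_⟩
    simp only [h, mul_zero]
    rw [h] at h1 h2 h3
    rcases lt_or_ge (3 / 4) |z.re| with h4 | h4
    · exact .inl ⟨h4, by norm_num⟩
    · right
      rw [abs_le] at h4
      refine ⟨abs_lt.2 ⟨?_, ?_⟩, by norm_num⟩ <;> nlinarith
  · left
    exact ⟨hi _ (by norm_num), .inl (by linarith)⟩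

/-- The height of a section of the upper half over its horizontal coordinate. -/
def height (u : ℝ) : ℝ := √(1 - u ^ 2) / 2

theorem height_sq {u : ℝ} (h : u ^ 2 < 1) : height u ^ 2 = (1 - u ^ 2) / 4 := by
  rw [height, div_pow, Real.sq_sqrt (by linarith)]; norm_num

theorem height_pos {u : ℝ} (h : u ^ 2 < 1) : 0 < height u :=
  div_pos (Real.sqrt_pos.2 (by linarith)) two_pos

theorem continuous_height : Continuous height := by
  unfold height; fun_prop

/-- The half ellipse u² + 4 v² = 1 passes above both holes; its distance from their centers is least
at u = ±2 / 3. -/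
theorem upper_height {u : ℝ} (h : u ^ 2 < 1) : Upper u (height u) := by
  have := height_sq h
  refine ⟨⟨?_, ?_, ?_⟩, .inl (height_pos h)⟩ <;> rw [this] <;>
    nlinarith [sq_nonneg (u - 2 / 3), sq_nonneg (u + 2 / 3)]

/-- If v > 0, the segment never falls below its lower end and so avoids the holes. If v ≤ 0, the
point lies in a gap, where u alone keeps it off the holes. -/
theorem Upper.segment {u v t : ℝ} (h : Upper u v) (h0 : 0 ≤ t) (h1 : t ≤ 1) :
    Upper u ((1 - t) * v + t * height u) := by
  have hu : u ^ 2 < 1 := by nlinarith [h.1.1, sq_nonneg v]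
  have hs := height_pos hu
  obtain ⟨⟨a1, a2, a3⟩, -⟩ := upper_height hu
  obtain ⟨⟨b1, b2, b3⟩, b4⟩ := h
  set s := height u
  set w := (1 - t) * v + t * s with hw
  have hwv : w - v = t * (s - v) := by rw [hw]; ring
  have hws : w - s = (1 - t) * (v - s) := by rw [hw]; ring
  have h1' := sub_nonneg.2 h1
  have hw2 : w ^ 2 ≤ max (v ^ 2) (s ^ 2) := by
    have : w ^ 2 ≤ (1 - t) * v ^ 2 + t * s ^ 2 := by
      nlinarith [mul_nonneg (mul_nonneg h0 (sub_nonneg.2 h1)) (sq_nonneg (v - s))]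
    have h2 := le_max_left (v ^ 2) (s ^ 2)
    have h3 := le_max_right (v ^ 2) (s ^ 2)
    nlinarith
  have c1 : u ^ 2 + w ^ 2 < 1 := by
    rcases max_choice (v ^ 2) (s ^ 2) with h | h <;> rw [h] at hw2 <;> linarith
  rcases lt_or_ge 0 v with hv | hv
  · have hw0 : 0 < w := by
      rcases h0.eq_or_lt with h | h
      · rw [hw, ← h]; linarith
      · nlinarith [mul_pos h hs, mul_nonneg (sub_nonneg.2 h1) hv.le]
    have hw3 : v ^ 2 ≤ w ^ 2 ∨ s ^ 2 ≤ w ^ 2 := by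
      rcases le_total v s with h | h
      · left
        have : v ≤ w := by linarith [mul_nonneg h0 (sub_nonneg.2 h)]
        exact pow_le_pow_left₀ hv.le this 2
      · right
        have : s ≤ w := by linarith [mul_nonneg h1' (sub_nonneg.2 h)]
        exact pow_le_pow_left₀ hs.le this 2
    refine ⟨⟨c1, ?_, ?_⟩, .inl hw0⟩ <;> rcases hw3 with h | h <;> linarith
  · have hvw : v ≤ w := by linarith [mul_nonneg h0 (sub_nonneg.2 (hv.trans hs.le))]
    have hu4 : 1 / 16 < (u + 1 / 2) ^ 2 ∧ 1 / 16 < (u - 1 / 2) ^ 2 := by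
      rcases b4 with h | h | h
      · linarith
      · rcases lt_abs.1 h.1 with h | h <;> constructor <;> nlinarith
      · have := abs_lt.1 h.1
        constructor <;> nlinarith
    refine ⟨⟨c1, by nlinarith [sq_nonneg w], by nlinarith [sq_nonneg w]⟩, ?_⟩
    rcases b4 with h | h | h
    · linarith
    · exact .inr (.inl ⟨h.1, by linarith⟩)
    · exact .inr (.inr ⟨h.1, by linarith⟩)

theorem section_mem_half {e : ℝ} (he : e ^ 2 = 1) {u : ℝ} (h : u ^ 2 < 1) :
    (⟨u, e * height u⟩ : ℂ) ∈ half e := by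
  change Upper u (e * (e * height u))
  rw [← mul_assoc, ← sq, he, one_mul]
  exact upper_height h

theorem re_sq_lt {e : ℝ} {z : ℂ} (hz : z ∈ half e) : z.re ^ 2 < 1 := by
  nlinarith [hz.1.1, sq_nonneg (e * z.im)]

/-- The half is moved vertically onto the arc of the ellipse, and the arc is then contracted to its
middle point. -/
theorem contractibleSpace_half {e : ℝ} (he : e ^ 2 = 1) : ContractibleSpace (half e) := by
  have hmk : ∀ {Z : Type} [TopologicalSpace Z] {f g : Z → ℝ}, Continuous f → Continuous g →
      Continuous fun z => (⟨f z, g z⟩ : ℂ) := fun hf hg =>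
    Complex.equivRealProdCLM.symm.continuous.comp (hf.prodMk hg)
  have hh := continuous_height
  let P : C(half e, half e) := ⟨fun z => ⟨⟨(z : ℂ).re, e * height (z : ℂ).re⟩,
    section_mem_half he (re_sq_lt z.2)⟩, (hmk (by fun_prop) (by fun_prop)).subtype_mk _⟩
  have m1 : ∀ y : I × half e, (⟨(y.2 : ℂ).re,
      (1 - (y.1 : ℝ)) * (y.2 : ℂ).im + y.1 * (e * height (y.2 : ℂ).re)⟩ : ℂ) ∈ half e := by
    intro y
    have := y.2.2.segment y.1.2.1 y.1.2.2
    change Upper _ (e * _)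
    convert this using 1
    linear_combination (y.1 * height (y.2 : ℂ).re : ℝ) * he
  have m2 : ∀ y : I × half e, (⟨(1 - (y.1 : ℝ)) * (y.2 : ℂ).re,
      e * height ((1 - (y.1 : ℝ)) * (y.2 : ℂ).re)⟩ : ℂ) ∈ half e := by
    refine fun y => section_mem_half he ?_
    have h1 := re_sq_lt y.2.2
    have h2 := y.1.2.1
    have h3 := y.1.2.2
    rw [mul_pow]
    have : (1 - (y.1 : ℝ)) ^ 2 ≤ 1 := by nlinarith
    nlinarith [sq_nonneg (y.2 : ℂ).re]
  let H1 : (ContinuousMap.id (half e)).Homotopy P :=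
    { toFun := fun y => ⟨_, m1 y⟩
      continuous_toFun := (hmk (by fun_prop) (by fun_prop)).subtype_mk m1
      map_zero_left := fun z => by ext; simp
      map_one_left := fun z => by ext; simp [P] }
  let H2 : P.Homotopy (ContinuousMap.const _ ⟨⟨0, e * height 0⟩, section_mem_half he (by norm_num)⟩) :=
    { toFun := fun y => ⟨_, m2 y⟩
      continuous_toFun := (hmk (by fun_prop) (by fun_prop)).subtype_mk m2
      map_zero_left := fun z => by ext; simp [P]
      map_one_left := fun z => by ext; simp }
  rw [contractible_iff_id_nullhomotopic]
  exact ⟨_, ⟨H1.trans H2⟩⟩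

variable {Q : Type*} [Group Q]

/-- Homomorphisms on the paths of a simply connected set have potentials. -/
theorem exists_potential {U : Set ℂ} (hU : SimplyConnectedSpace U) {φ : C(I, ℂ) → Q}
    (hφ : IsHomOn U φ) : ∃ u : ℂ → Q, ∀ γ : C(I, ℂ), (∀ t, γ t ∈ U) → u (γ 0) * φ γ = u (γ 1) := by
  classical
  let ψ : C(I, U) → Q := fun γ => φ ((⟨Subtype.val, continuous_subtype_val⟩ : C(U, ℂ)).comp γ)
  have hψ : IsHomOn univ ψ :=
    ⟨fun x _ => hφ.const x x.2,
      fun F _ => hφ.square ((⟨Subtype.val, continuous_subtype_val⟩ : C(U, ℂ)).comp F) fun z => (F z).2⟩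
  obtain ⟨x0⟩ := (inferInstance : Nonempty U)
  let c (x : U) : Path x0 x := PathConnectedSpace.somePath x0 x
  refine ⟨fun z => if h : z ∈ U then ψ (c ⟨z, h⟩).toContinuousMap else 1, fun γ hγ => ?_⟩
  dsimp only
  rw [dif_pos (hγ 0), dif_pos (hγ 1)]
  let δ : Path (⟨γ 0, hγ 0⟩ : U) ⟨γ 1, hγ 1⟩ := ⟨⟨fun t => ⟨γ t, hγ t⟩, by fun_prop⟩, rfl, rfl⟩
  have := hψ.homotopic (SimplyConnectedSpace.paths_homotopic ((c ⟨γ 0, hγ 0⟩).trans δ) (c ⟨γ 1, hγ 1⟩))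
  rw [hψ.map_trans] at this
  exact this

/-- The centers of the boundary circles of the pair of pants. -/
def cen : Fin 3 → ℝ
  | 0 => 0
  | 1 => -(1 / 2)
  | 2 => 1 / 2

/-- The neighborhoods of the boundary circles of the pair of pants. -/
def collar : Fin 3 → Set ℂ
  | 0 => {z | 49 / 64 < z.re ^ 2 + z.im ^ 2}
  | 1 => {z | (z.re + 1 / 2) ^ 2 + z.im ^ 2 < 9 / 64}
  | 2 => {z | (z.re - 1 / 2) ^ 2 + z.im ^ 2 < 9 / 64}

theorem isOpen_collar (j : Fin 3) : IsOpen (collar j) := by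
  fin_cases j
  · exact isOpen_lt (by fun_prop) (by fun_prop)
  · exact isOpen_lt (by fun_prop) (by fun_prop)
  · exact isOpen_lt (by fun_prop) (by fun_prop)

theorem collar_eq {i j : Fin 3} {z : ℂ} (hi : z ∈ collar i) (hj : z ∈ collar j) : i = j := by
  fin_cases i <;> fin_cases j <;> first
    | rfl
    | exfalso
      simp only [collar, mem_ofPred_eq] at hi hj
      nlinarith [sq_nonneg z.im]

theorem mem_collar_zero_half {e : ℝ} (he : e ^ 2 = 1) {z : ℂ} :
    z ∈ collar 0 ∩ half e ↔ 49 / 64 < z.re ^ 2 + z.im ^ 2 ∧ z.re ^ 2 + z.im ^ 2 < 1 ∧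
      -(1 / 3) < e * z.im := by
  have hv : (e * z.im) ^ 2 = z.im ^ 2 := by rw [mul_pow, he, one_mul]
  constructor
  · rintro ⟨h0, ⟨h1, h2, h3⟩, h4⟩
    rw [hv] at h1 h2 h3
    have h0 : 49 / 64 < z.re ^ 2 + z.im ^ 2 := h0
    refine ⟨h0, h1, ?_⟩
    rcases h4 with h | h | h
    · linarith
    · exact h.2
    · by_contra hn
      have := abs_lt.1 h.1
      have : z.im ^ 2 < 1 / 4 := by rw [← hv]; nlinarith
      nlinarith
  · rintro ⟨h0, h1, h2⟩
    refine ⟨h0, ⟨?_, ?_, ?_⟩, ?_⟩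
    · rwa [hv]
    · rw [hv]
      rcases le_total z.re (-(7 / 8)) with h | h <;> nlinarith [sq_nonneg z.im]
    · rw [hv]
      rcases le_total z.re (7 / 8) with h | h <;> nlinarith [sq_nonneg z.im]
    · rcases lt_or_ge 0 (e * z.im) with h | h
      · exact .inl h
      · refine .inr (.inl ⟨?_, h2⟩)
        have : z.im ^ 2 < 1 / 9 := by rw [← hv]; nlinarith
        rw [lt_abs]
        by_contra! hn
        nlinarith

theorem mem_collar_half {e : ℝ} (he : e ^ 2 = 1) {z : ℂ} {j : Fin 3} (hj : j ≠ 0) :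
    z ∈ collar j ∩ half e ↔ 1 / 16 < (z.re - cen j) ^ 2 + z.im ^ 2 ∧
      (z.re - cen j) ^ 2 + z.im ^ 2 < 9 / 64 ∧ (0 < e * z.im ∨ 1 / 16 < (z.re - cen j) ^ 2) := by
  have hv : (e * z.im) ^ 2 = z.im ^ 2 := by rw [mul_pow, he, one_mul]
  constructor
  · rintro ⟨h0, ⟨h1, h2, h3⟩, h4⟩
    rw [hv] at h1 h2 h3
    have key : 0 < e * z.im ∨ 1 / 16 < (z.re + 1 / 2) ^ 2 ∧ 1 / 16 < (z.re - 1 / 2) ^ 2 := by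
      rcases h4 with h | h | h
      · exact .inl h
      · right
        rcases lt_abs.1 h.1 with h | h <;> constructor <;> nlinarith
      · right
        have := abs_lt.1 h.1
        constructor <;> nlinarith
    fin_cases j
    · exact absurd rfl hj
    · simp only [cen, sub_neg_eq_add]
      exact ⟨h2, h0, key.imp_right And.left⟩
    · simp only [cen]
      exact ⟨h3, h0, key.imp_right And.right⟩
  · rintro ⟨h0, h1, h2⟩
    have hi : ∀ {x : ℝ}, x ^ 2 + z.im ^ 2 < 9 / 64 → 1 / 16 < x ^ 2 → -(1 / 3) < e * z.im := by
      intro x hx hx'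
      nlinarith
    fin_cases j
    · exact absurd rfl hj
    · simp only [cen, sub_neg_eq_add] at h0 h1 h2
      have hr : z.re < -(1 / 8) := by nlinarith [sq_nonneg z.im]
      have hr' : -(7 / 8) < z.re := by nlinarith [sq_nonneg z.im]
      refine ⟨h1, ⟨?_, ?_, ?_⟩, ?_⟩
      · rw [hv]; nlinarith
      · rwa [hv]
      · rw [hv]; nlinarith
      · rcases h2 with h | h
        · exact .inl h
        · right
          rcases le_or_gt z.re (-(1 / 2)) with h' | h'
          · exact .inl ⟨lt_abs.2 (.inr (by nlinarith)), hi h1 h⟩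
          · exact .inr ⟨abs_lt.2 ⟨by nlinarith, by linarith⟩, by linarith [hi h1 h]⟩
    · simp only [cen] at h0 h1 h2
      have hr : 1 / 8 < z.re := by nlinarith [sq_nonneg z.im]
      have hr' : z.re < 7 / 8 := by nlinarith [sq_nonneg z.im]
      refine ⟨h1, ⟨?_, ?_, ?_⟩, ?_⟩
      · rw [hv]; nlinarith
      · rw [hv]; nlinarith
      · rwa [hv]
      · rcases h2 with h | h
        · exact .inl h
        · right
          rcases le_or_gt (1 / 2) z.re with h' | h'
          · exact .inl ⟨lt_abs.2 (.inl (by nlinarith)), hi h1 h⟩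
          · exact .inr ⟨abs_lt.2 ⟨by linarith, by nlinarith⟩, by linarith [hi h1 h]⟩

/-- The intersection of a collar with a half is closed under raising points on circles. -/
theorem collar_half_raise {e : ℝ} (he : e ^ 2 = 1) {j : Fin 3} {z z' : ℂ} (hz : z ∈ collar j ∩ half e)
    (h : (z'.re - cen j) ^ 2 + z'.im ^ 2 = (z.re - cen j) ^ 2 + z.im ^ 2)
    (h' : e * z.im ≤ e * z'.im) : z' ∈ collar j ∩ half e := by
  have hv : (e * z.im) ^ 2 = z.im ^ 2 := by rw [mul_pow, he, one_mul]
  have hv' : (e * z'.im) ^ 2 = z'.im ^ 2 := by rw [mul_pow, he, one_mul]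
  by_cases hj : j = 0
  · subst hj
    rw [mem_collar_zero_half he] at hz ⊢
    simp only [cen, _root_.sub_zero] at h
    rw [h]
    exact ⟨hz.1, hz.2.1, by linarith [hz.2.2]⟩
  · rw [mem_collar_half he hj] at hz ⊢
    rw [h]
    refine ⟨hz.1, hz.2.1, ?_⟩
    rcases lt_or_ge 0 (e * z'.im) with h1 | h1
    · exact .inl h1
    · right
      rcases hz.2.2 with h2 | h2
      · linarith
      · nlinarith

/-- The highest points of circles in the collars. -/
theorem mem_collar_half_top {e : ℝ} (he : e ^ 2 = 1) {j : Fin 3} {ρ : ℝ}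
    (hρ : if j = 0 then 7 / 8 < ρ ∧ ρ < 1 else 1 / 4 < ρ ∧ ρ < 3 / 8) :
    (⟨cen j, e * ρ⟩ : ℂ) ∈ collar j ∩ half e := by
  have h1 : e * (e * ρ) = ρ := by rw [← mul_assoc, ← sq, he, one_mul]
  have h2 : (e * ρ) ^ 2 = ρ ^ 2 := by rw [mul_pow, he, one_mul]
  split_ifs at hρ with hj
  · subst hj
    rw [mem_collar_zero_half he]
    simp only [cen]
    rw [h1, h2]
    refine ⟨?_, ?_, ?_⟩ <;> nlinarith
  · rw [mem_collar_half he hj]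
    simp only
    rw [h1, h2]
    refine ⟨?_, ?_, .inl ?_⟩ <;> nlinarith

theorem radius_bounds {e : ℝ} (he : e ^ 2 = 1) {j : Fin 3} {z : ℂ} (hz : z ∈ collar j ∩ half e) :
    if j = 0 then 7 / 8 < ‖z - cen j‖ ∧ ‖z - cen j‖ < 1
      else 1 / 4 < ‖z - cen j‖ ∧ ‖z - cen j‖ < 3 / 8 := by
  have h : ‖z - cen j‖ ^ 2 = (z.re - cen j) ^ 2 + z.im ^ 2 := by
    rw [← Complex.normSq_eq_norm_sq, Complex.normSq_apply]
    simp only [Complex.sub_re, Complex.sub_im, Complex.ofReal_re, Complex.ofReal_im]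
    ring
  have h0 := norm_nonneg (z - cen j)
  split_ifs with hj
  · subst hj
    rw [mem_collar_zero_half he] at hz
    simp only [cen, _root_.sub_zero] at h hz
    simp only [cen] at h0 ⊢
    constructor <;> nlinarith
  · rw [mem_collar_half he hj, ← h] at hz
    constructor <;> nlinarith

/-- The intersections of the collars with the halves are path connected. -/
theorem joinedIn_collar_half {e : ℝ} (he : e ^ 2 = 1) {j : Fin 3} {z z' : ℂ}
    (hz : z ∈ collar j ∩ half e) (hz' : z' ∈ collar j ∩ half e) :
    JoinedIn (collar j ∩ half e) z z' := by
  have key : ∀ {z : ℂ}, z ∈ collar j ∩ half e →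
      JoinedIn (collar j ∩ half e) z ⟨cen j, e * ‖z - cen j‖⟩ := by
    intro z hz
    set w : ℂ := (z - cen j) / (e * Complex.I) with hw
    have heC : (e : ℂ) ^ 2 = 1 := by exact_mod_cast he
    have heI : (e * Complex.I : ℂ) ≠ 0 := by
      intro h
      have : (e * Complex.I : ℂ) ^ 2 = -1 := by rw [mul_pow, heC, Complex.I_sq]; ring
      rw [h] at this; norm_num at this
    have habs : |e| = 1 := (sq_eq_sq₀ (abs_nonneg e) zero_le_one).1 (by rw [sq_abs, he, one_pow])
    have hnw : ‖w‖ = ‖z - cen j‖ := by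
      rw [hw, norm_div, norm_mul, Complex.norm_I, Complex.norm_real, Real.norm_eq_abs, habs]; simp
    -- Angles are measured from the top direction e i. Rotating from the top to z keeps the height
    -- at least that of z, since the cosine decreases in the absolute angle.
    let f (t : ℝ) : ℂ := cen j + e * Complex.I * (‖w‖ * Complex.exp ((t * w.arg : ℝ) * Complex.I))
    have hre : ∀ t, (f t).re - cen j = -(e * (‖w‖ * Real.sin (t * w.arg))) := by
      intro t
      simp only [f, Complex.add_re, Complex.mul_re, Complex.mul_im, Complex.ofReal_re,
        Complex.ofReal_im, Complex.I_re, Complex.I_im, Complex.exp_ofReal_mul_I_re,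
        Complex.exp_ofReal_mul_I_im]
      ring
    have him : ∀ t, (f t).im = e * (‖w‖ * Real.cos (t * w.arg)) := by
      intro t
      simp only [f, Complex.add_im, Complex.mul_re, Complex.mul_im, Complex.ofReal_re,
        Complex.ofReal_im, Complex.I_re, Complex.I_im, Complex.exp_ofReal_mul_I_re,
        Complex.exp_ofReal_mul_I_im]
      ring
    have f1 : f 1 = z := by
      simp only [f]
      rw [one_mul, Complex.norm_mul_exp_arg_mul_I, hw]
      rw [mul_div_cancel₀ _ heI]
      ring
    have f0 : f 0 = ⟨cen j, e * ‖z - cen j‖⟩ := by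
      refine Complex.ext ?_ ?_
      · have := hre 0
        simp at this
        simp only
        linarith
      · simp [him, hnw]
    have hfc : Continuous f := by fun_prop
    have : JoinedIn (collar j ∩ half e) (f 0) (f 1) := by
      refine ⟨⟨⟨fun t => f t, by fun_prop⟩, by simp, by simp⟩, fun t => ?_⟩
      change f t ∈ _
      refine collar_half_raise he hz ?_ ?_
      · have h1 : ∀ t, ((f t).re - cen j) ^ 2 + (f t).im ^ 2 = ‖w‖ ^ 2 := by
          intro t
          rw [hre, him]
          linear_combination (‖w‖ ^ 2) * he + e ^ 2 * ‖w‖ ^ 2 * Real.sin_sq_add_cos_sq (t * w.arg)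
        rw [h1, ← h1 1, f1]
      · rw [← f1, him, him, ← mul_assoc, ← mul_assoc e e, ← sq, he, one_mul, one_mul, one_mul]
        refine mul_le_mul_of_nonneg_left ?_ (norm_nonneg _)
        rw [← Real.cos_abs, ← Real.cos_abs ((t : ℝ) * w.arg), abs_mul, abs_of_nonneg t.2.1]
        exact Real.cos_le_cos_of_nonneg_of_le_pi (mul_nonneg t.2.1 (abs_nonneg _))
          (Complex.abs_arg_le_pi w) (mul_le_of_le_one_left (abs_nonneg _) t.2.2)
    rw [f0, f1] at this
    exact this.symm
  have hseg : JoinedIn (collar j ∩ half e) ⟨cen j, e * ‖z - cen j‖⟩ ⟨cen j, e * ‖z' - cen j‖⟩ := by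
    let f (t : ℝ) : ℂ := cen j + (e * ((1 - t) * ‖z - cen j‖ + t * ‖z' - cen j‖) : ℝ) * Complex.I
    have hf : ∀ t, f t = ⟨cen j, e * ((1 - t) * ‖z - cen j‖ + t * ‖z' - cen j‖)⟩ := by
      intro t; apply Complex.ext <;> simp [f]
    have hfc : Continuous f := by fun_prop
    refine ⟨⟨⟨fun t => f t, by fun_prop⟩, by simp [hf], by simp [hf]⟩, fun t => ?_⟩
    change f t ∈ _
    rw [hf]
    refine mem_collar_half_top he ?_
    have h1 := radius_bounds he hz
    have h2 := radius_bounds he hz'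
    have h3 := t.2.1
    have h4 := sub_nonneg.2 t.2.2
    split_ifs at h1 h2 ⊢
    · exact convex_Ioo _ _ h1 h2 h4 h3 (sub_add_cancel _ _)
    · exact convex_Ioo _ _ h1 h2 h4 h3 (sub_add_cancel _ _)
  exact (key hz).trans (hseg.trans (key hz').symm)

end HawaiianPants

namespace HawaiianPants

variable {Q : Type*} [Group Q]

/-! ### The radial projections of the collars -/

theorem ring_mem_circle (m : ℕ+) (w : ℂ) :
    ((‖w‖ : ℂ) - Complex.I * w) / ((m : ℝ) * ‖w‖ : ℝ) ∈ circle m := by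
  have hm : (m : ℝ) ≠ 0 := by exact_mod_cast m.ne_zero
  rw [mem_circle_iff, Complex.normSq_div, Complex.normSq_ofReal, Complex.div_ofReal_re]
  have h : ‖w‖ ^ 2 = w.re ^ 2 + w.im ^ 2 := by
    rw [← Complex.normSq_eq_norm_sq, Complex.normSq_apply]; ring
  simp only [Complex.normSq_apply, Complex.sub_re, Complex.sub_im, Complex.mul_re, Complex.mul_im,
    Complex.I_re, Complex.I_im, Complex.ofReal_re, Complex.ofReal_im]
  by_cases h0 : ‖w‖ = 0
  · rw [h0]; simp
  · field_simp
    linear_combination -h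

/-- The point of the circle `C_m` in the direction of `w`, the base point being the lowest one. -/
def ring (m : ℕ+) (w : ℂ) : earring := ⟨_, mem_iUnion.2 ⟨m, ring_mem_circle m w⟩⟩

theorem ring_re (m : ℕ+) (w : ℂ) : (ring m w : ℂ).re = (‖w‖ + w.im) / (m * ‖w‖) := by
  change ((‖w‖ - Complex.I * w) / ((m : ℝ) * ‖w‖ : ℝ) : ℂ).re = _
  rw [Complex.div_ofReal_re]
  simp

theorem ring_im (m : ℕ+) (w : ℂ) : (ring m w : ℂ).im = -w.re / (m * ‖w‖) := by
  change ((‖w‖ - Complex.I * w) / ((m : ℝ) * ‖w‖ : ℝ) : ℂ).im = _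
  rw [Complex.div_ofReal_im]
  simp

theorem continuousAt_ring (m : ℕ+) {w : ℂ} (hw : w ≠ 0) : ContinuousAt (ring m) w := by
  refine IsInducing.subtypeVal.continuousAt_iff.2 ?_
  have hm : (m : ℝ) ≠ 0 := by exact_mod_cast m.ne_zero
  refine ContinuousAt.div (f := fun w : ℂ => (‖w‖ : ℂ) - Complex.I * w)
    (g := fun w : ℂ => (((m : ℝ) * ‖w‖ : ℝ) : ℂ)) (by fun_prop) (by fun_prop) ?_
  exact_mod_cast mul_ne_zero hm (norm_ne_zero_iff.2 hw)

theorem ring_ne_base (m : ℕ+) {w : ℂ} (h : w.re ≠ 0 ∨ 0 < w.im) : ring m w ≠ base := by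
  have hm : (m : ℝ) ≠ 0 := by exact_mod_cast m.ne_zero
  have hw : ‖w‖ ≠ 0 := by
    rw [norm_ne_zero_iff]
    rintro rfl
    simp at h
  intro hb
  have h1 := ring_re m w
  have h2 := ring_im m w
  rw [hb] at h1 h2
  change 0 = _ at h1
  change 0 = _ at h2
  rw [eq_div_iff (mul_ne_zero hm hw)] at h1 h2
  rcases h with h | h
  · apply h; linarith
  · linarith [norm_nonneg w]

theorem ring_mem_untop (N : ℕ) (m : ℕ+) {w : ℂ} (h : w.re ≠ 0 ∨ w.im < 0) : ring m w ∈ untop N := by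
  have hm : (m : ℝ) ≠ 0 := by exact_mod_cast m.ne_zero
  have hw : ‖w‖ ≠ 0 := by
    rw [norm_ne_zero_iff]
    rintro rfl
    simp at h
  by_cases h0 : w.re = 0
  · right
    have him := h.resolve_left (not_not.2 h0)
    have : ‖w‖ = -w.im := by
      rw [← Complex.re_add_im w, h0]
      simp [abs_of_neg him]
    rw [ring_re, this]
    simp
  · left
    rw [ring_im]
    exact div_ne_zero (neg_ne_zero.2 h0) (mul_ne_zero hm hw)

/-- Clockwise from the lowest point one first meets the left side, which is the side of the frames.
Only the right side picks up a factor. -/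
theorem side_ring {N : ℕ} {m : ℕ+} (hm : (m : ℕ) ≤ N) (c : ℕ+ → Q) (w : ℂ) :
    side N c (ring m w) = if 0 < w.re then (c m)⁻¹ else 1 := by
  have hm0 : (0 : ℝ) < m := by exact_mod_cast m.pos
  have hp : ∀ h : w.re ≠ 0, 0 < coord (ring m w) ↔ 0 < w.re := by
    intro h
    have hb := ring_ne_base m (.inl h)
    have hw : 0 < ‖w‖ := norm_pos_iff.2 fun h0 => h (by rw [h0]; rfl)
    rw [coord, Complex.inv_im, ring_im, div_pos_iff_of_pos_right, neg_div, neg_neg,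
      div_pos_iff_of_pos_right (mul_pos hm0 hw)]
    exact Complex.normSq_pos.2 fun h0 => hb (coe_eq_zero.1 h0)
  rw [side]
  by_cases h : 0 < w.re
  · have hb := ring_ne_base m (.inl h.ne')
    have hi : idx (ring m w) = m := idx_eq hb (ring_mem_circle m w)
    rw [if_pos h, hi, if_pos ⟨hm, hb, (hp h.ne').2 h⟩]
  · rw [if_neg h, if_neg]
    rintro ⟨-, hb, hc⟩
    by_cases h0 : w.re = 0
    · rw [coord, Complex.inv_im, ring_im, h0] at hc
      simp at hc
    · exact h ((hp h0).1 hc)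

/-- The numbers of the circles to which the boundary of the `n`-th pair of pants is attached. -/
def circ (n : ℕ+) : Fin 3 → ℕ+
  | 0 => n
  | 1 => 2 * n
  | 2 => 2 * n + 1

/-- The potential of the classes of paths in the lower parts of the collars. -/
def shade (l : Fin 3 → Q) (j : Fin 3) (z : ℂ) : Q := if cen j < z.re then (l j)⁻¹ else 1

theorem sub_cen_of_mem {e : ℝ} (he : e ^ 2 = 1) {j : Fin 3} {z : ℂ} (hz : z ∈ collar j ∩ half e) :
    (z - cen j).re ≠ 0 ∨ 0 < e * (z - cen j).im := by
  simp only [Complex.sub_re, Complex.sub_im, Complex.ofReal_re, Complex.ofReal_im, _root_.sub_zero]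
  have hv : (e * z.im) ^ 2 = z.im ^ 2 := by rw [mul_pow, he, one_mul]
  by_cases hj : j = 0
  · subst hj
    rw [mem_collar_zero_half he] at hz
    simp only [cen, _root_.sub_zero]
    by_cases h : z.re = 0
    · right
      rw [h] at hz
      nlinarith [hz.1, hz.2.2]
    · exact .inl h
  · rw [mem_collar_half he hj] at hz
    rcases hz.2.2 with h | h
    · exact .inr h
    · left
      intro h0
      rw [h0] at h
      norm_num at h

/-- The upper part of a collar contains no point straight below the center, the direction sent to
the base point. -/
theorem kappa_rim_upper {m : ℕ+} {j : Fin 3} {γ : C(I, ℂ)} (h : ∀ t, γ t ∈ collar j ∩ half 1)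
    {δ : C(I, earring)} (hδ : ∀ t, δ t = ring m (γ t - cen j)) : kappa δ = 1 := by
  refine kappa_of_ne_base fun t => ?_
  rw [hδ]
  exact ring_ne_base m (by simpa using sub_cen_of_mem (by norm_num) (h t))

/-- The lower part contains no point straight above the center, so the projection stays in `untop`.
The collapse kills the circle itself and only the jump between its two sides remains. -/
theorem kappa_rim_lower {n : ℕ+} {j : Fin 3} {γ : C(I, ℂ)} (h : ∀ t, γ t ∈ collar j ∩ half (-1))
    {δ : C(I, earring)} (hδ : ∀ t, δ t = ring (circ n j) (γ t - cen j)) :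
    kappa δ = (shade (loopL ∘ circ n) j (γ 0))⁻¹ * shade (loopL ∘ circ n) j (γ 1) := by
  have hu : ∀ t, δ t ∈ untop (circ n j) := fun t => by
    rw [hδ]
    exact ring_mem_untop _ _ (by simpa using sub_cen_of_mem (by norm_num) (h t))
  have hc : collapseHom (circ n j) (kappa δ) = 1 := by
    rw [collapseHom_kappa]
    refine Eq.trans ?_ (isHomOn_kappa.const base (mem_univ _))
    congr 1
    ext1 t
    change collapse _ (δ t) = base
    by_cases hb : δ t = base
    · rw [hb, collapse_base]
    · exact collapse_of_le (by rw [idx_eq hb (m := circ n j) (by rw [hδ]; exact ring_mem_circle _ _)])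
  rw [kappa_untop hu, hc, hδ, hδ, side_ring le_rfl, side_ring le_rfl]
  simp [shade]

/-! ### Potentials on the two halves of a pair of pants -/

theorem overlap_cases {z : ℂ} (h1 : z ∈ half 1) (h2 : z ∈ half (-1)) :
    z.re ^ 2 + z.im ^ 2 < 1 ∧ (3 / 4 < |z.re| ∧ |z.im| < 1 / 3 ∨ |z.re| < 1 / 4 ∧ |z.im| < 1 / 2) := by
  refine ⟨(half_subset_inner (by norm_num) h1).1, ?_⟩
  obtain ⟨-, h1⟩ := h1
  obtain ⟨-, h2⟩ := h2
  rw [one_mul] at h1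
  rw [neg_one_mul] at h2
  rw [abs_lt (a := z.im) (b := 1 / 3), abs_lt (a := z.im) (b := 1 / 2)]
  rcases h1 with h1 | h1 | h1 <;> rcases h2 with h2 | h2 | h2
  · linarith
  · exact .inl ⟨h2.1, by linarith, by linarith⟩
  · exact .inr ⟨h2.1, by linarith, by linarith⟩
  · exact .inl ⟨h1.1, by linarith, by linarith⟩
  · exact .inl ⟨h1.1, by linarith, by linarith⟩
  · linarith [h1.1, h2.1]
  · exact .inr ⟨h1.1, by linarith, by linarith⟩
  · linarith [h1.1, h2.1]
  · exact .inr ⟨h1.1, by linarith, by linarith⟩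

/-- Rectangles cut by the unit disk. -/
def rect (a b c : ℝ) : Set ℂ := {z | z.re ^ 2 + z.im ^ 2 < 1 ∧ z.re ∈ Ioo a b ∧ z.im ∈ Ioo (-c) c}

theorem convex_rect (a b c : ℝ) : Convex ℝ (rect a b c) := by
  rintro z ⟨h1, h2, h3⟩ w ⟨k1, k2, k3⟩ s t hs ht hst
  refine ⟨?_, ?_, ?_⟩
  · simp only [Complex.add_re, Complex.add_im, Complex.real_smul, Complex.mul_re, Complex.mul_im,
      Complex.ofReal_re, Complex.ofReal_im]
    have h4 : s * (z.re ^ 2 + z.im ^ 2) + t * (w.re ^ 2 + w.im ^ 2) < 1 :=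
      convex_Iio (1 : ℝ) h1 k1 hs ht hst
    obtain rfl : t = 1 - s := by linarith
    nlinarith [mul_nonneg (mul_nonneg hs ht) (add_nonneg (sq_nonneg (z.re - w.re))
      (sq_nonneg (z.im - w.im)))]
  · simpa using convex_Ioo a b h2 k2 hs ht hst
  · simpa using convex_Ioo (-c) c h3 k3 hs ht hst

theorem rect_subset {a b c : ℝ} (h : (b ≤ -(3 / 4) ∨ 3 / 4 ≤ a) ∧ c ≤ 1 / 3 ∨
    -(1 / 4) ≤ a ∧ b ≤ 1 / 4 ∧ c ≤ 1 / 2) : rect a b c ⊆ half 1 ∩ half (-1) := by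
  have key : ∀ {e : ℝ}, e = 1 ∨ e = -1 → rect a b c ⊆ half e := by
    rintro e he z ⟨h1, h2, h3⟩
    have he2 : e ^ 2 = 1 := by rcases he with rfl | rfl <;> norm_num
    have hi : -c < e * z.im := by
      rcases he with rfl | rfl
      · linarith [h3.1]
      · linarith [h3.2]
    have hr : 1 / 16 < (z.re + 1 / 2) ^ 2 ∧ 1 / 16 < (z.re - 1 / 2) ^ 2 := by
      obtain ⟨h4, h5⟩ := h2
      rcases h with ⟨h | h, -⟩ | ⟨h, h', -⟩ <;> constructor <;> nlinarith
    refine ⟨?_, ?_⟩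
    · simp only [mul_pow, he2, one_mul]
      exact ⟨h1, by nlinarith [sq_nonneg z.im], by nlinarith [sq_nonneg z.im]⟩
    · obtain ⟨h4, h5⟩ := h2
      rcases h with ⟨h | h, h'⟩ | ⟨h, h', h''⟩
      · exact .inr (.inl ⟨lt_abs.2 (.inr (by linarith)), by linarith⟩)
      · exact .inr (.inl ⟨lt_abs.2 (.inl (by linarith)), by linarith⟩)
      · exact .inr (.inr ⟨abs_lt.2 ⟨by linarith, by linarith⟩, by linarith⟩)
  exact fun z hz => ⟨key (.inl rfl) hz, key (.inr rfl) hz⟩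

/-- Two potentials on a set differ by a constant along paths. -/
theorem mul_inv_eq_of_joinedIn {S : Set ℂ} {φ : C(I, ℂ) → Q} {u w : ℂ → Q}
    (hu : ∀ γ : C(I, ℂ), (∀ t, γ t ∈ S) → u (γ 0) * φ γ = u (γ 1))
    (hw : ∀ γ : C(I, ℂ), (∀ t, γ t ∈ S) → w (γ 0) * φ γ = w (γ 1)) {z z' : ℂ} (h : JoinedIn S z z') :
    u z * (w z)⁻¹ = u z' * (w z')⁻¹ := by
  obtain ⟨γ, hγ⟩ := h
  have h1 := hu γ.toContinuousMap hγ
  have h2 := hw γ.toContinuousMap hγ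
  rw [Path.coe_toContinuousMap, γ.source, γ.target] at h1 h2
  rw [← h1, ← h2]
  group

/-- The straight path between two points of the real axis. -/
def line (a b : ℝ) : C(I, ℂ) := ⟨fun t => ((1 - t) * a + t * b : ℝ), by fun_prop⟩

/-- The class of a path on the real axis, closed up by given paths. -/
def seam (φ : C(I, ℂ) → Q) (k : ℂ → Q) (a b : ℝ) : Q := k a * φ (line a b) * (k b)⁻¹

theorem ofReal_mem_rect {a b c x : ℝ} (ha : a < x) (hb : x < b) (hc : 0 < c) (h1 : x ^ 2 < 1) :
    (x : ℂ) ∈ rect a b c := by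
  refine ⟨?_, ⟨ha, hb⟩, ?_, ?_⟩
  · rw [Complex.ofReal_re, Complex.ofReal_im]; linarith
  · rw [Complex.ofReal_im]; linarith
  · rwa [Complex.ofReal_im]

theorem line_mem_rect {a b c x y : ℝ} (hx : (x : ℂ) ∈ rect a b c) (hy : (y : ℂ) ∈ rect a b c) (t : I) :
    line x y t ∈ rect a b c := by
  have := convex_rect a b c hx hy (sub_nonneg.2 t.2.2) t.2.1 (sub_add_cancel _ _)
  convert this using 1
  simp [line]

theorem joinedIn_rect {a b c : ℝ} {z w : ℂ} (hz : z ∈ rect a b c) (hw : w ∈ rect a b c) :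
    JoinedIn (rect a b c) z w :=
  JoinedIn.of_segment_subset ((convex_rect a b c).segment_subset hz hw)

theorem simplyConnectedSpace_half {e : ℝ} (he : e ^ 2 = 1) : SimplyConnectedSpace (half e) :=
  have := contractibleSpace_half he
  inferInstance

/-- Potentials on the two halves of a pair of pants, given potentials near its boundary. -/
theorem exists_halves {φ : C(I, ℂ) → Q} (hφ : IsHomOn inner φ) {k : ℂ → Q} {l : Fin 3 → Q}
    (h1 : ∀ (j : Fin 3) (γ : C(I, ℂ)), (∀ t, γ t ∈ collar j ∩ half 1) → k (γ 0) * φ γ = k (γ 1))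
    (h2 : ∀ (j : Fin 3) (γ : C(I, ℂ)), (∀ t, γ t ∈ collar j ∩ half (-1)) →
      shade l j (γ 0) * k (γ 0) * φ γ = shade l j (γ 1) * k (γ 1))
    {x y : Q} (hx : seam φ k (-13 / 16) (-15 / 16) = x) (hy : seam φ k (13 / 16) (15 / 16) = y) :
    l 0 = y⁻¹ * l 2 * y * (x⁻¹ * l 1 * x) ∧ ∀ T : Subgroup Q, x ∈ T → y ∈ T → (∀ j, l j ∈ T) →
    ∃ u d : ℂ → Q, (∀ γ : C(I, ℂ), (∀ t, γ t ∈ half 1) → u (γ 0) * φ γ = u (γ 1)) ∧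
      (∀ γ : C(I, ℂ), (∀ t, γ t ∈ half (-1)) → d (γ 0) * φ γ = d (γ 1)) ∧
      (∀ j, ∀ z ∈ collar j ∩ half 1, u z * (k z)⁻¹ ∈ T) ∧
      (∀ j, ∀ z ∈ collar j ∩ half (-1), d z * (k z)⁻¹ ∈ T) ∧
      ∀ z ∈ half 1 ∩ half (-1), u z * (d z)⁻¹ ∈ T := by
  obtain ⟨u0, hu0⟩ := exists_potential (simplyConnectedSpace_half (e := 1) (by norm_num))
    (hφ.mono (half_subset_inner (by norm_num)))
  obtain ⟨d0, hd0⟩ := exists_potential (simplyConnectedSpace_half (e := -1) (by norm_num))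
    (hφ.mono (half_subset_inner (by norm_num)))
  set a0 : ℂ := ((-15 / 16 : ℝ) : ℂ) with ha0
  set a1 : ℂ := ((-13 / 16 : ℝ) : ℂ) with ha1
  set b1 : ℂ := ((-3 / 16 : ℝ) : ℂ) with hb1
  set b2 : ℂ := ((3 / 16 : ℝ) : ℂ) with hb2
  set a2 : ℂ := ((13 / 16 : ℝ) : ℂ) with ha2
  set a3 : ℂ := ((15 / 16 : ℝ) : ℂ) with ha3
  -- Both potentials are normalized to k at the point a0 of the left gap. They are then compared
  -- with k along the collars and with each other along the gaps; every ratio is constant on a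
  -- connected piece.
  let u z := k a0 * (u0 a0)⁻¹ * u0 z
  let d z := k a0 * (d0 a0)⁻¹ * d0 z
  have hu : ∀ γ : C(I, ℂ), (∀ t, γ t ∈ half 1) → u (γ 0) * φ γ = u (γ 1) := fun γ hγ => by
    simp only [u]; rw [mul_assoc, hu0 γ hγ]
  have hd : ∀ γ : C(I, ℂ), (∀ t, γ t ∈ half (-1)) → d (γ 0) * φ γ = d (γ 1) := fun γ hγ => by
    simp only [d]; rw [mul_assoc, hd0 γ hγ]
  have hua : u a0 = k a0 := by simp [u]
  have hda : d a0 = k a0 := by simp [d]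
  let L : Set ℂ := rect (-1) (-(3 / 4)) (1 / 3)
  let M : Set ℂ := rect (-(1 / 4)) (1 / 4) (1 / 2)
  let R : Set ℂ := rect (3 / 4) 1 (1 / 3)
  have hL : L ⊆ half 1 ∩ half (-1) := rect_subset (by norm_num)
  have hM : M ⊆ half 1 ∩ half (-1) := rect_subset (by norm_num)
  have hR : R ⊆ half 1 ∩ half (-1) := rect_subset (by norm_num)
  have L0 : a0 ∈ L := ofReal_mem_rect (by norm_num) (by norm_num) (by norm_num) (by norm_num)
  have L1 : a1 ∈ L := ofReal_mem_rect (by norm_num) (by norm_num) (by norm_num) (by norm_num)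
  have M1 : b1 ∈ M := ofReal_mem_rect (by norm_num) (by norm_num) (by norm_num) (by norm_num)
  have M2 : b2 ∈ M := ofReal_mem_rect (by norm_num) (by norm_num) (by norm_num) (by norm_num)
  have R2 : a2 ∈ R := ofReal_mem_rect (by norm_num) (by norm_num) (by norm_num) (by norm_num)
  have R3 : a3 ∈ R := ofReal_mem_rect (by norm_num) (by norm_num) (by norm_num) (by norm_num)
  have c0 : a0 ∈ collar 0 := by
    simp only [collar, mem_ofPred_eq, ha0, Complex.ofReal_re, Complex.ofReal_im]; norm_num
  have c1 : a1 ∈ collar 1 := by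
    simp only [collar, mem_ofPred_eq, ha1, Complex.ofReal_re, Complex.ofReal_im]; norm_num
  have c1' : b1 ∈ collar 1 := by
    simp only [collar, mem_ofPred_eq, hb1, Complex.ofReal_re, Complex.ofReal_im]; norm_num
  have c2' : b2 ∈ collar 2 := by
    simp only [collar, mem_ofPred_eq, hb2, Complex.ofReal_re, Complex.ofReal_im]; norm_num
  have c2 : a2 ∈ collar 2 := by
    simp only [collar, mem_ofPred_eq, ha2, Complex.ofReal_re, Complex.ofReal_im]; norm_num
  have c3 : a3 ∈ collar 0 := by
    simp only [collar, mem_ofPred_eq, ha3, Complex.ofReal_re, Complex.ofReal_im]; norm_num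
  have s0 : shade l 0 a0 = 1 := if_neg (by simp only [cen, ha0, Complex.ofReal_re]; norm_num)
  have s1 : shade l 1 a1 = 1 := if_neg (by simp only [cen, ha1, Complex.ofReal_re]; norm_num)
  have s1' : shade l 1 b1 = (l 1)⁻¹ := if_pos (by simp only [cen, hb1, Complex.ofReal_re]; norm_num)
  have s2' : shade l 2 b2 = 1 := if_neg (by simp only [cen, hb2, Complex.ofReal_re]; norm_num)
  have s2 : shade l 2 a2 = (l 2)⁻¹ := if_pos (by simp only [cen, ha2, Complex.ofReal_re]; norm_num)
  have s3 : shade l 0 a3 = (l 0)⁻¹ := if_pos (by simp only [cen, ha3, Complex.ofReal_re]; norm_num)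
  have hline0 : ∀ a b, line a b 0 = (a : ℂ) := fun a b => by simp [line]
  have hline1 : ∀ a b, line a b 1 = (b : ℂ) := fun a b => by simp [line]
  have uL : u a1 * φ (line (-13 / 16) (-15 / 16)) = u a0 := by
    have := hu (line (-13 / 16) (-15 / 16)) fun t => (hL (line_mem_rect L1 L0 t)).1
    rwa [hline0, hline1] at this
  have dL : d a1 * φ (line (-13 / 16) (-15 / 16)) = d a0 := by
    have := hd (line (-13 / 16) (-15 / 16)) fun t => (hL (line_mem_rect L1 L0 t)).2
    rwa [hline0, hline1] at this
  have uR : u a2 * φ (line (13 / 16) (15 / 16)) = u a3 := by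
    have := hu (line (13 / 16) (15 / 16)) fun t => (hR (line_mem_rect R2 R3 t)).1
    rwa [hline0, hline1] at this
  have dR : d a2 * φ (line (13 / 16) (15 / 16)) = d a3 := by
    have := hd (line (13 / 16) (15 / 16)) fun t => (hR (line_mem_rect R2 R3 t)).2
    rwa [hline0, hline1] at this
  have hU : ∀ j, ∀ z ∈ collar j ∩ half 1, ∀ w ∈ collar j ∩ half 1, u z * (k z)⁻¹ = u w * (k w)⁻¹ :=
    fun j z hz w hw => mul_inv_eq_of_joinedIn (fun γ hγ => hu γ fun t => (hγ t).2) (h1 j)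
      (joinedIn_collar_half (by norm_num) hz hw)
  have hD : ∀ j, ∀ z ∈ collar j ∩ half (-1), ∀ w ∈ collar j ∩ half (-1),
      d z * (shade l j z * k z)⁻¹ = d w * (shade l j w * k w)⁻¹ :=
    fun j z hz w hw => mul_inv_eq_of_joinedIn (w := fun z => shade l j z * k z)
      (fun γ hγ => hd γ fun t => (hγ t).2) (h2 j) (joinedIn_collar_half (by norm_num) hz hw)
  have hO : ∀ {a b c z w}, rect a b c ⊆ half 1 ∩ half (-1) → z ∈ rect a b c → w ∈ rect a b c →
      u z * (d z)⁻¹ = u w * (d w)⁻¹ := fun h hz hw =>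
    mul_inv_eq_of_joinedIn (fun γ hγ => hu γ fun t => (h (hγ t)).1)
      (fun γ hγ => hd γ fun t => (h (hγ t)).2) (joinedIn_rect hz hw)
  have U0 : ∀ z ∈ collar 0 ∩ half 1, u z * (k z)⁻¹ = 1 := fun z hz => by
    rw [hU 0 z hz a0 ⟨c0, (hL L0).1⟩, hua, mul_inv_cancel]
  have hx' : x⁻¹ = u a1 * (k a1)⁻¹ := by
    rw [← hx, seam, ← ha0, ← ha1, ← hua, ← uL]; group
  have U1 : ∀ z ∈ collar 1 ∩ half 1, u z * (k z)⁻¹ = x⁻¹ := fun z hz => by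
    rw [hU 1 z hz a1 ⟨c1, (hL L1).1⟩, hx']
  have u3 : u a3 = k a3 := mul_inv_eq_one.1 (U0 a3 ⟨c3, (hR R3).1⟩)
  have hy' : y⁻¹ = u a2 * (k a2)⁻¹ := by
    rw [← hy, seam, ← ha2, ← ha3, ← u3, ← uR]; group
  have U2 : ∀ z ∈ collar 2 ∩ half 1, u z * (k z)⁻¹ = y⁻¹ := fun z hz => by
    rw [hU 2 z hz a2 ⟨c2, (hR R2).1⟩, hy']
  have D0 : ∀ z ∈ collar 0 ∩ half (-1), d z * (shade l 0 z * k z)⁻¹ = 1 := fun z hz => by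
    rw [hD 0 z hz a0 ⟨c0, (hL L0).2⟩, hda, s0, one_mul, mul_inv_cancel]
  have d1 : d a1 = u a1 := by
    rw [← mul_right_cancel_iff (a := φ (line (-13 / 16) (-15 / 16))), dL, uL, hua, hda]
  have D1 : ∀ z ∈ collar 1 ∩ half (-1), d z * (shade l 1 z * k z)⁻¹ = x⁻¹ := fun z hz => by
    rw [hD 1 z hz a1 ⟨c1, (hL L1).2⟩, d1, s1, one_mul, hx']
  have d3 : d a3 = (l 0)⁻¹ * u a3 := by
    rw [mul_inv_eq_one.1 (D0 a3 ⟨c3, (hR R3).2⟩), s3, u3]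
  have d2 : d a2 = (l 0)⁻¹ * u a2 := by
    rw [← mul_right_cancel_iff (a := φ (line (13 / 16) (15 / 16))), dR, d3, ← uR]
    exact (mul_assoc _ _ _).symm
  have D2 : ∀ z ∈ collar 2 ∩ half (-1), d z * (shade l 2 z * k z)⁻¹ = (l 0)⁻¹ * y⁻¹ * l 2 :=
    fun z hz => by
      rw [hD 2 z hz a2 ⟨c2, (hR R2).2⟩, d2, s2, hy']; group
  have O0 : ∀ z ∈ L, u z * (d z)⁻¹ = 1 := fun z hz => by
    rw [hO hL hz L0, hua, hda, mul_inv_cancel]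
  have O2 : ∀ z ∈ R, u z * (d z)⁻¹ = l 0 := fun z hz => by
    rw [hO hR hz R3, d3]; group
  -- In the middle gap the ratio is computed twice, at b1 through the left hole and at b2 through
  -- the right one. Equality of the results is the relation of the pair of pants.
  have O1 : ∀ z ∈ M, u z * (d z)⁻¹ = x⁻¹ * l 1 * x := fun z hz => by
    have e1 := U1 b1 ⟨c1', (hM M1).1⟩
    have e2 := D1 b1 ⟨c1', (hM M1).2⟩
    rw [s1'] at e2
    rw [hO hM hz M1, mul_inv_eq_iff_eq_mul.1 e1, mul_inv_eq_iff_eq_mul.1 e2]; group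
  have O1' : u b2 * (d b2)⁻¹ = y⁻¹ * (l 2)⁻¹ * y * l 0 := by
    have e1 := U2 b2 ⟨c2', (hM M2).1⟩
    have e2 := D2 b2 ⟨c2', (hM M2).2⟩
    rw [s2'] at e2
    rw [mul_inv_eq_iff_eq_mul.1 e1, mul_inv_eq_iff_eq_mul.1 e2]; group
  have hrel : x⁻¹ * l 1 * x = y⁻¹ * (l 2)⁻¹ * y * l 0 := (O1 b2 M2).symm.trans O1'
  refine ⟨by rw [hrel]; group, fun T hxT hyT hlT => ⟨u, d, hu, hd, ?_, ?_, ?_⟩⟩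
  · intro j z hz
    fin_cases j
    · rw [show u z * (k z)⁻¹ = _ from U0 z hz]; exact T.one_mem
    · rw [show u z * (k z)⁻¹ = _ from U1 z hz]; exact T.inv_mem hxT
    · rw [show u z * (k z)⁻¹ = _ from U2 z hz]; exact T.inv_mem hyT
  · intro j z hz
    have hs : shade l j z ∈ T := by
      rw [shade]
      split_ifs
      · exact T.inv_mem (hlT j)
      · exact T.one_mem
    have key : ∀ g ∈ T, d z * (shade l j z * k z)⁻¹ = g → d z * (k z)⁻¹ ∈ T := by
      intro g hg h
      rw [mul_inv_eq_iff_eq_mul.1 h, show g * (shade l j z * k z) * (k z)⁻¹ = g * shade l j z by group]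
      exact T.mul_mem hg hs
    fin_cases j
    · exact key _ T.one_mem (D0 z hz)
    · exact key _ (T.inv_mem hxT) (D1 z hz)
    · exact key _ (T.mul_mem (T.mul_mem (T.inv_mem (hlT 0)) (T.inv_mem hyT)) (hlT 2)) (D2 z hz)
  · rintro z ⟨hz1, hz2⟩
    obtain ⟨h0, h⟩ := overlap_cases hz1 hz2
    rcases h with ⟨h, h'⟩ | ⟨h, h'⟩
    · rcases lt_abs.1 h with h | h
      · have : z ∈ R := ⟨h0, ⟨h, by nlinarith [sq_nonneg z.im]⟩, abs_lt.1 h'⟩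
        rw [O2 z this]
        exact hlT 0
      · have : z ∈ L := ⟨h0, ⟨by nlinarith [sq_nonneg z.im], by linarith⟩, abs_lt.1 h'⟩
        rw [O0 z this]
        exact T.one_mem
    · have : z ∈ M := ⟨h0, abs_lt.1 h, abs_lt.1 h'⟩
      rw [O1 z this]
      exact T.mul_mem (T.mul_mem (T.inv_mem hxT) (hlT 1)) hxT

/-- A function on the boundary circles of the pair of pants. -/
def triple (a b c : Q) : Fin 3 → Q
  | 0 => a
  | 1 => b
  | 2 => c

/-- The potential of the lower half for prescribed values on the boundary circles and the seams. -/
def lower (l : Fin 3 → Q) (x : Q) (z : ℂ) : Q :=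
  open Classical in
  if z ∈ collar 0 then shade l 0 z else
    if z.re ≤ -(1 / 2) then 1 else if z.re ≤ 1 / 2 then x⁻¹ * (l 1)⁻¹ * x else (l 0)⁻¹

/-- The relation is needed at the right hole alone, where the values for the middle and the right
gap must differ by the prescribed jump. -/
theorem lower_collar {l : Fin 3 → Q} {x y : Q} (h : l 0 = y⁻¹ * l 2 * y * (x⁻¹ * l 1 * x)) (j : Fin 3) :
    ∃ g : Q, ∀ z ∈ collar j, lower l x z = g * shade l j z * triple 1 x y j := by
  match j with
  | 0 => exact ⟨1, fun z hz => by rw [lower, if_pos hz]; simp [triple]⟩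
  | 1 =>
    refine ⟨x⁻¹, fun z hz => ?_⟩
    have h0 : z ∉ collar 0 := fun h0 => absurd (collar_eq h0 hz) (by decide)
    have h1 : z.re ≤ 1 / 2 := by
      have : (z.re + 1 / 2) ^ 2 + z.im ^ 2 < 9 / 64 := hz
      nlinarith [sq_nonneg z.im]
    rw [lower, if_neg h0, if_pos h1, shade, show cen 1 = -(1 / 2) from rfl, triple]
    by_cases h2 : z.re ≤ -(1 / 2)
    · rw [if_pos h2, if_neg h2.not_gt]; simp
    · rw [if_neg h2, if_pos (not_le.1 h2)]
  | 2 =>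
    refine ⟨x⁻¹ * (l 1)⁻¹ * x * y⁻¹, fun z hz => ?_⟩
    have h0 : z ∉ collar 0 := fun h0 => absurd (collar_eq h0 hz) (by decide)
    have h1 : ¬ z.re ≤ -(1 / 2) := by
      have : (z.re - 1 / 2) ^ 2 + z.im ^ 2 < 9 / 64 := hz
      nlinarith [sq_nonneg z.im]
    rw [lower, if_neg h0, if_neg h1, shade, show cen 2 = 1 / 2 from rfl, triple]
    by_cases h2 : z.re ≤ 1 / 2
    · rw [if_pos h2, if_neg h2.not_gt]; simp
    · rw [if_neg h2, if_pos (not_le.1 h2), h]; group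

theorem lower_overlap {z : ℂ} (h1 : z ∈ half 1) (h2 : z ∈ half (-1)) (l : Fin 3 → Q) (x : Q) :
    lower l x z = if z.re ≤ -(1 / 2) then 1 else if z.re ≤ 1 / 2 then x⁻¹ * (l 1)⁻¹ * x else (l 0)⁻¹ := by
  rw [lower]
  split_ifs with h0 h3 h4 h4 <;> try rfl
  · refine if_neg ?_
    simp only [cen]; linarith
  · exfalso
    have h0 : 49 / 64 < z.re ^ 2 + z.im ^ 2 := h0
    obtain ⟨-, h | h⟩ := overlap_cases h1 h2
    · rcases lt_abs.1 h.1 with h | h <;> linarith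
    · rw [abs_lt, abs_lt] at h
      nlinarith [h.1, h.2]
  · refine if_pos ?_
    simp only [cen]; linarith

/-- Inside the gaps the real part never equals ±1 / 2, the only places where the value can change.
-/
theorem lower_path {γ : C(I, ℂ)} (h1 : ∀ t, γ t ∈ half 1) (h2 : ∀ t, γ t ∈ half (-1))
    (l : Fin 3 → Q) (x : Q) : lower l x (γ 0) = lower l x (γ 1) := by
  have hc : Continuous fun t => (γ t).re := by fun_prop
  have key : ∀ a : ℝ, |a| = 1 / 2 → ((γ 0).re ≤ a ↔ (γ 1).re ≤ a) := by
    intro a ha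
    have hne : ∀ t, (γ t).re ≠ a := by
      intro t h
      obtain ⟨-, h' | h'⟩ := overlap_cases (h1 t) (h2 t) <;> rw [h, ha] at h' <;> linarith [h'.1]
    constructor
    · intro hp
      by_contra hn
      obtain ⟨t, ht⟩ := mem_range_of_exists_le_of_exists_ge hc ⟨0, hp⟩ ⟨1, (not_le.1 hn).le⟩
      exact hne t ht
    · intro hp
      by_contra hn
      obtain ⟨t, ht⟩ := mem_range_of_exists_le_of_exists_ge hc ⟨1, hp⟩ ⟨0, (not_le.1 hn).le⟩
      exact hne t ht
  rw [lower_overlap (h1 0) (h2 0), lower_overlap (h1 1) (h2 1)]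
  simp only [key (-(1 / 2)) (by rw [abs_neg]; norm_num), key (1 / 2) (by norm_num)]

end HawaiianPants

namespace HawaiianPants

/-! ### Maps on the Hawaiian Pants -/

/-- The quotient map onto the Hawaiian Pants. -/
def quo : earring ⊕ (Σ _ : ℕ+, pants) → HawaiianPants := Quot.mk Glue

theorem isQuotientMap_quo : IsQuotientMap quo := isQuotientMap_quot_mk

/-- The inclusion of the Hawaiian Earring. -/
def inE : C(earring, HawaiianPants) :=
  ⟨fun w => quo (.inl w), isQuotientMap_quo.continuous.comp continuous_inl⟩

/-- The characteristic map of the `n`-th pair of pants. -/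
def inP (n : ℕ+) : C(pants, HawaiianPants) :=
  ⟨fun z => quo (.inr ⟨n, z⟩), isQuotientMap_quo.continuous.comp
    (continuous_inr.comp continuous_sigmaMk)⟩

theorem exists_rep (x : HawaiianPants) : (∃ w, inE w = x) ∨ ∃ n z, inP n z = x := by
  obtain ⟨w | ⟨n, z⟩, rfl⟩ := isQuotientMap_quo.surjective x
  · exact .inl ⟨w, rfl⟩
  · exact .inr ⟨n, z, rfl⟩

/-- The boundary circles of the pair of pants. -/
def bdry : Fin 3 → I → pants
  | 0 => outer
  | 1 => left
  | 2 => right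

theorem inP_bdry (n : ℕ+) (j : Fin 3) (t : I) : inP n (bdry j t) = inE (ell (circ n j) t) := by
  match j with
  | 0 => exact Quot.sound (.outer n t)
  | 1 => exact Quot.sound (.left n t)
  | 2 => exact Quot.sound (.right n t)

/-- Functions on the Hawaiian Pants from compatible functions on its parts. -/
def liftFun {Z : Type*} (f : earring → Z) (g : ℕ+ → pants → Z)
    (h : ∀ n j t, g n (bdry j t) = f (ell (circ n j) t)) : HawaiianPants → Z :=
  Quot.lift (Sum.elim f fun y => g y.1 y.2) (by
    rintro _ _ (⟨n, t⟩ | ⟨n, t⟩ | ⟨n, t⟩)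
    · exact h n 0 t
    · exact h n 1 t
    · exact h n 2 t)

theorem continuousOn_of {Z : Type*} [TopologicalSpace Z] {s : Set HawaiianPants} (hs : IsOpen s)
    {g : HawaiianPants → Z} (h1 : Continuous fun w => g (inE w))
    (h2 : ∀ n, ContinuousOn (fun z : pants => g (inP n z)) {z | inP n z ∈ s}) : ContinuousOn g s := by
  rw [isQuotientMap_quo.continuousOn_isOpen_iff hs]
  rintro (w | ⟨n, z⟩) hx
  · refine ContinuousAt.continuousWithinAt ?_
    rw [← IsOpenEmbedding.inl.continuousAt_iff]
    exact h1.continuousAt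
  · refine ContinuousAt.continuousWithinAt ?_
    have : IsOpenEmbedding fun z : pants => (Sum.inr ⟨n, z⟩ : earring ⊕ (Σ _ : ℕ+, pants)) :=
      IsOpenEmbedding.inr.comp IsOpenEmbedding.sigmaMk
    rw [← this.continuousAt_iff (x := z)]
    exact (h2 n).continuousAt ((hs.preimage (inP n).continuous).mem_nhds hx)

theorem isOpen_of {s : Set HawaiianPants} (h1 : IsOpen {w | inE w ∈ s})
    (h2 : ∀ n, IsOpen {z | inP n z ∈ s}) : IsOpen s := by
  rw [← isQuotientMap_quo.isOpen_preimage, isOpen_sum_iff]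
  refine ⟨h1, ?_⟩
  rw [isOpen_sigma_iff]
  exact h2

theorem bdry_sub_cen (j : Fin 3) (t : I) : ∃ r : ℝ, 0 < r ∧ r = ‖(bdry j t : ℂ) - cen j‖ ∧
    (bdry j t : ℂ) - cen j = -(r * Complex.I * Complex.exp ((-(2 * Real.pi * t) : ℝ) * Complex.I)) ∧
    r = if j = 0 then 1 else 1 / 4 := by
  have key : ∀ (c : ℂ) (r : ℝ), clockwise c r t - c =
      -(r * Complex.I * Complex.exp ((-(2 * Real.pi * t) : ℝ) * Complex.I)) := fun c r => by
    rw [clockwise]; ring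
  match j with
  | 0 =>
    have h : ((cen 0 : ℝ) : ℂ) = 0 := Complex.ofReal_zero
    refine ⟨1, one_pos, ?_, ?_, rfl⟩
    · rw [h]; exact (norm_clockwise_sub _ zero_le_one t).symm
    · rw [h]; exact key _ _
  | 1 =>
    have h : ((cen 1 : ℝ) : ℂ) = -1 / 2 := by simp [cen]; ring
    refine ⟨1 / 4, by norm_num, ?_, ?_, rfl⟩
    · rw [h]; exact (norm_clockwise_sub _ (by norm_num) t).symm
    · rw [h]; exact key _ _
  | 2 =>
    have h : ((cen 2 : ℝ) : ℂ) = 1 / 2 := by simp [cen]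
    refine ⟨1 / 4, by norm_num, ?_, ?_, rfl⟩
    · rw [h]; exact (norm_clockwise_sub _ (by norm_num) t).symm
    · rw [h]; exact key _ _

theorem norm_sub_cen_sq (z : ℂ) (j : Fin 3) : ‖z - cen j‖ ^ 2 = (z.re - cen j) ^ 2 + z.im ^ 2 := by
  rw [← Complex.normSq_eq_norm_sq, Complex.normSq_apply]
  simp only [Complex.sub_re, Complex.sub_im, Complex.ofReal_re, Complex.ofReal_im]
  ring

/-- The distances of the points of a collar from the center of its circle. -/
def band : Fin 3 → Set ℝ
  | 0 => Ioc (7 / 8) 1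
  | 1 => Ico (1 / 4) (3 / 8)
  | 2 => Ico (1 / 4) (3 / 8)

theorem convex_band (j : Fin 3) : Convex ℝ (band j) := by
  match j with
  | 0 => exact convex_Ioc _ _
  | 1 => exact convex_Ico _ _
  | 2 => exact convex_Ico _ _

theorem pos_of_mem_band {j : Fin 3} {r : ℝ} (h : r ∈ band j) : 0 < r := by
  match j with
  | 0 => exact lt_trans (by norm_num) h.1
  | 1 => exact lt_of_lt_of_le (by norm_num) h.1
  | 2 => exact lt_of_lt_of_le (by norm_num) h.1

theorem mem_pants_iff {z : ℂ} : z ∈ pants ↔ z.re ^ 2 + z.im ^ 2 ≤ 1 ∧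
    1 / 16 ≤ (z.re + 1 / 2) ^ 2 + z.im ^ 2 ∧ 1 / 16 ≤ (z.re - 1 / 2) ^ 2 + z.im ^ 2 := by
  have h0 := norm_sub_cen_sq z 0
  have h1 := norm_sub_cen_sq z 1
  have h2 := norm_sub_cen_sq z 2
  simp only [cen, Complex.ofReal_zero, _root_.sub_zero, sub_neg_eq_add, Complex.ofReal_neg,
    Complex.ofReal_div, Complex.ofReal_one, Complex.ofReal_ofNat] at h0 h1 h2
  rw [pants, mem_sdiff, mem_union, not_or, mem_closedBall_iff_norm, mem_ball_iff_norm,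
    mem_ball_iff_norm, _root_.sub_zero, neg_div, sub_neg_eq_add, not_lt, not_lt, ← h0, ← h1, ← h2]
  have n0 := norm_nonneg z
  have n1 := norm_nonneg (z + 1 / 2)
  have n2 := norm_nonneg (z - 1 / 2)
  refine and_congr ?_ (and_congr ?_ ?_)
  · constructor <;> intro h <;> nlinarith
  · constructor <;> intro h <;> nlinarith
  · constructor <;> intro h <;> nlinarith

theorem inner_subset_pants : inner ⊆ pants := fun _ h =>
  mem_pants_iff.2 ⟨h.1.le, h.2.1.le, h.2.2.le⟩

theorem mem_band_iff {z : ℂ} {j : Fin 3} : ‖z - cen j‖ ∈ band j ↔ z ∈ pants ∧ z ∈ collar j := by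
  have h := norm_sub_cen_sq z j
  have h0 := norm_nonneg (z - cen j)
  rw [mem_pants_iff]
  match j with
  | 0 =>
    simp only [cen, _root_.sub_zero] at h
    simp only [cen] at h0 ⊢
    simp only [band, collar, mem_ofPred_eq, mem_Ioc]
    rw [← h]
    constructor
    · rintro ⟨h1, h2⟩
      refine ⟨⟨by nlinarith, ?_, ?_⟩, by nlinarith⟩
      · rcases le_total z.re (-(7 / 8)) with h' | h' <;> nlinarith [sq_nonneg z.im]
      · rcases le_total z.re (7 / 8) with h' | h' <;> nlinarith [sq_nonneg z.im]
    · rintro ⟨⟨h1, -⟩, h2⟩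
      constructor <;> nlinarith
  | 1 =>
    simp only [cen, sub_neg_eq_add] at h
    simp only [cen] at h0 ⊢
    simp only [band, collar, mem_ofPred_eq, mem_Ico]
    rw [← h]
    constructor
    · rintro ⟨h1, h2⟩
      have h3 : (z.re + 1 / 2) ^ 2 + z.im ^ 2 < 9 / 64 := by rw [← h]; nlinarith
      have hr : z.re < -(1 / 8) := by nlinarith [sq_nonneg z.im]
      have hr' : -(7 / 8) < z.re := by nlinarith [sq_nonneg z.im]
      exact ⟨⟨by nlinarith, by nlinarith, by nlinarith⟩, by nlinarith⟩
    · rintro ⟨⟨-, h1, -⟩, h2⟩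
      constructor <;> nlinarith
  | 2 =>
    simp only [cen] at h
    simp only [cen] at h0 ⊢
    simp only [band, collar, mem_ofPred_eq, mem_Ico]
    rw [← h]
    constructor
    · rintro ⟨h1, h2⟩
      have h3 : (z.re - 1 / 2) ^ 2 + z.im ^ 2 < 9 / 64 := by rw [← h]; nlinarith
      have hr : 1 / 8 < z.re := by nlinarith [sq_nonneg z.im]
      have hr' : z.re < 7 / 8 := by nlinarith [sq_nonneg z.im]
      exact ⟨⟨by nlinarith, by nlinarith, by nlinarith⟩, by nlinarith⟩
    · rintro ⟨⟨-, -, h1⟩, h2⟩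
      constructor <;> nlinarith

theorem bdry_mem_collar (j : Fin 3) (t : I) : (bdry j t : ℂ) ∈ collar j := by
  obtain ⟨r, -, h, -, hr⟩ := bdry_sub_cen j t
  refine (mem_band_iff.1 ?_).2
  rw [← h, hr]
  match j with
  | 0 => norm_num [band]
  | 1 => rw [if_neg (by decide)]; norm_num [band]
  | 2 => rw [if_neg (by decide)]; norm_num [band]

theorem bdry_notMem_inner (j : Fin 3) (t : I) : (bdry j t : ℂ) ∉ inner := by
  obtain ⟨r, -, h, -, hr⟩ := bdry_sub_cen j t
  have h2 := norm_sub_cen_sq (bdry j t) j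
  rw [← h, hr] at h2
  rintro ⟨h3, h4, h5⟩
  match j with
  | 0 =>
    simp only [cen, if_true, _root_.sub_zero] at h2
    linarith
  | 1 =>
    simp only [cen, if_neg (show ¬ (1 : Fin 3) = 0 by decide), sub_neg_eq_add] at h2
    linarith
  | 2 =>
    simp only [cen, if_neg (show ¬ (2 : Fin 3) = 0 by decide)] at h2
    linarith

theorem exists_collar {z : ℂ} (hz : z ∈ pants) (h : z ∉ inner) : ∃ j, z ∈ collar j := by
  obtain ⟨h1, h2, h3⟩ := mem_pants_iff.1 hz
  by_contra! hn
  have n0 : ¬ 49 / 64 < z.re ^ 2 + z.im ^ 2 := hn 0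
  have n1 : ¬ (z.re + 1 / 2) ^ 2 + z.im ^ 2 < 9 / 64 := hn 1
  have n2 : ¬ (z.re - 1 / 2) ^ 2 + z.im ^ 2 < 9 / 64 := hn 2
  exact h ⟨by linarith, by linarith, by linarith⟩

open Classical in
/-- The collar to which a point belongs. -/
def col (z : ℂ) : Fin 3 := if z ∈ collar 0 then 0 else if z ∈ collar 1 then 1 else 2

theorem col_eq {z : ℂ} {j : Fin 3} (h : z ∈ collar j) : col z = j := by
  rw [col]
  split_ifs with h0 h1
  · exact collar_eq h0 h
  · exact collar_eq h1 h
  · match j with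
    | 0 => exact absurd h h0
    | 1 => exact absurd h h1
    | 2 => rfl

open Classical in
/-- The plane coordinate of the points of the interiors of the pairs of pants. -/
def tau : HawaiianPants → ℂ := liftFun (fun _ => 5) (fun _ z => if (z : ℂ) ∈ inner then z else 5)
  fun _ j t => if_neg (bdry_notMem_inner j t)

open Classical in
/-- The number of the pair of pants of the points of the interiors of the pairs of pants. -/
def nu : HawaiianPants → ℕ+ := liftFun (fun _ => 1) (fun n z => if (z : ℂ) ∈ inner then n else 1)
  fun _ j t => if_neg (bdry_notMem_inner j t)

theorem ring_bdry (n : ℕ+) (j : Fin 3) (t : I) :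
    ring n (bdry j t - cen j) = ell n t := by
  obtain ⟨r, hr, h, h', -⟩ := bdry_sub_cen j t
  have hn : (n : ℝ) ≠ 0 := by exact_mod_cast n.ne_zero
  refine Subtype.ext (Complex.ext ?_ ?_)
  · rw [ring_re, ← h, h']
    simp only [Complex.neg_im, Complex.mul_im, Complex.mul_re, Complex.ofReal_re, Complex.ofReal_im,
      Complex.I_re, Complex.I_im, Complex.exp_ofReal_mul_I_re, Complex.exp_ofReal_mul_I_im,
      Real.cos_neg, Real.sin_neg]
    simp only [ell]
    field_simp
    ring
  · rw [ring_im, ← h, h']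
    simp only [Complex.neg_re, Complex.mul_im, Complex.mul_re, Complex.ofReal_re, Complex.ofReal_im,
      Complex.I_re, Complex.I_im, Complex.exp_ofReal_mul_I_re, Complex.exp_ofReal_mul_I_im,
      Real.cos_neg, Real.sin_neg]
    simp only [ell]
    field_simp
    ring

/-- The retraction of a neighborhood of the Hawaiian Earring. -/
def retract : HawaiianPants → earring :=
  liftFun id (fun n z => ring (circ n (col z)) (z - cen (col z))) fun n j t => by
    rw [col_eq (bdry_mem_collar j t)]
    exact ring_bdry _ j t

theorem tau_inE (w : earring) : tau (inE w) = 5 := rfl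

theorem five_notMem_inner : (5 : ℂ) ∉ inner := by
  rintro ⟨h, -⟩
  norm_num at h

/-- The dummy coordinate 5 is outside the interior but in the outer collar, so `near` contains the
earring without a separate clause. -/
theorem five_mem_collar : (5 : ℂ) ∈ collar 0 := by
  simp only [collar, mem_ofPred_eq]
  norm_num

theorem tau_inP {n : ℕ+} {z : pants} (h : (z : ℂ) ∈ inner) : tau (inP n z) = z := if_pos h

theorem tau_inP_of_notMem {n : ℕ+} {z : pants} (h : (z : ℂ) ∉ inner) : tau (inP n z) = 5 := if_neg h

theorem nu_inP {n : ℕ+} {z : pants} (h : (z : ℂ) ∈ inner) : nu (inP n z) = n := if_pos h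

theorem tau_inP_mem {n : ℕ+} {z : pants} {S : Set ℂ} (hS : S ⊆ inner) :
    tau (inP n z) ∈ S ↔ (z : ℂ) ∈ S := by
  by_cases h : (z : ℂ) ∈ inner
  · rw [tau_inP h]
  · rw [tau_inP_of_notMem h]
    exact ⟨fun h' => absurd (hS h') five_notMem_inner, fun h' => absurd (hS h') h⟩

theorem exists_inP {x : HawaiianPants} (h : tau x ∈ inner) :
    ∃ z : pants, (z : ℂ) = tau x ∧ inP (nu x) z = x := by
  obtain ⟨w, rfl⟩ | ⟨n, z, rfl⟩ := exists_rep x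
  · exact absurd h five_notMem_inner
  · have hz : (z : ℂ) ∈ inner := (tau_inP_mem subset_rfl).1 h
    exact ⟨z, (tau_inP hz).symm, by rw [nu_inP hz]⟩

theorem isOpen_tau {S : Set ℂ} (hS : IsOpen S) (h : S ⊆ inner) : IsOpen {x | tau x ∈ S} := by
  refine isOpen_of ?_ fun n => ?_
  · have : {w | inE w ∈ {x | tau x ∈ S}} = ∅ := by
      ext w
      simp only [mem_ofPred_eq, tau_inE, mem_empty_iff_false, iff_false]
      exact fun h' => five_notMem_inner (h h')
    rw [this]
    exact isOpen_empty
  · have : {z | inP n z ∈ {x | tau x ∈ S}} = Subtype.val ⁻¹' S := by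
      ext z
      exact tau_inP_mem h
    rw [this]
    exact hS.preimage continuous_subtype_val

theorem continuousOn_tau : ContinuousOn tau {x | tau x ∈ inner} := by
  refine continuousOn_of (isOpen_tau isOpen_inner subset_rfl) continuous_const fun n => ?_
  refine continuous_subtype_val.continuousOn.congr fun z hz => ?_
  exact tau_inP ((tau_inP_mem subset_rfl).1 hz)

theorem nu_path {γ : C(I, HawaiianPants)} (h : ∀ t, tau (γ t) ∈ inner) (t : I) :
    nu (γ t) = nu (γ 0) := by
  have h1 : ContinuousOn (fun x => (nu x : ℕ)) {x | tau x ∈ inner} := by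
    refine continuousOn_of (isOpen_tau isOpen_inner subset_rfl) continuous_const fun n => ?_
    refine (continuousOn_const (c := (n : ℕ))).congr fun z hz => ?_
    exact congrArg _ (nu_inP ((tau_inP_mem subset_rfl).1 hz))
  exact PNat.eq (PreconnectedSpace.constant inferInstance (h1.comp_continuous γ.continuous h))

/-- The neighborhood of the Hawaiian Earring formed by the collars. -/
def near : Set HawaiianPants := {x | ∃ j, tau x ∈ collar j}

theorem inE_mem_near (w : earring) : inE w ∈ near := ⟨0, five_mem_collar⟩

theorem inP_mem_near {n : ℕ+} {z : pants} : inP n z ∈ near ↔ ∃ j, (z : ℂ) ∈ collar j := by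
  by_cases h : (z : ℂ) ∈ inner
  · rw [near, mem_ofPred_eq, tau_inP h]
  · rw [near, mem_ofPred_eq, tau_inP_of_notMem h]
    exact iff_of_true ⟨0, five_mem_collar⟩ (exists_collar z.2 h)

theorem isOpen_near : IsOpen near := by
  refine isOpen_of ?_ fun n => ?_
  · simp only [inE_mem_near]
    exact isOpen_univ
  · simp only [inP_mem_near, ofPred_exists]
    exact isOpen_iUnion fun j => (isOpen_collar j).preimage continuous_subtype_val

theorem retract_inE (w : earring) : retract (inE w) = w := rfl

theorem retract_inP {n : ℕ+} {z : pants} {j : Fin 3} (h : (z : ℂ) ∈ collar j) :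
    retract (inP n z) = ring (circ n j) (z - cen j) := by
  rw [← col_eq h]; rfl

theorem retract_eq {x : HawaiianPants} {j : Fin 3} (h : tau x ∈ inner) (hj : tau x ∈ collar j) :
    retract x = ring (circ (nu x) j) (tau x - cen j) := by
  obtain ⟨z, hz, hx⟩ := exists_inP h
  rw [← hz] at hj ⊢
  conv_lhs => rw [← hx]
  exact retract_inP hj

theorem inE_injective : Function.Injective inE := fun w v h => by
  rw [← retract_inE w, h, retract_inE]

theorem continuousOn_retract : ContinuousOn retract near := by
  refine continuousOn_of isOpen_near continuous_id fun n z hz => ?_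
  obtain ⟨j, hj⟩ := inP_mem_near.1 hz
  refine ContinuousAt.continuousWithinAt ?_
  have h0 : (z : ℂ) - cen j ≠ 0 := norm_pos_iff.1 (pos_of_mem_band (mem_band_iff.2 ⟨z.2, hj⟩))
  have h1 : ContinuousAt (fun z : pants => ring (circ n j) (z - cen j)) z :=
    (continuousAt_ring _ h0).comp (f := fun z : pants => (z : ℂ) - cen j) (by fun_prop)
  refine h1.congr ?_
  filter_upwards [((isOpen_collar j).preimage continuous_subtype_val).mem_nhds hj] with y hy
  exact (retract_inP hy).symm

/-- The characteristic map of the `n`-th pair of pants, as a function on the plane. -/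
def plane (n : ℕ+) (z : ℂ) : HawaiianPants :=
  open Classical in if h : z ∈ pants then inP n ⟨z, h⟩ else inE base

theorem plane_eq (n : ℕ+) (z : pants) : plane n z = inP n z := dif_pos z.2

theorem continuousOn_plane (n : ℕ+) : ContinuousOn (plane n) pants := by
  rw [continuousOn_iff_continuous_domRestrict]
  exact (inP n).continuous.congr fun z => (plane_eq n z).symm

theorem plane_nu_tau {x : HawaiianPants} (h : tau x ∈ inner) : plane (nu x) (tau x) = x := by
  obtain ⟨z, hz, hx⟩ := exists_inP h
  rw [← hz, plane_eq, hx]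

theorem tau_plane {n : ℕ+} {z : ℂ} (h : z ∈ inner) : tau (plane n z) = z := by
  rw [show plane n z = inP n ⟨z, inner_subset_pants h⟩ from dif_pos _, tau_inP h]

theorem nu_plane {n : ℕ+} {z : ℂ} (h : z ∈ inner) : nu (plane n z) = n := by
  rw [show plane n z = inP n ⟨z, inner_subset_pants h⟩ from dif_pos _, nu_inP h]

/-! ### The collars as mapping cylinders -/

theorem exists_angle {v : ℂ} (hv : ‖v‖ = 1) :
    ∃ t : I, Complex.exp ((-(2 * Real.pi * t) : ℝ) * Complex.I) = v := by
  have hp := Real.pi_pos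
  have h1 := Complex.neg_pi_lt_arg (-v)
  have h2 := Complex.arg_le_pi (-v)
  refine ⟨⟨(Real.pi - (-v).arg) / (2 * Real.pi), ?_, ?_⟩, ?_⟩
  · exact div_nonneg (by linarith) (by linarith)
  · rw [div_le_one (by linarith)]; linarith
  · have : -(2 * Real.pi * ((Real.pi - (-v).arg) / (2 * Real.pi))) = (-v).arg - Real.pi := by
      field_simp; ring
    rw [this]
    have h3 := Complex.norm_mul_exp_arg_mul_I (-v)
    rw [norm_neg, hv] at h3
    push_cast
    rw [sub_mul, Complex.exp_sub, Complex.exp_pi_mul_I]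
    push_cast at h3
    rw [one_mul] at h3
    rw [h3]
    ring

/-- The radius of a boundary circle. -/
def rad : Fin 3 → ℝ
  | 0 => 1
  | 1 => 1 / 4
  | 2 => 1 / 4

theorem rad_mem_band (j : Fin 3) : rad j ∈ band j := by
  match j with
  | 0 => norm_num [rad, band]
  | 1 => norm_num [rad, band]
  | 2 => norm_num [rad, band]

theorem exists_bdry {j : Fin 3} {z : ℂ} (h : ‖z - cen j‖ = rad j) : ∃ t, (bdry j t : ℂ) = z := by
  have hr : (rad j : ℂ) ≠ 0 := by exact_mod_cast (pos_of_mem_band (rad_mem_band j)).ne'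
  obtain ⟨t, ht⟩ := exists_angle (v := Complex.I * ((z - cen j) / rad j)) (by
    rw [norm_mul, Complex.norm_I, norm_div, h, Complex.norm_real, one_mul, Real.norm_of_nonneg
      (pos_of_mem_band (rad_mem_band j)).le]
    exact div_self (pos_of_mem_band (rad_mem_band j)).ne')
  obtain ⟨r, -, -, h', hr'⟩ := bdry_sub_cen j t
  have : r = rad j := by
    rw [hr']
    match j with
    | 0 => rfl
    | 1 => rfl
    | 2 => rfl
  refine ⟨t, ?_⟩
  rw [ht, this] at h'
  rw [← sub_left_inj (a := ((cen j : ℝ) : ℂ)), h']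
  field_simp
  rw [Complex.I_sq]
  ring

/-- The points of the segment from a boundary circle to a point of its collar. -/
def spoke (j : Fin 3) (z : ℂ) (s : ℝ) : ℂ :=
  cen j + ((((1 - s) * rad j + s * ‖z - cen j‖) / ‖z - cen j‖ : ℝ) : ℂ) * (z - cen j)

theorem norm_spoke {j : Fin 3} {z : ℂ} (h : ‖z - cen j‖ ∈ band j) {s : ℝ} (hs : s ∈ I) :
    ‖spoke j z s - cen j‖ = (1 - s) * rad j + s * ‖z - cen j‖ := by
  have h0 := pos_of_mem_band h
  have h1 := pos_of_mem_band (rad_mem_band j)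
  rw [spoke, add_sub_cancel_left, norm_mul, Complex.norm_real, Real.norm_of_nonneg,
    div_mul_cancel₀ _ h0.ne']
  exact div_nonneg (add_nonneg (mul_nonneg (sub_nonneg.2 hs.2) h1.le) (mul_nonneg hs.1 h0.le)) h0.le

theorem spoke_mem {j : Fin 3} {z : ℂ} (h : ‖z - cen j‖ ∈ band j) {s : ℝ} (hs : s ∈ I) :
    ‖spoke j z s - cen j‖ ∈ band j := by
  rw [norm_spoke h hs]
  exact convex_band j (rad_mem_band j) h (sub_nonneg.2 hs.2) hs.1 (sub_add_cancel _ _)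

theorem spoke_one {j : Fin 3} {z : ℂ} (h : ‖z - cen j‖ ∈ band j) : spoke j z 1 = z := by
  rw [spoke, _root_.sub_self, zero_mul, zero_add, one_mul, div_self (pos_of_mem_band h).ne']
  simp

theorem ring_spoke (m : ℕ+) {j : Fin 3} {z : ℂ} (h : ‖z - cen j‖ ∈ band j) {s : ℝ} (hs : s ∈ I) :
    ring m (spoke j z s - cen j) = ring m (z - cen j) := by
  have h0 := pos_of_mem_band h
  have h2 := pos_of_mem_band (spoke_mem h hs)
  have hm : (m : ℝ) ≠ 0 := by exact_mod_cast m.ne_zero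
  have h3 := norm_spoke h hs
  refine Subtype.ext (Complex.ext ?_ ?_)
  · rw [ring_re, ring_re, div_eq_div_iff (mul_ne_zero hm h2.ne') (mul_ne_zero hm h0.ne'), h3, spoke,
      add_sub_cancel_left]
    simp only [Complex.mul_im, Complex.ofReal_re, Complex.ofReal_im, zero_mul, add_zero]
    field_simp
  · rw [ring_im, ring_im, div_eq_div_iff (mul_ne_zero hm h2.ne') (mul_ne_zero hm h0.ne'), h3, spoke,
      add_sub_cancel_left]
    simp only [Complex.mul_re, Complex.ofReal_re, Complex.ofReal_im, zero_mul, _root_.sub_zero]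
    field_simp

theorem continuousOn_spoke (j : Fin 3) :
    Continuous fun y : {z : pants | (z : ℂ) ∈ collar j} × I => spoke j y.1 y.2 := by
  have : ∀ y : {z : pants | (z : ℂ) ∈ collar j} × I, ‖((y.1 : pants) : ℂ) - cen j‖ ≠ 0 := fun y =>
    (pos_of_mem_band (mem_band_iff.2 ⟨y.1.1.2, y.1.2⟩)).ne'
  unfold spoke
  refine continuous_const.add (Continuous.mul ?_ (by fun_prop))
  exact Complex.continuous_ofReal.comp (Continuous.div (by fun_prop) (by fun_prop) this)

/-- The segments from the boundary circle in a pair of pants. -/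
def spokeMap (n : ℕ+) (j : Fin 3) : C({z : pants | (z : ℂ) ∈ collar j} × I, HawaiianPants) :=
  ⟨fun y => plane n (spoke j y.1 y.2), (continuousOn_plane n).comp_continuous (continuousOn_spoke j)
    fun y => (mem_band_iff.1 (spoke_mem (mem_band_iff.2 ⟨y.1.1.2, y.1.2⟩) y.2.2)).1⟩

theorem plane_spoke_zero (n : ℕ+) {j : Fin 3} {z : ℂ} (h : ‖z - cen j‖ ∈ band j) :
    plane n (spoke j z 0) = inE (ring (circ n j) (z - cen j)) := by
  obtain ⟨t, ht⟩ := exists_bdry (j := j) (z := spoke j z 0) (by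
    rw [norm_spoke h ⟨le_rfl, zero_le_one⟩]; ring)
  rw [← ring_spoke _ h ⟨le_rfl, zero_le_one⟩, ← ht, plane_eq, inP_bdry, ring_bdry]

open Classical in
/-- The path from the image of a point under the retraction to the point. -/
def spokePath (n : ℕ+) (z : pants) : C(I, HawaiianPants) :=
  if h : (z : ℂ) ∈ collar (col z) then (spokeMap n (col z)).curry ⟨z, h⟩ else .const I (inP n z)

theorem spokePath_eq (n : ℕ+) {z : pants} {j : Fin 3} (h : (z : ℂ) ∈ collar j) :
    spokePath n z = (spokeMap n j).curry ⟨z, h⟩ := by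
  obtain rfl := col_eq h
  exact dif_pos h

/-- The path from the image of a point under the retraction to the point. -/
def beam : HawaiianPants → C(I, HawaiianPants) :=
  liftFun (fun w => .const I (inE w)) spokePath fun n j t => by
    rw [spokePath_eq n (bdry_mem_collar j t)]
    have hb : ‖(bdry j t : ℂ) - cen j‖ = rad j := by
      obtain ⟨r, -, h, -, hr⟩ := bdry_sub_cen j t
      rw [← h, hr]
      match j with
      | 0 => rfl
      | 1 => rfl
      | 2 => rfl
    ext1 s
    have : spoke j (bdry j t) s = bdry j t := by
      rw [spoke, hb, ← add_mul, sub_add_cancel, one_mul,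
        div_self (pos_of_mem_band (rad_mem_band j)).ne']
      simp
    change plane n (spoke j (bdry j t) s) = inE (ell (circ n j) t)
    rw [this, plane_eq, inP_bdry]

theorem beam_inP {n : ℕ+} {z : pants} {j : Fin 3} (h : (z : ℂ) ∈ collar j) (s : I) :
    beam (inP n z) s = plane n (spoke j z s) := by
  change spokePath n z s = _
  rw [spokePath_eq n h]
  rfl

/-- Working in the space of paths lets continuity descend directly to the quotient, with no need to
multiply the quotient map by an interval. -/
theorem continuousOn_beam : ContinuousOn beam near := by
  refine continuousOn_of isOpen_near ?_ fun n z hz => ?_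
  · exact ContinuousMap.continuous_const'.comp inE.continuous
  · obtain ⟨j, hj⟩ := inP_mem_near.1 hz
    have ho : IsOpen {z : pants | (z : ℂ) ∈ collar j} :=
      (isOpen_collar j).preimage continuous_subtype_val
    refine ContinuousAt.continuousWithinAt ?_
    have : ContinuousOn (fun z : pants => beam (inP n z)) {z : pants | (z : ℂ) ∈ collar j} := by
      rw [continuousOn_iff_continuous_domRestrict]
      refine (spokeMap n j).curry.continuous.congr fun y => ?_
      exact (spokePath_eq n y.2).symm
    exact this.continuousAt (ho.mem_nhds hj)

theorem beam_zero {x : HawaiianPants} (hx : x ∈ near) : beam x 0 = inE (retract x) := by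
  obtain ⟨w, rfl⟩ | ⟨n, z, rfl⟩ := exists_rep x
  · rfl
  · obtain ⟨j, hj⟩ := inP_mem_near.1 hx
    rw [beam_inP hj, retract_inP hj]
    exact plane_spoke_zero n (mem_band_iff.2 ⟨z.2, hj⟩)

theorem beam_one {x : HawaiianPants} (hx : x ∈ near) : beam x 1 = x := by
  obtain ⟨w, rfl⟩ | ⟨n, z, rfl⟩ := exists_rep x
  · rfl
  · obtain ⟨j, hj⟩ := inP_mem_near.1 hx
    rw [beam_inP hj]
    exact (congrArg _ (spoke_one (mem_band_iff.2 ⟨z.2, hj⟩))).trans (plane_eq n z)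

theorem beam_mem_near {x : HawaiianPants} (hx : x ∈ near) (s : I) :
    beam x s ∈ near ∧ retract (beam x s) = retract x := by
  obtain ⟨w, rfl⟩ | ⟨n, z, rfl⟩ := exists_rep x
  · exact ⟨hx, rfl⟩
  · obtain ⟨j, hj⟩ := inP_mem_near.1 hx
    have hb := mem_band_iff.2 ⟨z.2, hj⟩
    obtain ⟨h1, h2⟩ := mem_band_iff.1 (spoke_mem hb s.2)
    have : beam (inP n z) s = inP n ⟨_, h1⟩ := (beam_inP hj s).trans (plane_eq n ⟨_, h1⟩)
    rw [this]
    refine ⟨inP_mem_near.2 ⟨j, h2⟩, ?_⟩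
    rw [retract_inP h2, retract_inP hj]
    exact ring_spoke _ hb s.2

variable {Q : Type*} [Group Q]

/-- A homomorphism on the paths near the Hawaiian Earring is determined by its values on the paths in
the Hawaiian Earring. -/
theorem map_beam {Φ : C(I, HawaiianPants) → Q} (hΦ : IsHomOn univ Φ) {γ : C(I, HawaiianPants)}
    (h : ∀ t, γ t ∈ near) :
    Φ (beam (γ 0)) * Φ γ = Φ (inE.comp (mapOn continuousOn_retract γ h)) * Φ (beam (γ 1)) := by
  have hc : Continuous fun t => beam (γ t) := continuousOn_beam.comp_continuous γ.continuous h
  -- The beams sweep out a square with γ on the right and its retraction to the earring on the left.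
  let F : C(I × I, HawaiianPants) := ⟨fun y => beam (γ y.2) y.1,
    (hc.comp continuous_snd).eval continuous_fst⟩
  have := hΦ.square F fun _ => mem_univ _
  have e1 : bot F = beam (γ 0) := rfl
  have e2 : top F = beam (γ 1) := rfl
  have e3 : rgt F = γ := by ext1 t; exact beam_one (h t)
  have e4 : lft F = inE.comp (mapOn continuousOn_retract γ h) := by ext1 t; exact beam_zero (h t)
  rwa [e1, e2, e3, e4] at this

end HawaiianPants

theorem PathHom.IsHomOn.toHom_frameClass {X Q : Type*} [TopologicalSpace X] [Group Q] {p : X}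
    {Φ : C(I, X) → Q} (hΦ : IsHomOn univ Φ) (c : ∀ x, Path p x) (γ : C(I, X)) :
    hΦ.toHom p (frameClass c γ) =
      Φ (c (γ 0)).toContinuousMap * Φ γ * (Φ (c (γ 1)).toContinuousMap)⁻¹ := by
  rw [frameClass, hΦ.toHom_mk, hΦ.map_trans, hΦ.map_trans, hΦ.map_symm]
  rfl

namespace HawaiianPants

/-! ### The fundamental group of the Hawaiian Pants -/

theorem ofReal_mem_left {x : ℝ} (h1 : -1 < x) (h2 : x < -(3 / 4)) :
    (x : ℂ) ∈ half 1 ∩ half (-1) :=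
  rect_subset (a := -1) (b := -(3 / 4)) (c := 1 / 3) (by norm_num)
    (ofReal_mem_rect h1 h2 (by norm_num) (by nlinarith))

theorem joined_of_mem_near {x : HawaiianPants} (hx : x ∈ near) : Joined (inE base) x :=
  .trans ⟨(frame (retract x)).map inE.continuous⟩ ⟨⟨beam x, beam_zero hx, beam_one hx⟩⟩

/-- An interior point is joined inside its half to -15 / 16, which lies in both halves and in the
outer collar. -/
theorem joined_base (x : HawaiianPants) : Joined (inE base) x := by
  by_cases hx : x ∈ near
  · exact joined_of_mem_near hx
  · obtain ⟨w, rfl⟩ | ⟨n, z, rfl⟩ := exists_rep x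
    · exact absurd (inE_mem_near w) hx
    · have hz : (z : ℂ) ∈ inner := by
        by_contra h
        exact hx (inP_mem_near.2 (exists_collar z.2 h))
      have key : ∀ e : ℝ, e ^ 2 = 1 → ((-15 / 16 : ℝ) : ℂ) ∈ half e → (z : ℂ) ∈ half e →
          Joined (inE base) (inP n z) := by
        intro e he ha hz
        have := simplyConnectedSpace_half he
        obtain ⟨γ⟩ : Joined (⟨_, ha⟩ : half e) ⟨z, hz⟩ := PathConnectedSpace.joined _ _
        have hc : Continuous fun y : half e => plane n y :=
          (continuousOn_plane n).comp_continuous continuous_subtype_val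
            fun y => inner_subset_pants (half_subset_inner he y.2)
        have h1 : Joined (plane n ((-15 / 16 : ℝ) : ℂ)) (plane n z) := ⟨γ.map hc⟩
        rw [plane_eq] at h1
        refine .trans (joined_of_mem_near ?_) h1
        refine ⟨0, ?_⟩
        rw [tau_plane (half_subset_inner he ha)]
        simp only [collar, mem_ofPred_eq, Complex.ofReal_re, Complex.ofReal_im]
        norm_num
      have ha := ofReal_mem_left (x := -15 / 16) (by norm_num) (by norm_num)
      rcases inner_subset hz with h | h
      · exact key 1 (by norm_num) ha.1 h
      · exact key (-1) (by norm_num) ha.2 h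

/-- Paths from the base point to each point, extending those in the Hawaiian Earring. -/
def frameP (x : HawaiianPants) : Path (inE base) x :=
  open Classical in
  if h : ∃ w, inE w = x then ((frame h.choose).map inE.continuous).cast rfl h.choose_spec.symm
    else (joined_base x).somePath

theorem frameP_inE (w : earring) : frameP (inE w) = (frame w).map inE.continuous := by
  have h : ∃ v, inE v = inE w := ⟨w, rfl⟩
  have key : ∀ v (hv : inE v = inE w),
      ((frame v).map inE.continuous).cast rfl hv.symm = (frame w).map inE.continuous := by
    intro v hv
    obtain rfl := inE_injective hv
    rfl
  rw [frameP, dif_pos h]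
  exact key _ h.choose_spec

theorem frameP_base : frameP (inE base) = Path.refl (inE base) := by
  rw [frameP_inE, frame_base]
  rfl

/-- The fundamental group of the Hawaiian Pants. -/
abbrev PantsLoops : Type := LoopGroup HawaiianPants (inE base)

/-- The class of a path closed up by the standard paths from the base point. -/
def kap (γ : C(I, HawaiianPants)) : PantsLoops := frameClass frameP γ

theorem isHomOn_kap : IsHomOn univ kap := isHomOn_frameClass frameP

theorem kap_loop (γ : Path (inE base) (inE base)) : kap γ.toContinuousMap = LoopGroup.mk γ :=
  frameClass_loop frameP frameP_base γ

/-- The homomorphism induced by the inclusion of the Hawaiian Earring. -/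
def iota : EarringGroup →* PantsLoops := LoopGroup.map inE rfl

theorem kap_inE (δ : C(I, earring)) : kap (inE.comp δ) = iota (kappa δ) := by
  have e0 : frameP ((inE.comp δ) 0) = (frame (δ 0)).map inE.continuous := frameP_inE _
  have e1 : frameP ((inE.comp δ) 1) = (frame (δ 1)).map inE.continuous := frameP_inE _
  rw [kap, frameClass, e0, e1, kappa, frameClass, iota, LoopGroup.map_mk, Path.map_trans,
    Path.map_trans, Path.map_symm]
  rfl

/-- The class of the path from the image of a point under the retraction to the point. -/
def reach (x : HawaiianPants) : PantsLoops := kap (beam x)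

theorem reach_inE (w : earring) : reach (inE w) = 1 := isHomOn_kap.const _ (mem_univ _)

theorem kap_near {γ : C(I, HawaiianPants)} (h : ∀ t, γ t ∈ near) :
    reach (γ 0) * kap γ = iota (kappa (mapOn continuousOn_retract γ h)) * reach (γ 1) := by
  rw [← kap_inE]
  exact map_beam isHomOn_kap h

theorem continuousOn_plane_inner (n : ℕ+) : ContinuousOn (plane n) inner :=
  (continuousOn_plane n).mono inner_subset_pants

/-- The class of the image of a path in the interior of the pair of pants. -/
def kapPlane (n : ℕ+) : C(I, ℂ) → PantsLoops := pullback (continuousOn_plane_inner n) kap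

theorem isHomOn_kapPlane (n : ℕ+) : IsHomOn inner (kapPlane n) :=
  isHomOn_kap.pullback (continuousOn_plane_inner n)

theorem mapOn_plane_tau {γ : C(I, HawaiianPants)} (h : ∀ t, tau (γ t) ∈ inner) :
    mapOn (continuousOn_plane_inner (nu (γ 0))) (mapOn continuousOn_tau γ h) h = γ := by
  ext1 t
  change plane (nu (γ 0)) (tau (γ t)) = γ t
  rw [← nu_path h t, plane_nu_tau (h t)]

theorem kap_tau {γ : C(I, HawaiianPants)} (h : ∀ t, tau (γ t) ∈ inner) :
    kap γ = kapPlane (nu (γ 0)) (mapOn continuousOn_tau γ h) := by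
  rw [kapPlane, pullback_eq _ _ _ h, mapOn_plane_tau h]

theorem plane_mem_near {n : ℕ+} {z : ℂ} {j : Fin 3} (h : z ∈ inner) (hj : z ∈ collar j) :
    plane n z ∈ near ∧ retract (plane n z) = ring (circ n j) (z - cen j) := by
  refine ⟨⟨j, by rwa [tau_plane h]⟩, ?_⟩
  rw [retract_eq (j := j) (by rwa [tau_plane h]) (by rwa [tau_plane h]), tau_plane h, nu_plane h]

theorem map_shade {Q R : Type*} [Group Q] [Group R] (ψ : Q →* R) (l : Fin 3 → Q) (j : Fin 3) (z : ℂ) :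
    ψ (shade l j z) = shade (ψ ∘ l) j z := by
  rw [shade, shade]
  split_ifs <;> simp

/-- With `kapPlane_lower` this supplies the boundary potentials of `exists_halves`: retracting to
the earring turns classes near the boundary into known earring classes. -/
theorem kapPlane_upper (n : ℕ+) (j : Fin 3) (γ : C(I, ℂ)) (h : ∀ t, γ t ∈ collar j ∩ half 1) :
    reach (plane n (γ 0)) * kapPlane n γ = reach (plane n (γ 1)) := by
  have hi : ∀ t, γ t ∈ inner := fun t => half_subset_inner (by norm_num) (h t).2
  have hn := fun t => plane_mem_near (n := n) (hi t) (h t).1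
  have := kap_near (γ := mapOn (continuousOn_plane_inner n) γ hi) fun t => (hn t).1
  rw [kappa_rim_upper h fun t => (hn t).2, map_one, one_mul] at this
  rw [kapPlane, pullback_eq _ _ _ hi]
  exact this

theorem kapPlane_lower (n : ℕ+) (j : Fin 3) (γ : C(I, ℂ)) (h : ∀ t, γ t ∈ collar j ∩ half (-1)) :
    shade (iota ∘ loopL ∘ circ n) j (γ 0) * reach (plane n (γ 0)) * kapPlane n γ =
      shade (iota ∘ loopL ∘ circ n) j (γ 1) * reach (plane n (γ 1)) := by
  have hi : ∀ t, γ t ∈ inner := fun t => half_subset_inner (by norm_num) (h t).2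
  have hn := fun t => plane_mem_near (n := n) (hi t) (h t).1
  have := kap_near (γ := mapOn (continuousOn_plane_inner n) γ hi) fun t => (hn t).1
  rw [kappa_rim_lower h fun t => (hn t).2, map_mul, map_inv, map_shade, map_shade, mul_assoc,
    eq_inv_mul_iff_mul_eq, ← mul_assoc] at this
  rw [kapPlane, pullback_eq _ _ _ hi]
  exact this

/-- The class of the seam between the first and the second boundary circle. -/
def seamX (n : ℕ+) : PantsLoops :=
  seam (kapPlane n) (fun z => reach (plane n z)) (-13 / 16) (-15 / 16)

/-- The class of the seam between the first and the third boundary circle. -/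
def seamY (n : ℕ+) : PantsLoops :=
  seam (kapPlane n) (fun z => reach (plane n z)) (13 / 16) (15 / 16)

/-- The cover of the Hawaiian Pants by the neighborhood of the Hawaiian Earring and the two halves of
the pairs of pants. -/
def cover : Option Bool → Set HawaiianPants
  | none => near
  | some b => {x | tau x ∈ half (bif b then 1 else -1)}

theorem isOpen_cover (i : Option Bool) : IsOpen (cover i) := by
  match i with
  | none => exact isOpen_near
  | some true => exact isOpen_tau (isOpen_half _) (half_subset_inner (by norm_num))
  | some false => exact isOpen_tau (isOpen_half _) (half_subset_inner (by norm_num))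

theorem exists_mem_cover (x : HawaiianPants) : ∃ i, x ∈ cover i := by
  by_cases hx : x ∈ near
  · exact ⟨none, hx⟩
  · have h : tau x ∈ inner := by
      obtain ⟨w, rfl⟩ | ⟨n, z, rfl⟩ := exists_rep x
      · exact absurd (inE_mem_near w) hx
      · rw [tau_inP_mem subset_rfl]
        by_contra h
        exact hx (inP_mem_near.2 (exists_collar z.2 h))
    rcases inner_subset h with h | h
    · exact ⟨some true, h⟩
    · exact ⟨some false, h⟩

theorem pants_rel (n : ℕ+) : iota (loopL n) =
    (seamY n)⁻¹ * iota (loopL (2 * n + 1)) * seamY n *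
      ((seamX n)⁻¹ * iota (loopL (2 * n)) * seamX n) :=
  (exists_halves (k := fun z => reach (plane n z)) (l := iota ∘ loopL ∘ circ n)
    (isHomOn_kapPlane n) (kapPlane_upper n) (kapPlane_lower n) rfl rfl).1

theorem pants_gen : Subgroup.closure (range iota ∪ range seamX ∪ range seamY) = ⊤ := by
  classical
  rw [eq_top_iff]
  set T := Subgroup.closure (range iota ∪ range seamX ∪ range seamY)
  have hι : ∀ b, iota b ∈ T := fun b => Subgroup.subset_closure (.inl (.inl ⟨b, rfl⟩))
  choose u d hu hd hku hkd hud using fun n =>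
    (exists_halves (k := fun z => reach (plane n z)) (l := iota ∘ loopL ∘ circ n)
    (isHomOn_kapPlane n) (kapPlane_upper n) (kapPlane_lower n) rfl rfl).2 T
      (Subgroup.subset_closure (.inl (.inr ⟨n, rfl⟩))) (Subgroup.subset_closure (.inr ⟨n, rfl⟩))
      fun j => hι _
  -- A frame for each point is chosen from the potentials of the three kinds of sets in the cover.
  -- On overlaps they differ by elements of `T`, so the order of preference is irrelevant.
  let α (x : HawaiianPants) : PantsLoops := if x ∈ near then reach x else
    if tau x ∈ half 1 then u (nu x) (tau x) else d (nu x) (tau x)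
  have hαu : ∀ x, tau x ∈ half 1 → α x * (u (nu x) (tau x))⁻¹ ∈ T := by
    intro x hx
    simp only [α]
    split_ifs with h
    · obtain ⟨j, hj⟩ := h
      have := T.inv_mem (hku (nu x) j _ ⟨hj, hx⟩)
      rwa [plane_nu_tau (half_subset_inner (by norm_num) hx), mul_inv_rev, inv_inv] at this
    · rw [mul_inv_cancel]; exact T.one_mem
  have hαd : ∀ x, tau x ∈ half (-1) → α x * (d (nu x) (tau x))⁻¹ ∈ T := by
    intro x hx
    simp only [α]
    split_ifs with h h'
    · obtain ⟨j, hj⟩ := h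
      have := T.inv_mem (hkd (nu x) j _ ⟨hj, hx⟩)
      rwa [plane_nu_tau (half_subset_inner (by norm_num) hx), mul_inv_rev, inv_inv] at this
    · exact hud _ _ ⟨h', hx⟩
    · rw [mul_inv_cancel]; exact T.one_mem
  rintro g -
  obtain ⟨γ, rfl⟩ := LoopGroup.mk_surjective g
  have hm := IsHomOn.mem_of_cover isOpen_cover exists_mem_cover isHomOn_kap T α (fun i γ hγ => by
    have key : ∀ (h : ∀ t, tau (γ t) ∈ inner) (w : ℕ+ → ℂ → PantsLoops)
        (h0 : α (γ 0) * (w (nu (γ 0)) (tau (γ 0)))⁻¹ ∈ T)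
        (h1 : α (γ 1) * (w (nu (γ 1)) (tau (γ 1)))⁻¹ ∈ T)
        (hw : w (nu (γ 0)) (tau (γ 0)) * kapPlane (nu (γ 0)) (mapOn continuousOn_tau γ h) =
          w (nu (γ 0)) (tau (γ 1))), α (γ 0) * kap γ * (α (γ 1))⁻¹ ∈ T := by
      intro h w h0 h1 hw
      rw [nu_path h 1, ← hw] at h1
      rw [kap_tau h]
      convert T.mul_mem h0 (T.inv_mem h1) using 1
      group
    match i with
    | none =>
      have e : ∀ t, α (γ t) = reach (γ t) := fun t => if_pos (hγ t)
      rw [e, e, kap_near hγ, mul_inv_cancel_right]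
      exact hι _
    | some true =>
      have h := fun t => half_subset_inner (by norm_num) (hγ t)
      exact key h u (hαu _ (hγ 0)) (hαu _ (hγ 1)) (hu _ (mapOn continuousOn_tau γ h) hγ)
    | some false =>
      have h := fun t => half_subset_inner (by norm_num) (hγ t)
      exact key h d (hαd _ (hγ 0)) (hαd _ (hγ 1)) (hd _ (mapOn continuousOn_tau γ h) hγ))
    γ.toContinuousMap
  have h1 : α (inE base) = 1 := (if_pos (inE_mem_near base)).trans (reach_inE base)
  rw [kap_loop, Path.coe_toContinuousMap, γ.source, γ.target, h1] at hm
  simpa using hm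

theorem col_path {ζ : C(I, ℂ)} (h : ∀ t, ∃ j, ζ t ∈ collar j) (t : I) : ζ t ∈ collar (col (ζ 0)) := by
  have : IsLocallyConstant fun t => col (ζ t) := by
    rw [IsLocallyConstant.iff_eventually_eq]
    intro t
    obtain ⟨j, hj⟩ := h t
    filter_upwards [ζ.continuous.continuousAt.eventually ((isOpen_collar j).mem_nhds hj)] with s hs
    rw [col_eq hs, col_eq hj]
  rw [← this.apply_eq_of_preconnectedSpace t 0]
  obtain ⟨j, hj⟩ := h t
  rwa [col_eq hj]

/-- The universal property of the fundamental group of the Hawaiian Pants. -/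
theorem pants_lift (Q : Type) [Group Q] (ψ : EarringGroup →* Q) (x y : ℕ+ → Q)
    (hxy : ∀ n, ψ (loopL n) =
      (y n)⁻¹ * ψ (loopL (2 * n + 1)) * y n * ((x n)⁻¹ * ψ (loopL (2 * n)) * x n)) :
    ∃ Φ : PantsLoops →* Q, (∀ b, Φ (iota b) = ψ b) ∧ (∀ n, Φ (seamX n) = x n) ∧
      ∀ n, Φ (seamY n) = y n := by
  let l (n : ℕ+) : Fin 3 → Q := ψ ∘ loopL ∘ circ n
  let s (p : HawaiianPants) : Q := triple 1 (x (nu p)) (y (nu p)) (col (tau p))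
  let f (p : HawaiianPants) : Q := lower (l (nu p)) (x (nu p)) (tau p)
  -- The upper halves are made trivial. The prescribed seam values then enter as the frame change
  -- `s` near the boundary circles, and the lower halves have the potential that this forces.
  let φ : Option Bool → C(I, HawaiianPants) → Q
    | none => fun γ => (s (γ 0))⁻¹ * ψ (pullback continuousOn_retract kappa γ) * s (γ 1)
    | some true => fun _ => 1
    | some false => fun γ => (f (γ 0))⁻¹ * f (γ 1)
  have hφ : ∀ i, IsHomOn (cover i) (φ i) := fun i => match i with
    | none => ((isHomOn_kappa.pullback continuousOn_retract).comp ψ).conj s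
    | some true => isHomOn_one _
    | some false => isHomOn_potential _ f
  have hcol : ∀ γ : C(I, HawaiianPants), (∀ t, γ t ∈ near) → ∀ h : (∀ t, tau (γ t) ∈ inner),
      ∀ t, tau (γ t) ∈ collar (col (tau (γ 0))) := fun γ h1 h =>
    col_path (ζ := mapOn continuousOn_tau γ h) h1
  have hret : ∀ γ : C(I, HawaiianPants), (∀ t, γ t ∈ near) → ∀ h : (∀ t, tau (γ t) ∈ inner),
      ∀ t, retract (γ t) = ring (circ (nu (γ 0)) (col (tau (γ 0))))
        (tau (γ t) - cen (col (tau (γ 0)))) := fun γ h1 h t => by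
    rw [retract_eq (h t) (hcol γ h1 h t), nu_path h t]
  have hs : ∀ γ : C(I, HawaiianPants), (∀ t, γ t ∈ near) → (∀ t, tau (γ t) ∈ inner) →
      s (γ 1) = s (γ 0) := fun γ h1 h => by
    simp only [s]
    rw [nu_path h 1, col_eq (hcol γ h1 h 1)]
  have a1 : ∀ γ, (∀ t, γ t ∈ cover none) → (∀ t, γ t ∈ cover (some true)) →
      φ none γ = φ (some true) γ := by
    intro γ (h1 : ∀ t, γ t ∈ near) h2
    have h := fun t => half_subset_inner (by norm_num) (h2 t)
    have hk := kappa_rim_upper (γ := mapOn continuousOn_tau γ h)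
      (fun t => ⟨hcol γ h1 h t, h2 t⟩) (δ := mapOn continuousOn_retract γ h1) (hret γ h1 h)
    change (s (γ 0))⁻¹ * ψ (pullback continuousOn_retract kappa γ) * s (γ 1) = 1
    rw [pullback_eq _ _ _ h1, hk, hs γ h1 h]
    simp
  have a2 : ∀ γ, (∀ t, γ t ∈ cover none) → (∀ t, γ t ∈ cover (some false)) →
      φ none γ = φ (some false) γ := by
    intro γ (h1 : ∀ t, γ t ∈ near) h2
    have h := fun t => half_subset_inner (by norm_num) (h2 t)
    have hk := kappa_rim_lower (γ := mapOn continuousOn_tau γ h)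
      (fun t => ⟨hcol γ h1 h t, h2 t⟩) (δ := mapOn continuousOn_retract γ h1) (hret γ h1 h)
    change (s (γ 0))⁻¹ * ψ (pullback continuousOn_retract kappa γ) * s (γ 1) = (f (γ 0))⁻¹ * f (γ 1)
    obtain ⟨g, hg⟩ := lower_collar (l := l (nu (γ 0))) (hxy (nu (γ 0))) (col (tau (γ 0)))
    have hf : ∀ t, f (γ t) = g * shade (l (nu (γ 0))) (col (tau (γ 0))) (tau (γ t)) * s (γ 0) :=
      fun t => by
        simp only [f]
        rw [nu_path h t]
        exact hg _ (hcol γ h1 h t)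
    rw [pullback_eq _ _ _ h1, hk, hs γ h1 h, hf, hf, map_mul, map_inv, map_shade, map_shade]
    change (s (γ 0))⁻¹ * ((shade (l (nu (γ 0))) (col (tau (γ 0))) (tau (γ 0)))⁻¹ *
      shade (l (nu (γ 0))) (col (tau (γ 0))) (tau (γ 1))) * s (γ 0) = _
    group
  have a3 : ∀ γ, (∀ t, γ t ∈ cover (some true)) → (∀ t, γ t ∈ cover (some false)) →
      φ (some true) γ = φ (some false) γ := by
    intro γ h1 h2
    have h := fun t => half_subset_inner (by norm_num) (h1 t)
    have := lower_path (γ := mapOn continuousOn_tau γ h) h1 h2 (l (nu (γ 0))) (x (nu (γ 0)))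
    change 1 = (lower (l (nu (γ 0))) (x (nu (γ 0))) (tau (γ 0)))⁻¹ *
      lower (l (nu (γ 1))) (x (nu (γ 1))) (tau (γ 1))
    rw [nu_path h 1, eq_inv_mul_iff_mul_eq, mul_one]
    exact this
  obtain ⟨Φ, hΦ, hΦφ⟩ := exists_isHomOn_univ isOpen_cover exists_mem_cover hφ (by
    rintro (_ | _ | _) (_ | _ | _) γ h1 h2
    · rfl
    · exact a2 γ h1 h2
    · exact a1 γ h1 h2
    · exact (a2 γ h2 h1).symm
    · rfl
    · exact (a3 γ h2 h1).symm
    · exact (a1 γ h2 h1).symm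
    · exact a3 γ h1 h2
    · rfl)
  have sE : ∀ w, s (inE w) = 1 := fun w => by
    simp only [s]
    rw [tau_inE, col_eq five_mem_collar]
    rfl
  have hE : ∀ δ : C(I, earring), Φ (inE.comp δ) = ψ (kappa δ) := by
    intro δ
    have hn : ∀ t, inE.comp δ t ∈ near := fun t => inE_mem_near _
    rw [hΦφ none _ hn]
    change (s (inE (δ 0)))⁻¹ * ψ (pullback continuousOn_retract kappa (inE.comp δ)) * s (inE (δ 1)) = _
    rw [sE, sE, pullback_eq _ _ _ hn, inv_one, one_mul, mul_one]
    rfl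
  have hfr : ∀ w, Φ (frameP (inE w)).toContinuousMap = 1 := fun w => by
    rw [frameP_inE]
    exact (hE _).trans (by rw [kappa_frame, map_one])
  have hbeam : ∀ p ∈ near, Φ (beam p) = s p := by
    intro p hp
    have hn := beam_mem_near hp
    rw [hΦφ none _ fun t => (hn t).1]
    change (s (beam p 0))⁻¹ * ψ (pullback continuousOn_retract kappa (beam p)) * s (beam p 1) = _
    have : mapOn continuousOn_retract (beam p) (fun t => (hn t).1) =
        ContinuousMap.const I (retract p) := by
      ext1 t; exact (hn t).2
    rw [pullback_eq _ _ _ fun t => (hn t).1, this, isHomOn_kappa.const _ (mem_univ _), beam_zero hp,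
      beam_one hp, sE]
    simp
  -- A seam runs in an upper half, where the homomorphism is trivial, so its value comes from the
  -- two beams at its ends alone.
  have hline : ∀ (n : ℕ+) (a b : ℝ), (∀ t, line a b t ∈ half 1) → (a : ℂ) ∈ collar (col a) →
      (b : ℂ) ∈ collar (col b) →
      hΦ.toHom (inE base) (seam (kapPlane n) (fun z => reach (plane n z)) a b) =
        triple 1 (x n) (y n) (col a) * (triple 1 (x n) (y n) (col b))⁻¹ := by
    intro n a b h ha hb
    have hi := fun t => half_subset_inner (by norm_num) (h t)
    have e0 : line a b 0 = (a : ℂ) := by simp [line]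
    have e1 : line a b 1 = (b : ℂ) := by simp [line]
    have ia : (a : ℂ) ∈ inner := e0 ▸ hi 0
    have ib : (b : ℂ) ∈ inner := e1 ▸ hi 1
    have na := (plane_mem_near (n := n) ia ha).1
    have nb := (plane_mem_near (n := n) ib hb).1
    have hγ : ∀ t, mapOn (continuousOn_plane_inner n) (line a b) hi t ∈ cover (some true) := by
      intro t
      change tau (plane n (line a b t)) ∈ half 1
      rw [tau_plane (hi t)]
      exact h t
    have p0 : mapOn (continuousOn_plane_inner n) (line a b) hi 0 = plane n a := congrArg (plane n) e0
    have p1 : mapOn (continuousOn_plane_inner n) (line a b) hi 1 = plane n b := congrArg (plane n) e1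
    have hs : ∀ z : ℂ, z ∈ inner → s (plane n z) = triple 1 (x n) (y n) (col z) := fun z hz => by
      simp only [s]
      rw [tau_plane hz, nu_plane hz]
    rw [seam, kapPlane, pullback_eq _ _ _ hi, map_mul, map_mul, map_inv, reach, reach, kap, kap, kap,
      hΦ.toHom_frameClass, hΦ.toHom_frameClass, hΦ.toHom_frameClass, hΦφ (some true) _ hγ, hbeam _ na,
      hbeam _ nb, beam_zero na, beam_zero nb, hfr, hfr, beam_one na, beam_one nb, p0, p1, hs _ ia,
      hs _ ib]
    change 1 * _ * _ * (_ * 1 * _) * _ = _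
    group
  refine ⟨hΦ.toHom (inE base), fun b => ?_, fun n => ?_, fun n => ?_⟩
  · obtain ⟨γ, rfl⟩ := LoopGroup.mk_surjective b
    rw [iota, LoopGroup.map_mk, hΦ.toHom_mk, ← kappa_loop, ← hE]
    rfl
  · have h := fun t => (rect_subset (a := -1) (b := -(3 / 4)) (c := 1 / 3) (by norm_num)
      (line_mem_rect (x := -13 / 16) (y := -15 / 16)
        (ofReal_mem_rect (by norm_num) (by norm_num) (by norm_num) (by norm_num))
        (ofReal_mem_rect (by norm_num) (by norm_num) (by norm_num) (by norm_num)) t)).1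
    have c1 : ((-13 / 16 : ℝ) : ℂ) ∈ collar 1 := by
      simp only [collar, mem_ofPred_eq, Complex.ofReal_re, Complex.ofReal_im]; norm_num
    have c0 : ((-15 / 16 : ℝ) : ℂ) ∈ collar 0 := by
      simp only [collar, mem_ofPred_eq, Complex.ofReal_re, Complex.ofReal_im]; norm_num
    rw [seamX, hline n _ _ h (by rwa [col_eq c1]) (by rwa [col_eq c0]), col_eq c1, col_eq c0]
    simp [triple]
  · have h := fun t => (rect_subset (a := 3 / 4) (b := 1) (c := 1 / 3) (by norm_num)
      (line_mem_rect (x := 13 / 16) (y := 15 / 16)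
        (ofReal_mem_rect (by norm_num) (by norm_num) (by norm_num) (by norm_num))
        (ofReal_mem_rect (by norm_num) (by norm_num) (by norm_num) (by norm_num)) t)).1
    have c1 : ((13 / 16 : ℝ) : ℂ) ∈ collar 2 := by
      simp only [collar, mem_ofPred_eq, Complex.ofReal_re, Complex.ofReal_im]; norm_num
    have c0 : ((15 / 16 : ℝ) : ℂ) ∈ collar 0 := by
      simp only [collar, mem_ofPred_eq, Complex.ofReal_re, Complex.ofReal_im]; norm_num
    rw [seamY, hline n _ _ h (by rwa [col_eq c1]) (by rwa [col_eq c0]), col_eq c1, col_eq c0]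
    simp [triple]

/-- The structure of the fundamental group of the Hawaiian Pants. -/
def pantsGroup : PantsGroup EarringGroup PantsLoops where
  ι := iota
  X := seamX
  Y := seamY
  L := loopL
  r := collapseHom
  rel := pants_rel
  gen := pants_gen
  lift := pants_lift
  liftB := exists_lift_earring
  genB := closure_collapse_loopL
  r_L _ _ h := collapseHom_loopL_of_lt h
  r_r _ _ h b := collapseHom_collapseHom h b
  eq_one _ := eq_one_of_collapseHom

end HawaiianPants

/-! ### Discrete monodromy -/

namespace PathClass

variable {X : Type*} [TopologicalSpace X] {x₀ : X}

theorem mk_bot_eq {x : X} {α α' : Path x₀ x} :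
    mk (⊥ : Subgroup (FundamentalGroup X x₀)) α = mk ⊥ α' ↔ α.Homotopic α' := by
  have h1 : mk (⊥ : Subgroup (FundamentalGroup X x₀)) α = mk ⊥ α' ↔ Rel ⊥ ⟨x, α⟩ ⟨x, α'⟩ :=
    Quotient.eq (r := setoid ⊥)
  rw [h1, rel_mk, Subgroup.mem_bot, ← Path.Homotopic.Quotient.eq]
  change Path.Homotopic.Quotient.mk (α.trans α'.symm) = Path.Homotopic.Quotient.refl x₀ ↔ _
  rw [Path.Homotopic.Quotient.mk_trans, Path.Homotopic.Quotient.mk_symm]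
  constructor
  · intro h
    have := congrArg (fun a => a.trans (Path.Homotopic.Quotient.mk α')) h
    simpa using this
  · intro h
    rw [h, Path.Homotopic.Quotient.trans_symm]

theorem isOpen_basicOpen (H : Subgroup (FundamentalGroup X x₀)) {x : X} (α : Path x₀ x) {U : Set X}
    (hU : IsOpen U) (hx : x ∈ U) : IsOpen (basicOpen H α U) :=
  TopologicalSpace.isOpen_generateFrom_of_mem ⟨x, α, U, hU, hx, rfl⟩

theorem mem_basicOpen {x : X} (α : Path x₀ x) {U : Set X}
    (hx : x ∈ U) {β : Path x₀ x} (h : α.Homotopic β) : mk ⊥ β ∈ basicOpen ⊥ α U :=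
  ⟨x, Path.refl x, by simpa using hx, mk_bot_eq.2 (h.symm.trans ⟨(Path.Homotopy.transRefl α).symm⟩)⟩

theorem exists_of_mem_basicOpen {H : Subgroup (FundamentalGroup X x₀)} {x : X} {α : Path x₀ x}
    {U : Set X} {e : Space H} (h : e ∈ basicOpen H α U) (he : proj H e = x) :
    ∃ δ : Path x x, range δ ⊆ U ∧ e = mk H (α.trans δ) := by
  obtain ⟨z, γ, hγ, rfl⟩ := h
  obtain rfl : z = x := he
  exact ⟨γ, hγ, rfl⟩

theorem exists_fiber {H : Subgroup (FundamentalGroup X x₀)} {x : X} (e : Fiber H x) :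
    ∃ α : Path x₀ x, e = ⟨mk H α, rfl⟩ := by
  obtain ⟨e, he⟩ := e
  obtain ⟨⟨z, α⟩, rfl⟩ := Quotient.exists_rep e
  obtain rfl : z = x := he
  exact ⟨α, rfl⟩

/-- A local criterion for the discrete monodromy property. -/
theorem discreteMonodromyProperty_of
    (h : ∀ (x y : X) (β : Path x y), (∃ hxy : x = y, β.Homotopic ((Path.refl x).cast rfl hxy.symm)) ∨
      ∃ U V : Set X, IsOpen U ∧ x ∈ U ∧ IsOpen V ∧ y ∈ V ∧ ∀ (δ : Path x x) (ε : Path y y),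
        range δ ⊆ U → range ε ⊆ V → (δ.trans β).Homotopic (β.trans ε) →
          δ.Homotopic (Path.refl x)) : DiscreteMonodromyProperty X := by
  intro x₀ x y β
  obtain ⟨hxy, hβ⟩ | ⟨U, V, hU, hx, hV, hy, hUV⟩ := h x y β
  · left
    subst hxy
    intro e
    obtain ⟨α, rfl⟩ := exists_fiber e
    rw [monodromy_mk]
    exact mk_bot_eq.2 (((Path.Homotopic.refl α).hcomp hβ).trans ⟨Path.Homotopy.transRefl α⟩)
  · right
    refine IsDiscrete.of_nhdsWithin ?_
    rintro ⟨e, e'⟩ he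
    obtain ⟨α, rfl⟩ := exists_fiber e
    obtain rfl : ⟨mk ⊥ (α.trans β), rfl⟩ = e' := he
    rw [Filter.le_pure_iff, mem_nhdsWithin]
    -- A graph point in this neighborhood yields δ in U and ε in V; cancelling α leaves δ·β ≃ β·ε.
    -- Once δ is trivial the first entry is ⟨α⟩, and the graph determines the second.
    refine ⟨{q | (q.1 : Space _) ∈ basicOpen ⊥ α U ∧ (q.2 : Space _) ∈ basicOpen ⊥ (α.trans β) V},
      ?_, ⟨mem_basicOpen α hx (.refl _), mem_basicOpen _ hy (.refl _)⟩, ?_⟩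
    · exact ((isOpen_basicOpen ⊥ α hU hx).preimage (by fun_prop)).inter
        ((isOpen_basicOpen ⊥ _ hV hy).preimage (by fun_prop))
    · rintro ⟨⟨e1, p1⟩, ⟨e2, p2⟩⟩ ⟨⟨h1, h2⟩, h3⟩
      obtain ⟨δ, hδ, rfl⟩ := exists_of_mem_basicOpen h1 p1
      obtain ⟨ε, hε, rfl⟩ := exists_of_mem_basicOpen h2 p2
      have h4 : mk ⊥ ((α.trans δ).trans β) = mk ⊥ ((α.trans β).trans ε) := congrArg Subtype.val h3
      rw [mk_bot_eq, ← Path.Homotopic.Quotient.eq] at h4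
      simp only [Path.Homotopic.Quotient.mk_trans, Path.Homotopic.Quotient.trans_assoc] at h4
      have h5 := congrArg (fun a => (Path.Homotopic.Quotient.mk α).symm.trans a) h4
      simp only [← Path.Homotopic.Quotient.trans_assoc, Path.Homotopic.Quotient.symm_trans,
        Path.Homotopic.Quotient.refl_trans] at h5
      have h6 := hUV δ ε hδ hε (Path.Homotopic.Quotient.eq.1 h5)
      have h7 : mk ⊥ (α.trans δ) = mk ⊥ α :=
        mk_bot_eq.2 (((Path.Homotopic.refl α).hcomp h6).trans ⟨Path.Homotopy.transRefl α⟩)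
      have h8 : (⟨mk ⊥ (α.trans δ), p1⟩ : Fiber ⊥ x) = ⟨mk ⊥ α, rfl⟩ := Subtype.ext h7
      refine Prod.ext h8 ?_
      exact h3.symm.trans (congrArg (monodromy ⊥ β) h8)

end PathClass

/-! ### Small loops in the Hawaiian Pants -/

namespace HawaiianPants

theorem homotopic_refl_of_kap {x : HawaiianPants} {δ : Path x x} (h : kap δ.toContinuousMap = 1) :
    δ.Homotopic (Path.refl x) := by
  rw [kap, frameClass_path] at h
  change Path.Homotopic.Quotient.mk _ = Path.Homotopic.Quotient.refl _ at h
  rw [Path.Homotopic.Quotient.mk_trans, Path.Homotopic.Quotient.mk_trans,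
    Path.Homotopic.Quotient.mk_symm] at h
  have h1 := congrArg (fun a => a.trans (Path.Homotopic.Quotient.mk (frameP x))) h
  simp only [Path.Homotopic.Quotient.trans_assoc, Path.Homotopic.Quotient.symm_trans,
    Path.Homotopic.Quotient.trans_refl, Path.Homotopic.Quotient.refl_trans] at h1
  have h2 := congrArg (fun a => (Path.Homotopic.Quotient.mk (frameP x)).symm.trans a) h1
  simp only [← Path.Homotopic.Quotient.trans_assoc, Path.Homotopic.Quotient.symm_trans,
    Path.Homotopic.Quotient.refl_trans] at h2
  exact Path.Homotopic.Quotient.eq.1 h2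

/-- The class of a path in a half is a difference of values of a potential, and vanishes on loops.
-/
theorem homotopic_refl_of_half {e : ℝ} (he : e ^ 2 = 1) {x : HawaiianPants} (δ : Path x x)
    (h : ∀ t, tau (δ t) ∈ half e) : δ.Homotopic (Path.refl x) := by
  have hi : ∀ t, tau (δ.toContinuousMap t) ∈ inner := fun t => half_subset_inner he (h t)
  refine homotopic_refl_of_kap ?_
  rw [kap_tau hi]
  obtain ⟨u, hu⟩ := exists_potential (simplyConnectedSpace_half he)
    ((isHomOn_kapPlane (nu (δ.toContinuousMap 0))).mono (half_subset_inner he))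
  have h1 := hu (mapOn continuousOn_tau _ hi) h
  have h2 : mapOn continuousOn_tau _ hi 0 = mapOn continuousOn_tau _ hi 1 :=
    congrArg tau (δ.source.trans δ.target.symm)
  rw [h2] at h1
  exact mul_eq_left.1 h1

theorem eq_inE {n : ℕ+} {z : pants} (h : (z : ℂ) ∉ inner) : ∃ w, inE w = inP n z := by
  have key : ∃ j, ‖(z : ℂ) - cen j‖ ^ 2 = rad j ^ 2 := by
    obtain ⟨h1, h2, h3⟩ := mem_pants_iff.1 z.2
    by_contra! hn
    have n0 := hn 0
    have n1 := hn 1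
    have n2 := hn 2
    rw [norm_sub_cen_sq] at n0 n1 n2
    simp only [cen, rad, _root_.sub_zero, sub_neg_eq_add] at n0 n1 n2
    norm_num at n0 n1 n2 h2 h3
    refine h ⟨lt_of_le_of_ne h1 n0, ?_, ?_⟩ <;> norm_num
    · exact lt_of_le_of_ne h2 (Ne.symm n1)
    · exact lt_of_le_of_ne h3 (Ne.symm n2)
  obtain ⟨j, hj⟩ := key
  obtain ⟨t, ht⟩ := exists_bdry
    ((sq_eq_sq₀ (norm_nonneg _) (pos_of_mem_band (rad_mem_band j)).le).1 hj)
  refine ⟨ell (circ n j) t, ?_⟩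
  rw [← inP_bdry, Subtype.ext ht]

/-- Small loops away from the base point are null-homotopic. -/
theorem exists_nhds_of_ne {x : HawaiianPants} (hx : x ≠ inE base) :
    ∃ U, IsOpen U ∧ x ∈ U ∧ ∀ δ : Path x x, range δ ⊆ U → δ.Homotopic (Path.refl x) := by
  by_cases h : tau x ∈ inner
  · have key : ∀ e : ℝ, e ^ 2 = 1 → tau x ∈ half e → ∃ U, IsOpen U ∧ x ∈ U ∧
        ∀ δ : Path x x, range δ ⊆ U → δ.Homotopic (Path.refl x) := fun e he hxe =>
      ⟨_, isOpen_tau (isOpen_half e) (half_subset_inner he), hxe, fun δ hδ =>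
        homotopic_refl_of_half he δ fun t => hδ ⟨t, rfl⟩⟩
    rcases inner_subset h with h | h
    · exact key 1 (by norm_num) h
    · exact key (-1) (by norm_num) h
  · obtain ⟨w, rfl⟩ : ∃ w, inE w = x := by
      obtain h' | ⟨n, z, rfl⟩ := exists_rep x
      · exact h'
      · exact eq_inE fun hz => h ((tau_inP_mem subset_rfl).2 hz)
    -- Loops in this neighborhood retract to earring loops avoiding the base point, which have
    -- trivial class.
    refine ⟨_, continuousOn_retract.isOpen_inter_preimage isOpen_near isOpen_ne_base,
      ⟨inE_mem_near w, fun hw : w = base => hx (by rw [hw])⟩, fun δ hδ => homotopic_refl_of_kap ?_⟩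
    have h1 := kap_near (γ := δ.toContinuousMap) fun t => (hδ ⟨t, rfl⟩).1
    rw [kappa_of_ne_base (γ := mapOn continuousOn_retract δ.toContinuousMap _)
      fun t => (hδ ⟨t, rfl⟩).2] at h1
    rw [Path.coe_toContinuousMap, δ.source, δ.target, reach_inE] at h1
    simpa using h1

/-- The classes of small loops at the base point. -/
theorem exists_nhds_base (N : ℕ) :
    ∃ U, IsOpen U ∧ inE base ∈ U ∧ ∀ δ : Path (inE base) (inE base), range δ ⊆ U →
      LoopGroup.mk δ ∈ pantsGroup.tail N := by
  -- Loops here retract into `untop N`, and `side` is trivial at the base point, so their classes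
  -- come from the circles beyond N.
  refine ⟨_, continuousOn_retract.isOpen_inter_preimage isOpen_near (isOpen_untop N),
    ⟨inE_mem_near base, base_mem_untop N⟩, fun δ hδ => ?_⟩
  have h1 := kap_near (γ := δ.toContinuousMap) fun t => (hδ ⟨t, rfl⟩).1
  rw [kappa_untop (γ := mapOn continuousOn_retract δ.toContinuousMap _)
    fun t => (hδ ⟨t, rfl⟩).2] at h1
  have hs : side N loopL base = 1 := if_neg fun h => h.2.1 rfl
  have e0 : retract (δ.toContinuousMap 0) = base := by
    rw [Path.coe_toContinuousMap, δ.source, retract_inE]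
  have e1 : retract (δ.toContinuousMap 1) = base := by
    rw [Path.coe_toContinuousMap, δ.target, retract_inE]
  have m0 : ∀ h, mapOn continuousOn_retract δ.toContinuousMap h 0 = base := fun _ => e0
  have m1 : ∀ h, mapOn continuousOn_retract δ.toContinuousMap h 1 = base := fun _ => e1
  rw [m0, m1, hs, kap_loop, Path.coe_toContinuousMap, δ.source, δ.target, reach_inE, inv_one, one_mul,
    one_mul, mul_one, mul_one] at h1
  rw [h1]
  exact pantsGroup.ι_r_mem_tail N _

end HawaiianPants

end

theorem mainTheorem6 : DiscreteMonodromyProperty HawaiianPants := by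
  refine PathClass.discreteMonodromyProperty_of fun x y β => ?_
  by_cases hx : x = HawaiianPants.inE HawaiianPants.base
  · by_cases hy : y = HawaiianPants.inE HawaiianPants.base
    · subst hx hy
      by_cases hβ : LoopGroup.mk β = 1
      · exact .inl ⟨rfl, LoopGroup.mk_eq.1 hβ⟩
      · obtain ⟨N, hN⟩ : ∃ N, LoopGroup.mk β ∉ HawaiianPants.pantsGroup.tail N := by
          by_contra! h
          exact hβ (HawaiianPants.pantsGroup.eq_one_of_forall_mem_tail h)
        obtain ⟨U, hU, hpU, h⟩ := HawaiianPants.exists_nhds_base N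
        refine .inr ⟨U, U, hU, hpU, hU, hpU, fun δ ε hδ hε hδε => LoopGroup.mk_eq.1 ?_⟩
        -- Malnormality of the tail, applied to the classes of δ and ε and to that of β outside the
        -- tail.
        exact HawaiianPants.pantsGroup.eq_one_of_mul_eq_mul (h δ hδ) (h ε hε) hN
          (LoopGroup.mk_eq.2 hδε)
    · obtain ⟨V, hV, hyV, h⟩ := HawaiianPants.exists_nhds_of_ne hy
      -- A trivial ε suffices: δ·β ≃ β then makes δ trivial, with no smallness required of δ.
      refine .inr ⟨Set.univ, V, isOpen_univ, trivial, hV, hyV, fun δ ε _ hε hδε => ?_⟩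
      have h1 := hδε.trans ((Path.Homotopic.refl β).hcomp (h ε hε))
      rw [← Path.Homotopic.Quotient.eq] at h1 ⊢
      have h2 := congrArg (fun a => a.trans (Path.Homotopic.Quotient.mk β).symm) h1
      simpa using h2
  · obtain ⟨U, hU, hxU, h⟩ := HawaiianPants.exists_nhds_of_ne hx
    exact .inr ⟨U, Set.univ, hU, hxU, isOpen_univ, trivial, fun δ _ hδ _ _ => h δ hδ⟩
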